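/- Let $A$ be a finite alphabet. Words $u\in A^*$ have positions $1,\dots,|u|$. An $\mathrm{FO}^2$-formula is a first-order formula over the letter predicates $\mathbf a$ ($a\in A$), the order $<$ and equality that uses at most two (re-usable) variable symbols and has negation only on atomic formulas. A language $L\subseteq A^*$ is $\mathrm{FO}^2_m$-definable if it is the set of words satisfying some $\mathrm{FO}^2$-sentence such that, on every path from the root to a leaf of its parsing tree, the sequence of quantifiers encountered has at most $m$ blocks (maximal factors consisting only of $\exists$ or only of $\forall$). Let $\mathbf{FO}^2_m$ be the pseudovariety of finite monoids corresponding to these languages under Eilenberg's correspondence, i.e. the one generated by the syntactic monoids of the $\mathrm{FO}^2_m$-definable languages. A ranker is a non-empty word $r=Z_1\cdots Z_n$ over the alphabet $\{X_a,Y_a\mid a\in A\}$; $n$ is its depth, and its blocks are the maximal factors consisting only of letters $X_a$ or only of letters $Y_a$. For a word $u$ and $0\le q\le |u|+1$, $X_a(u,q)$ is the least $a$-position greater than $q$ and $Y_a(u,q)$ is the greatest $a$-position less than $q$, if they exist. The instructions of $r$ are executed from left to right, starting at $0$ if $Z_1$ is an $X$-letter and at $|u|+1$ if $Z_1$ is a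 $Y$-letter; if all steps are defined, $r$ is defined on $u$ and $r(u)$ is the last position reached. The ranker $r$ is condensed on $u$ if it is defined on $u$ and there is a strictly decreasing chain of open intervals $(0,|u|+1)=(i_0,j_0)\supset (i_1,j_1)\supset\cdots\supset(i_{n-1},j_{n-1})\ni r(u)$ such that for $1\le \ell\le n-1$ the interval $(i_\ell,j_\ell)$ is $(X_a(u,i_{\ell-1}),j_{\ell-1})$ if $Z_\ell Z_{\ell+1}=X_aX_b$, $(i_{\ell-1},Y_a(u,j_{\ell-1}))$ if $Z_\ell Z_{\ell+1}=Y_aY_b$, $(i_{\ell-1},X_a(u,i_{\ell-1}))$ if $Z_\ell Z_{\ell+1}=X_aY_b$, and $(Y_a(u,j_{\ell-1}),j_{\ell-1})$ if $Z_\ell Z_{\ell+1}=Y_aX_b$. For $n\ge m\ge 1$ write $u\mathrel{\triangleright}_{m,n}v$ (resp. $u\mathrel{\triangleleft}_{m,n}v$) if the same rankers are condensed on $u$ and on $v$ among the following ones: the rankers with exactly $m$ blocks and depth at most $n$ that start with an $X$-letter (resp. a $Y$-letter), and all rankers with fewer than $m$ blocks and depth less than $n$. These relations are congruences of finite index on $A^*$.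 Let $\mathbf R_m$ (resp. $\mathbf L_m$) be the pseudovariety of finite monoids generated by the quotients $A^*/{\triangleright}_{m,n}$ (resp. $A^*/{\triangleleft}_{m,n}$), for all $n\ge m$ and all finite alphabets $A$. Let $\mathcal R_m$ (resp. $\mathcal L_m$) be the class of languages recognized by a monoid in $\mathbf R_m$ (resp. $\mathbf L_m$). **Theorem.** Let $m\ge 1$. Every language in $\mathcal R_m$ or in $\mathcal L_m$ is $\mathrm{FO}^2_m$-definable, and every $\mathrm{FO}^2_m$-definable language is in $\mathcal R_{m+1}\cap\mathcal L_{m+1}$. Equivalently, $$\mathbf R_m\vee\mathbf L_m\subseteq \mathbf{FO}^2_m\subseteq \mathbf R_{m+1}\cap\mathbf L_{m+1},$$ where $\mathbf V\vee\mathbf W$ denotes the least pseudovariety containing $\mathbf V$ and $\mathbf W$. -/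

import Mathlib

/-!
Words over an alphabet `A` are lists, languages are Mathlib's `Language A`.
Positions in a word `w` are the natural numbers `1, …, w.length`.
-/

universe u

namespace FO2Alt

/-! ### Positions, blocks -/

/-- Position `i` (counted from `1`) of the word `w` carries the letter `a`. -/
def LetterAt {A : Type u} (w : List A) (i : ℕ) (a : A) : Prop :=
  1 ≤ i ∧ w[i - 1]? = some a

/-- The number of blocks of a sequence, a block being a maximal factor all of whose entries are
equal. -/
def blocks {α : Type} [DecidableEq α] : List α → ℕ
  | [] => 0
  | [_] => 1
  | x :: y :: l => (if x = y then 0 else 1) + blocks (y :: l)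

/-! ### Two-variable first-order logic over words -/

/-- The two quantifiers. -/
inductive Quant
  | ex
  | all
  deriving DecidableEq

/-- First-order formulas over the signature of words (a unary predicate for each letter, the order
`<`, and equality), with only two variable symbols (which may be re-used) and with negation only on
atomic formulas. -/
inductive Formula (A : Type u) : Type u
  | letter (a : A) (x : Fin 2)
  | notLetter (a : A) (x : Fin 2)
  | lt (x y : Fin 2)
  | notLt (x y : Fin 2)
  | eq (x y : Fin 2)
  | notEq (x y : Fin 2)
  | and (φ ψ : Formula A)
  | or (φ ψ : Formula A)
  | quant (q : Quant) (x : Fin 2) (φ : Formula A)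

namespace Formula

/-- The free variables of a formula. -/
def free {A : Type u} : Formula A → Finset (Fin 2)
  | letter _ x => {x}
  | notLetter _ x => {x}
  | lt x y => {x, y}
  | notLt x y => {x, y}
  | eq x y => {x, y}
  | notEq x y => {x, y}
  | and φ ψ => φ.free ∪ ψ.free
  | or φ ψ => φ.free ∪ ψ.free
  | quant _ x φ => φ.free.erase x

/-- The quantifier labels of the paths from the root to a leaf in the parsing tree. -/
def labels {A : Type u} : Formula A → List (List Quant)
  | and φ ψ => φ.labels ++ ψ.labels
  | or φ ψ => φ.labels ++ ψ.labels
  | quant q _ φ => φ.labels.map (fun l => q :: l)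
  | _ => [[]]

/-- Satisfaction of a formula in the word `w` under the valuation `ν`. Quantifiers range over the
positions `1, …, w.length`. -/
def Sat {A : Type u} (w : List A) : Formula A → (Fin 2 → ℕ) → Prop
  | letter a x, ν => LetterAt w (ν x) a
  | notLetter a x, ν => ¬ LetterAt w (ν x) a
  | lt x y, ν => ν x < ν y
  | notLt x y, ν => ¬ ν x < ν y
  | eq x y, ν => ν x = ν y
  | notEq x y, ν => ¬ ν x = ν y
  | and φ ψ, ν => φ.Sat w ν ∧ ψ.Sat w ν
  | or φ ψ, ν => φ.Sat w ν ∨ ψ.Sat w ν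
  | quant .ex x φ, ν => ∃ i, 1 ≤ i ∧ i ≤ w.length ∧ φ.Sat w (Function.update ν x i)
  | quant .all x φ, ν => ∀ i, 1 ≤ i → i ≤ w.length → φ.Sat w (Function.update ν x i)

end Formula

/-- `L` is defined by a two-variable sentence with at most `m` blocks of quantifiers along every
path of its parsing tree. (The truth value of a sentence does not depend on the valuation.) -/
def FO2Definable {A : Type u} (m : ℕ) (L : Language A) : Prop :=
  ∃ φ : Formula A, φ.free = ∅ ∧ (∀ l ∈ φ.labels, blocks l ≤ m) ∧
    ∀ (w : List A) (ν : Fin 2 → ℕ), w ∈ L ↔ φ.Sat w ν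

/-! ### Rankers and condensed rankers -/

/-- The directions of the instructions of a ranker: `X` moves to the right, `Y` to the left. -/
inductive Dir
  | X
  | Y
  deriving DecidableEq

/-- The instruction `X_a` (go to the next `a` to the right) or `Y_a` (go to the next `a` to the
left). -/
structure Step (A : Type u) : Type u where
  dir : Dir
  letter : A

/-- `z.Goes w q p`: the instruction `z`, started at `q`, is defined on `w` and leads to position
`p`; i.e. `p = X_a(w, q)` or `p = Y_a(w, q)`. -/
def Step.Goes {A : Type u} (w : List A) (z : Step A) (q p : ℕ) : Prop :=
  match z.dir with
  | .X => IsLeast {i | q < i ∧ LetterAt w i z.letter} p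
  | .Y => IsGreatest {i | i < q ∧ LetterAt w i z.letter} p

/-- `RunsTo w r q p`: the sequence of instructions `r`, started at `q`, is defined on `w` and leads
to position `p`. -/
def RunsTo {A : Type u} (w : List A) : List (Step A) → ℕ → ℕ → Prop
  | [], q, p => p = q
  | z :: r, q, p => ∃ q', z.Goes w q q' ∧ RunsTo w r q' p

/-- The starting position of an instruction sequence: `0` if it starts with an `X`-instruction and
`w.length + 1` if it starts with a `Y`-instruction. -/
def startPos {A : Type u} (w : List A) : List (Step A) → ℕ
  | [] => 0
  | z :: _ =>
    match z.dir with
    | .X => 0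
    | .Y => w.length + 1

/-- `Narrows w z z' i j i' j'`: performing the instruction `z`, to be followed by an instruction
`z'`, turns the open interval `(i, j)` into `(i', j')`. -/
def Narrows {A : Type u} (w : List A) (z z' : Step A) (i j i' j' : ℕ) : Prop :=
  match z.dir, z'.dir with
  | .X, .X => z.Goes w i i' ∧ j' = j
  | .Y, .Y => i' = i ∧ z.Goes w j j'
  | .X, .Y => i' = i ∧ z.Goes w i j'
  | .Y, .X => z.Goes w j i' ∧ j' = j

/-- The ranker `r` is condensed on `w`: it is defined on `w`, and there is a strictly decreasing
chain `(0, |w| + 1) = (i 0, j 0) ⊃ (i 1, j 1) ⊃ ⋯ ⊃ (i (n - 1), j (n - 1))` of open intervals, where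
`n` is the length of `r`, the last of which contains the position defined by `r`, and each of which
is obtained from the preceding one by the corresponding instruction of `r`. -/
def Condensed {A : Type u} (w : List A) (r : List (Step A)) : Prop :=
  ∃ p, RunsTo w r (startPos w r) p ∧
    ∃ i j : ℕ → ℕ, i 0 = 0 ∧ j 0 = w.length + 1 ∧
      (∀ (k : ℕ) (z z' : Step A), r[k]? = some z → r[k + 1]? = some z' →
        Set.Ioo (i (k + 1)) (j (k + 1)) ⊂ Set.Ioo (i k) (j k) ∧
        Narrows w z z' (i k) (j k) (i (k + 1)) (j (k + 1))) ∧
      p ∈ Set.Ioo (i (r.length - 1)) (j (r.length - 1))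

/-- The rankers (non-empty sequences of instructions) starting in direction `d`, with exactly `m`
blocks and of length (depth) exactly `n`. -/
def rankers (A : Type u) (d : Dir) (m n : ℕ) : Set (List (Step A)) :=
  {r | (r.map Step.dir).head? = some d ∧ blocks (r.map Step.dir) = m ∧ r.length = n}

/-- The rankers with `m` blocks, depth at most `n` and starting in direction `d`, together with all
rankers (starting in either direction) with fewer than `m` blocks and depth less than `n`. -/
def rankersLE (A : Type u) (d : Dir) (m n : ℕ) : Set (List (Step A)) :=
  {r | (∃ n' ≤ n, r ∈ rankers A d m n') ∨ ∃ d', ∃ m' < m, ∃ n' < n, r ∈ rankers A d' m' n'}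

/-- The words `v` and `w` agree on condensed rankers from `rankersLE A d m n`. For `d = X` this is
the relation `▷_{m,n}`, for `d = Y` it is `◁_{m,n}`. -/
def CondEquiv {A : Type u} (d : Dir) (m n : ℕ) (v w : List A) : Prop :=
  ∀ r ∈ rankersLE A d m n, (Condensed v r ↔ Condensed w r)

/-- The congruence on the free monoid `A*` generated by `CondEquiv d m n`. (The relation
`CondEquiv d m n` is itself a congruence when `1 ≤ m ≤ n`, so that this is the same relation.) -/
def condCon (A : Type u) (d : Dir) (m n : ℕ) : Con (FreeMonoid A) :=
  conGen fun v w => CondEquiv d m n v.toList w.toList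

/-! ### Pseudovarieties of monoids and the corresponding classes of languages -/

/-- A pseudovariety: a class of finite monoids closed under finite direct products, submonoids and
homomorphic images. -/
structure Pseudovariety where
  mem : (M : Type) → [Monoid M] → Prop
  finite : ∀ (M : Type) [Monoid M], mem M → Finite M
  pi : ∀ (ι : Type) [Finite ι] (M : ι → Type) [∀ k, Monoid (M k)],
    (∀ k, mem (M k)) → mem (∀ k, M k)
  submonoid : ∀ (M : Type) [Monoid M] (S : Submonoid M), mem M → mem S
  image : ∀ (M N : Type) [Monoid M] [Monoid N] (f : M →* N),
    Function.Surjective f → mem M → mem N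

namespace Pseudovariety

/-- Containment of pseudovarieties. -/
instance : LE Pseudovariety :=
  ⟨fun V W => ∀ (M : Type) [Monoid M], V.mem M → W.mem M⟩

/-- The pseudovariety generated by a class `C` of finite monoids: the least pseudovariety that
contains `C`. -/
def generated (C : (M : Type) → [Monoid M] → Prop) : Pseudovariety where
  mem M _ := Finite M ∧
    ∀ V : Pseudovariety, (∀ (N : Type) [Monoid N], C N → V.mem N) → V.mem M
  finite _ _ h := h.1
  pi ι _ M _ h :=
    ⟨have : ∀ k, Finite (M k) := fun k => (h k).1
     inferInstance, fun V hV => V.pi ι M fun k => (h k).2 V hV⟩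
  submonoid M _ S h :=
    ⟨have : Finite M := h.1
     inferInstance, fun V hV => V.submonoid M S (h.2 V hV)⟩
  image M N _ _ f hf h :=
    ⟨have : Finite M := h.1
     Finite.of_surjective f hf, fun V hV => V.image M N f hf (h.2 V hV)⟩

/-- The join `V ⊔ W`: the least pseudovariety containing `V` and `W`. -/
instance : Max Pseudovariety :=
  ⟨fun V W => generated fun M _ => V.mem M ∨ W.mem M⟩

/-- The intersection `V ⊓ W`. -/
instance : Min Pseudovariety :=
  ⟨fun V W =>
    { mem := fun M _ => V.mem M ∧ W.mem M
      finite := fun M _ h => V.finite M h.1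
      pi := fun ι _ M _ h => ⟨V.pi ι M fun k => (h k).1, W.pi ι M fun k => (h k).2⟩
      submonoid := fun M _ S h => ⟨V.submonoid M S h.1, W.submonoid M S h.2⟩
      image := fun M N _ _ f hf h => ⟨V.image M N f hf h.1, W.image M N f hf h.2⟩ }⟩

end Pseudovariety

/-- The language `L` is recognized by the monoid `M`: there is a morphism `f : A* → M` with
`L = f⁻¹(f(L))`. -/
def Recognizes {A : Type u} (M : Type) [Monoid M] (L : Language A) : Prop :=
  ∃ f : FreeMonoid A →* M, ∀ w : List A,
    w ∈ L ↔ ∃ v ∈ L, f (FreeMonoid.ofList v) = f (FreeMonoid.ofList w)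

/-- The class of languages corresponding to a pseudovariety `V`, at the alphabet `A`: the languages
of `A*` recognized by a monoid in `V`. -/
def Pseudovariety.languages (V : Pseudovariety) (A : Type u) : Set (Language A) :=
  {L | ∃ (M : Type) (_ : Monoid M), V.mem M ∧ Recognizes M L}

/-- The syntactic congruence of a language. -/
def syntacticCon {A : Type u} (L : Language A) : Con (FreeMonoid A) where
  r v w := ∀ x y : List A, x ++ v.toList ++ y ∈ L ↔ x ++ w.toList ++ y ∈ L
  iseqv := ⟨fun _ _ _ => Iff.rfl, fun h x y => (h x y).symm,
    fun h h' x y => (h x y).trans (h' x y)⟩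
  mul' {a b c d} h h' x y := by
    have h1 := h x (c.toList ++ y)
    have h2 := h' (x ++ b.toList) y
    simp only [FreeMonoid.toList_mul, List.append_assoc] at h1 h2 ⊢
    exact h1.trans h2

/-! ### The hierarchies -/

/-- The pseudovariety generated by the quotients of the free monoids `A*` by the congruences
`CondEquiv d m n`, where `n ≥ m` and `A` is a finite alphabet. -/
def condVar (d : Dir) (m : ℕ) : Pseudovariety :=
  .generated fun M _ => ∃ (A : Type) (_ : Finite A) (n : ℕ),
    m ≤ n ∧ Nonempty (M ≃* (condCon A d m n).Quotient)

/-- The pseudovariety `R_m`, generated by the quotients `A*/▷_{m,n}`. -/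
def RVar (m : ℕ) : Pseudovariety := condVar .X m

/-- The pseudovariety `L_m`, generated by the quotients `A*/◁_{m,n}`. -/
def LVar (m : ℕ) : Pseudovariety := condVar .Y m

/-- The pseudovariety `FO²_m` corresponding to the class of `FO²_m`-definable languages under
Eilenberg's correspondence: it is generated by the syntactic monoids of these languages. -/
def FO2Var (m : ℕ) : Pseudovariety :=
  .generated fun M _ => ∃ (A : Type) (_ : Finite A) (L : Language A),
    FO2Definable m L ∧ Nonempty (M ≃* (syntacticCon L).Quotient)

end FO2Alt

open FO2Alt

/-!
Condensed rankers with `m` blocks are definable with `m` blocks of quantifiers, and conversely words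
that agree on sufficiently many condensed rankers with `m + 1` blocks cannot be distinguished by
formulas with `m` blocks. The rest is algebra.

*From rankers to formulas.* A condensed ranker that starts with `X_a` cuts the word at its first `a`
and continues in one of the two parts (`cond_X_cons_iff`). If the next instruction is an `X`, it
continues after the first `a`, and formulas are relativized to the positions that are preceded by an
`a`, i.e. that satisfy a guard of the form `∃ y, …`. As a bound of a quantifier it costs no
additional block: below `∃ x` it starts with `∃`, and below `∀ x` it occurs negated. If the next
instruction is a `Y`, the ranker continues before the first `a`, and the guard needs one more block,
just as the ranker does (`definable_cond`). There are only finitely many rankers of bounded depth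
over a finite alphabet, so that every property of words which is invariant under `CondEquiv d m n`
is definable (`definable_of_condEquiv`). Finally, definability is preserved by inverse images under
morphisms of free monoids (`Definable.comap`), since positions of the image of a word can be encoded
by positions of the word and a bounded offset. Both relativization and inverse images are
interpretations (`Interp`).

*From formulas to rankers.* Consider intervals of words, indexed by `ℤ`. If two of them agree on the
condensed rankers with at most `M + 1` blocks that start to the right (and on those with at most `M`
blocks that start to the left), then the parts after their first `a` agree in the same way, and the
parts before their first `a` agree on the condensed rankers with at most `M` blocks that start to
the left, at the expense of one unit of depth (`Seg.Equiv.after`, `Seg.Equiv.before`). By induction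
one can follow an ordinary run of a ranker inside an interval. Such a run may cross the first `a`
many times, but each time it does so its continuation is a run that starts afresh at the cut. Hence
ordinary runs with the same bounds on blocks and depth lead somewhere in one of the intervals if
they do in the other (`Seg.Equiv.exists_run`), and they are ordered in the same way, except possibly
if both exhaust the number of blocks (`Seg.Equiv.sameOrder`).

With this information on `m + 1` blocks, the existential player wins the two-pebble game with `m`
blocks of quantifiers. The invariant (`PebbleLE`) is asymmetric: as long as the current block of
quantifiers lasts, only the implication is required that the end points of runs with few blocks lie
on the same side of the pebble `y` that answers as they do of the pebble `x`, and a change of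
quantifiers costs one block (`PebbleLE.symm`). If the new `b`-position `x'` is not the end of a run
with few blocks and lies to the right of the other pebble, it is answered by the last `b` before all
those run ends that have to stay on the right of the answer (`PebbleLE.step_right`). The game is
played on two words `xuy` and `xvy`, where `u` and `v` agree on condensed rankers and moves outside
of them are copied. This shows that agreement on condensed rankers is contained in the syntactic
congruence (`FO2Definable.exists_condEquiv`).

*Algebra.* The congruence generated by `CondEquiv d m n` contains this relation and is contained in
every congruence that contains it. Both facts together suffice; it is not needed that the relation
coincides with the congruence. The finite monoids all of whose recognized languages are definable
form a pseudovariety (`definableVar`), which therefore contains `condVar d m`. The inclusions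
between the pseudovarieties follow by comparing generators.
-/

namespace FO2Alt

/-! ### Counting blocks -/

section Blocks

variable {α : Type} [DecidableEq α]

@[simp] theorem blocks_nil : blocks ([] : List α) = 0 := rfl

@[simp] theorem blocks_singleton (x : α) : blocks [x] = 1 := rfl

theorem blocks_cons_cons (x y : α) (l : List α) :
    blocks (x :: y :: l) = (if x = y then 0 else 1) + blocks (y :: l) := rfl

@[simp] theorem blocks_cons_self (x : α) (l : List α) :
    blocks (x :: x :: l) = blocks (x :: l) := by simp [blocks_cons_cons]

theorem blocks_cons_pos (x : α) (l : List α) : 1 ≤ blocks (x :: l) := by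
  induction l generalizing x with
  | nil => simp
  | cons y l ih => rw [blocks_cons_cons]; have := ih y; omega

theorem blocks_le_blocks_cons (x : α) (l : List α) : blocks l ≤ blocks (x :: l) := by
  cases l with
  | nil => simp
  | cons y l => rw [blocks_cons_cons]; omega

theorem blocks_cons_le (x : α) (l : List α) : blocks (x :: l) ≤ blocks l + 1 := by
  cases l with
  | nil => simp
  | cons y l => rw [blocks_cons_cons]; split_ifs <;> omega

theorem blocks_cons_le_blocks_cons_cons (x y : α) (l : List α) :
    blocks (x :: l) ≤ blocks (x :: y :: l) := by
  rw [blocks_cons_cons]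
  split_ifs with h
  · simp [h]
  · have h1 := blocks_cons_le x l
    have h2 := blocks_le_blocks_cons y l
    omega

/-- Cutting a sequence at an entry that is kept on both sides counts one block twice. -/
theorem blocks_append_cons (p : List α) (x : α) (l : List α) :
    blocks (p ++ x :: l) + 1 = blocks (p ++ [x]) + blocks (x :: l) := by
  induction p with
  | nil => simp [Nat.add_comm]
  | cons y p ih =>
    cases p with
    | nil =>
      simp only [List.cons_append, List.nil_append, blocks_cons_cons, blocks_singleton]
      omega
    | cons z p => simp only [List.cons_append, blocks_cons_cons] at ih ⊢; omega

theorem blocks_reverse (l : List α) : blocks l.reverse = blocks l := by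
  induction l with
  | nil => rfl
  | cons x l ih =>
    cases l with
    | nil => rfl
    | cons y l =>
      have h := blocks_append_cons l.reverse y [x]
      simp only [List.reverse_cons, List.append_assoc, List.cons_append, List.nil_append] at h ih ⊢
      rw [blocks_cons_cons] at h
      rw [blocks_cons_cons, ← ih]
      simp only [blocks_singleton, eq_comm] at h ⊢
      omega

theorem blocks_append_concat_le (l s : List α) (d : α) :
    blocks (l ++ [d]) ≤ blocks (l ++ s ++ [d]) := by
  rw [← blocks_reverse (l ++ [d]), ← blocks_reverse (l ++ s ++ [d])]
  simp only [List.reverse_append, List.reverse_cons, List.reverse_nil, List.nil_append,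
    List.cons_append]
  induction s.reverse generalizing d with
  | nil => simp
  | cons x s ih =>
    calc _ ≤ blocks (d :: x :: l.reverse) := blocks_cons_le_blocks_cons_cons ..
      _ ≤ _ := by
        rw [List.cons_append, blocks_cons_cons, blocks_cons_cons]
        have := ih x
        omega

theorem blocks_map_of_injective {β : Type} [DecidableEq β] (f : α → β)
    (hf : Function.Injective f) (l : List α) : blocks (l.map f) = blocks l := by
  induction l with
  | nil => rfl
  | cons x l ih =>
    cases l with
    | nil => rfl
    | cons y l =>
      simp only [List.map_cons, blocks_cons_cons, hf.eq_iff] at ih ⊢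
      rw [ih]

end Blocks

/-! ### Directions and their exchange -/

variable {A : Type u}

/-- The opposite direction. -/
def Dir.flip : Dir → Dir
  | .X => .Y
  | .Y => .X

@[simp] theorem Dir.flip_flip (d : Dir) : d.flip.flip = d := by cases d <;> rfl
@[simp] theorem Dir.flip_X : Dir.X.flip = .Y := rfl
@[simp] theorem Dir.flip_Y : Dir.Y.flip = .X := rfl

theorem Dir.flip_injective : Function.Injective Dir.flip := fun a b h => by
  rw [← a.flip_flip, h, b.flip_flip]

/-- The instruction with the same letter and the opposite direction. -/
def Step.flip (z : Step A) : Step A := ⟨z.dir.flip, z.letter⟩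

@[simp] theorem Step.flip_flip (z : Step A) : z.flip.flip = z := by simp [Step.flip]
@[simp] theorem Step.flip_dir (z : Step A) : z.flip.dir = z.dir.flip := rfl
@[simp] theorem Step.flip_mk (d : Dir) (a : A) : (Step.mk d a).flip = ⟨d.flip, a⟩ := rfl

@[simp] theorem map_flip_map_flip (r : List (Step A)) :
    (r.map Step.flip).map Step.flip = r := by
  simp [Function.comp_def]

theorem map_dir_map_flip (r : List (Step A)) :
    (r.map Step.flip).map Step.dir = (r.map Step.dir).map Dir.flip := by
  simp [Function.comp_def]

/-! ### Segments of words indexed by the integers -/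

/-- An open interval `(lo, hi)` in a word whose positions are integers. Indexing by `ℤ` turns the
left-right symmetry of the theory into the map `x ↦ -x`. -/
structure Seg (A : Type u) : Type u where
  word : ℤ → Option A
  lo : ℤ
  hi : ℤ

namespace Seg

/-- The mirror image of a segment. -/
def flip (S : Seg A) : Seg A := ⟨fun x => S.word (-x), -S.hi, -S.lo⟩

/-- The part of a segment that lies before `p`. -/
def before (S : Seg A) (p : ℤ) : Seg A := ⟨S.word, S.lo, p⟩

/-- The part of a segment that lies after `p`. -/
def after (S : Seg A) (p : ℤ) : Seg A := ⟨S.word, p, S.hi⟩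

/-- The instruction `z`, started at `x`, leads to `y`. -/
def Go (S : Seg A) (z : Step A) (x y : ℤ) : Prop :=
  match z.dir with
  | .X => x < y ∧ S.word y = some z.letter ∧ ∀ t, x < t → t < y → S.word t ≠ some z.letter
  | .Y => y < x ∧ S.word y = some z.letter ∧ ∀ t, y < t → t < x → S.word t ≠ some z.letter

/-- The end of the segment at which an instruction of direction `d` starts. -/
def start (S : Seg A) : Dir → ℤ
  | .X => S.lo
  | .Y => S.hi

/-- Condensed rankers of a segment, described recursively: an instruction cuts the segment at the
position it reaches, and the direction of the next instruction selects the part to continue in. -/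
def Cond : Seg A → List (Step A) → Prop
  | _, [] => True
  | S, z :: r => ∃ p, S.lo < p ∧ p < S.hi ∧ S.Go z (S.start z.dir) p ∧
      match (r.map Step.dir).head? with
      | some .Y => (S.before p).Cond r
      | _ => (S.after p).Cond r

@[simp] theorem before_word (S : Seg A) (p : ℤ) : (S.before p).word = S.word := rfl
@[simp] theorem before_lo (S : Seg A) (p : ℤ) : (S.before p).lo = S.lo := rfl
@[simp] theorem before_hi (S : Seg A) (p : ℤ) : (S.before p).hi = p := rfl
@[simp] theorem after_word (S : Seg A) (p : ℤ) : (S.after p).word = S.word := rfl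
@[simp] theorem after_lo (S : Seg A) (p : ℤ) : (S.after p).lo = p := rfl
@[simp] theorem after_hi (S : Seg A) (p : ℤ) : (S.after p).hi = S.hi := rfl
@[simp] theorem flip_word (S : Seg A) (x : ℤ) : S.flip.word x = S.word (-x) := rfl
@[simp] theorem flip_lo (S : Seg A) : S.flip.lo = -S.hi := rfl
@[simp] theorem flip_hi (S : Seg A) : S.flip.hi = -S.lo := rfl
@[simp] theorem flip_flip (S : Seg A) : S.flip.flip = S := by simp [flip]
@[simp] theorem flip_before (S : Seg A) (p : ℤ) : (S.before p).flip = S.flip.after (-p) := rfl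
@[simp] theorem flip_after (S : Seg A) (p : ℤ) : (S.after p).flip = S.flip.before (-p) := rfl
@[simp] theorem start_X (S : Seg A) : S.start .X = S.lo := rfl
@[simp] theorem start_Y (S : Seg A) : S.start .Y = S.hi := rfl

theorem go_X {S : Seg A} {a : A} {x y : ℤ} : S.Go ⟨.X, a⟩ x y ↔
    x < y ∧ S.word y = some a ∧ ∀ t, x < t → t < y → S.word t ≠ some a := Iff.rfl

theorem go_Y {S : Seg A} {a : A} {x y : ℤ} : S.Go ⟨.Y, a⟩ x y ↔
    y < x ∧ S.word y = some a ∧ ∀ t, y < t → t < x → S.word t ≠ some a := Iff.rfl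

theorem Go.letter {S : Seg A} {z : Step A} {x y : ℤ} (h : S.Go z x y) :
    S.word y = some z.letter := by
  rcases z with ⟨_ | _, a⟩ <;> exact h.2.1

theorem Go.unique {S : Seg A} {z : Step A} {x y y' : ℤ} (h : S.Go z x y) (h' : S.Go z x y') :
    y = y' := by
  rcases z with ⟨_ | _, a⟩
  · rw [go_X] at h h'
    rcases lt_trichotomy y y' with hl | hl | hl
    · exact absurd h.2.1 (h'.2.2 _ h.1 hl)
    · exact hl
    · exact absurd h'.2.1 (h.2.2 _ h'.1 hl)
  · rw [go_Y] at h h'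
    rcases lt_trichotomy y y' with hl | hl | hl
    · exact absurd h'.2.1 (h.2.2 _ hl h'.1)
    · exact hl
    · exact absurd h.2.1 (h'.2.2 _ hl h.1)

theorem flip_go (S : Seg A) (z : Step A) (x y : ℤ) :
    S.flip.Go z.flip x y ↔ S.Go z (-x) (-y) := by
  rcases z with ⟨_ | _, a⟩
  · simp only [Step.flip_mk, Dir.flip_X, go_X, go_Y, flip_word, neg_lt_neg_iff]
    refine and_congr_right fun _ => and_congr_right fun _ =>
      ⟨fun h t h1 h2 => ?_, fun h t h1 h2 => h _ (by omega) (by omega)⟩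
    have := h (-t) (by omega) (by omega)
    rwa [neg_neg] at this
  · simp only [Step.flip_mk, Dir.flip_Y, go_X, go_Y, flip_word, neg_lt_neg_iff]
    refine and_congr_right fun _ => and_congr_right fun _ =>
      ⟨fun h t h1 h2 => ?_, fun h t h1 h2 => h _ (by omega) (by omega)⟩
    have := h (-t) (by omega) (by omega)
    rwa [neg_neg] at this

theorem start_flip (S : Seg A) (d : Dir) : S.flip.start d.flip = -S.start d := by
  cases d <;> rfl

/-- An instruction to the right is defined as soon as its letter occurs to the right. -/
theorem exists_go_X {S : Seg A} {a : A} {x y : ℤ} (hxy : x < y) (hy : S.word y = some a) :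
    ∃ p, p ≤ y ∧ S.Go ⟨.X, a⟩ x p := by
  obtain ⟨p, hp, hmin⟩ := Int.exists_least_of_bdd (P := fun p => x < p ∧ S.word p = some a)
    ⟨x, fun z hz => hz.1.le⟩ ⟨y, hxy, hy⟩
  exact ⟨p, hmin y ⟨hxy, hy⟩, hp.1, hp.2, fun t h1 h2 h3 => by have := hmin t ⟨h1, h3⟩; omega⟩

theorem exists_go_Y {S : Seg A} {a : A} {x y : ℤ} (hxy : y < x) (hy : S.word y = some a) :
    ∃ p, y ≤ p ∧ S.Go ⟨.Y, a⟩ x p := by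
  obtain ⟨p, hp, hmax⟩ := Int.exists_greatest_of_bdd (P := fun p => p < x ∧ S.word p = some a)
    ⟨x, fun z hz => hz.1.le⟩ ⟨y, hxy, hy⟩
  exact ⟨p, hmax y ⟨hxy, hy⟩, hp.1, hp.2, fun t h1 h2 h3 => by have := hmax t ⟨h2, h3⟩; omega⟩

/-- Condensed rankers are compatible with the left-right symmetry. -/
theorem cond_flip (S : Seg A) (r : List (Step A)) : S.flip.Cond (r.map Step.flip) ↔ S.Cond r := by
  induction r generalizing S with
  | nil => simp [Cond]
  | cons z r ih =>
    have key : ∀ p, S.flip.lo < p ∧ p < S.flip.hi ∧ S.flip.Go z.flip (S.flip.start z.flip.dir) p ↔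
        S.lo < -p ∧ -p < S.hi ∧ S.Go z (S.start z.dir) (-p) := fun p => by
      rw [flip_go, Step.flip_dir, start_flip, neg_neg, flip_lo, flip_hi]
      constructor <;> rintro ⟨h1, h2, h3⟩ <;> exact ⟨by omega, by omega, h3⟩
    have cont : ∀ p, (match ((r.map Step.flip).map Step.dir).head? with
        | some .Y => (S.flip.before p).Cond (r.map Step.flip)
        | _ => (S.flip.after p).Cond (r.map Step.flip)) ↔
        (match (r.map Step.dir).head? with
        | some .Y => (S.before (-p)).Cond r
        | _ => (S.after (-p)).Cond r) := fun p => by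
      have h1 := ih (S.before (-p))
      have h2 := ih (S.after (-p))
      rw [flip_before, neg_neg] at h1
      rw [flip_after, neg_neg] at h2
      rcases r with - | ⟨⟨_ | _, a⟩, r⟩
      · simp [Cond]
      · exact h2
      · exact h1
    constructor
    · rintro ⟨p, h1, h2, h3, h4⟩
      obtain ⟨h1, h2, h3⟩ := (key p).1 ⟨h1, h2, h3⟩
      exact ⟨-p, h1, h2, h3, (cont p).1 h4⟩
    · rintro ⟨p, h1, h2, h3, h4⟩
      obtain ⟨h1, h2, h3⟩ := (key (-p)).2 (by rw [neg_neg]; exact ⟨h1, h2, h3⟩)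
      exact ⟨-p, h1, h2, h3, (cont (-p)).2 (by rw [neg_neg]; exact h4)⟩

/-- Whether a ranker is condensed on a segment depends only on the factor that the segment spans. -/
theorem cond_shift (S S' : Seg A) (c : ℤ) (hlo : S'.lo = S.lo + c) (hhi : S'.hi = S.hi + c)
    (hw : ∀ x, S.lo < x → x < S.hi → S'.word (x + c) = S.word x) (r : List (Step A)) :
    S'.Cond r ↔ S.Cond r := by
  have main : ∀ (r : List (Step A)) (S S' : Seg A) (c : ℤ), S'.lo = S.lo + c → S'.hi = S.hi + c →
      (∀ x, S.lo < x → x < S.hi → S'.word (x + c) = S.word x) → S.Cond r → S'.Cond r := by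
    intro r
    induction r with
    | nil => intros; simp [Cond]
    | cons z r ih =>
      rintro S S' c hlo hhi hw ⟨p, h1, h2, h3, h4⟩
      refine ⟨p + c, by omega, by omega, ?_, ?_⟩
      · rcases z with ⟨_ | _, a⟩
        · simp only [start_X, go_X] at h3 ⊢
          refine ⟨by omega, by rw [hw p h1 h2]; exact h3.2.1, fun t ht1 ht2 => ?_⟩
          have := hw (t - c) (by omega) (by omega)
          rw [sub_add_cancel] at this
          rw [this]
          exact h3.2.2 _ (by omega) (by omega)
        · simp only [start_Y, go_Y] at h3 ⊢
          refine ⟨by omega, by rw [hw p h1 h2]; exact h3.2.1, fun t ht1 ht2 => ?_⟩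
          have := hw (t - c) (by omega) (by omega)
          rw [sub_add_cancel] at this
          rw [this]
          exact h3.2.2 _ (by omega) (by omega)
      · have hb : (S.before p).Cond r → (S'.before (p + c)).Cond r :=
          ih _ _ c hlo rfl fun x hx1 hx2 => hw x hx1 (by simp at hx2; omega)
        have ha : (S.after p).Cond r → (S'.after (p + c)).Cond r :=
          ih _ _ c rfl hhi fun x hx1 hx2 => hw x (by simp at hx1; omega) hx2
        rcases r with - | ⟨⟨_ | _, a⟩, r⟩
        · exact ha h4
        · exact ha h4
        · exact hb h4
  refine ⟨main r S' S (-c) (by omega) (by omega) fun x h1 h2 => ?_, main r S S' c hlo hhi hw⟩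
  rw [← hw (x + -c) (by omega) (by omega)]
  congr 1
  omega

/-! ### Scattered subwords of a segment -/

/-- The word `l` is a scattered subword of the segment. -/
def Sub : Seg A → List A → Prop
  | _, [] => True
  | S, a :: l => ∃ x, S.lo < x ∧ x < S.hi ∧ S.word x = some a ∧ (S.after x).Sub l

theorem Sub.mono {S S' : Seg A} {l : List A} (h : S.Sub l) (hw : S'.word = S.word)
    (hlo : S'.lo ≤ S.lo) (hhi : S.hi ≤ S'.hi) : S'.Sub l := by
  induction l generalizing S S' with
  | nil => trivial
  | cons a l ih =>
    obtain ⟨x, h1, h2, h3, h4⟩ := h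
    exact ⟨x, by omega, by omega, by rw [hw]; exact h3, ih h4 hw le_rfl hhi⟩

theorem sub_append_singleton (S : Seg A) (l : List A) (a : A) :
    S.Sub (l ++ [a]) ↔ ∃ x, S.lo < x ∧ x < S.hi ∧ S.word x = some a ∧ (S.before x).Sub l := by
  induction l generalizing S with
  | nil => simp [Sub]
  | cons b l ih =>
    simp only [List.cons_append, Sub, ih]
    constructor
    · rintro ⟨x, h1, h2, h3, y, h4, h5, h6, h7⟩
      simp only [after_lo, after_hi, after_word] at h4 h5 h6
      exact ⟨y, by omega, h5, h6, x, h1, h4, h3, h7⟩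
    · rintro ⟨y, h1, h2, h3, x, h4, h5, h6, h7⟩
      simp only [before_lo, before_hi, before_word] at h4 h5 h6
      exact ⟨x, h4, by omega, h6, y, h5, h2, h3, h7⟩

theorem sub_flip (S : Seg A) (l : List A) : S.flip.Sub l ↔ S.Sub l.reverse := by
  induction l generalizing S with
  | nil => simp [Sub]
  | cons a l ih =>
    rw [List.reverse_cons, sub_append_singleton]
    constructor
    · rintro ⟨x, h1, h2, h3, h4⟩
      simp only [flip_lo, flip_hi, flip_word] at h1 h2 h3
      refine ⟨-x, by omega, by omega, h3, (ih _).1 ?_⟩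
      rwa [flip_before, neg_neg]
    · rintro ⟨x, h1, h2, h3, h4⟩
      refine ⟨-x, by simp; omega, by simp; omega, by simpa using h3, ?_⟩
      rw [← ih] at h4
      rwa [flip_before] at h4

/-- A block of instructions to the right is a leftmost embedding of a subword. -/
theorem cond_map_X (S : Seg A) (l : List A) : S.Cond (l.map (Step.mk .X)) ↔ S.Sub l := by
  induction l generalizing S with
  | nil => simp [Cond, Sub]
  | cons a l ih =>
    have hr : ∀ p, (match ((l.map (Step.mk Dir.X)).map Step.dir).head? with
      | some .Y => (S.before p).Cond (l.map (Step.mk .X))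
      | _ => (S.after p).Cond (l.map (Step.mk .X))) ↔ (S.after p).Sub l := fun p => by
      rw [← ih]
      cases l <;> rfl
    simp only [List.map_cons, Cond, Sub]
    constructor
    · rintro ⟨p, h1, h2, h3, h4⟩
      exact ⟨p, h1, h2, h3.letter, (hr p).1 h4⟩
    · rintro ⟨x, h1, h2, h3, h4⟩
      obtain ⟨p, hpx, hp⟩ := S.exists_go_X h1 h3
      exact ⟨p, hp.1, by omega, hp, (hr p).2 (h4.mono rfl hpx le_rfl)⟩

theorem cond_map_Y (S : Seg A) (l : List A) : S.Cond (l.map (Step.mk .Y)) ↔ S.Sub l.reverse := by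
  rw [← sub_flip, ← cond_map_X, ← cond_flip]
  simp [Function.comp_def]

/-! ### Equivalence of segments with respect to condensed rankers -/

/-- The number of blocks of a ranker, counted as if it were preceded by an instruction of
direction `d`. -/
def wt (d : Dir) (r : List (Step A)) : ℕ := blocks (d :: r.map Step.dir)

/-- The segments `S` and `T` agree on all condensed rankers `r` of depth at most `N` and with
`wt d r ≤ M`, i.e. on those starting in direction `d` with at most `M` blocks and those starting in
the other direction with fewer than `M` blocks. -/
def Equiv (d : Dir) (M N : ℕ) (S T : Seg A) : Prop :=
  ∀ r : List (Step A), wt d r ≤ M → r.length ≤ N → (S.Cond r ↔ T.Cond r)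

theorem Equiv.symm {d : Dir} {M N : ℕ} {S T : Seg A} (h : Equiv d M N S T) : Equiv d M N T S :=
  fun r h1 h2 => (h r h1 h2).symm

theorem wt_map_flip (d : Dir) (r : List (Step A)) : wt d.flip (r.map Step.flip) = wt d r := by
  rw [wt, map_dir_map_flip, ← List.map_cons (f := Dir.flip),
    blocks_map_of_injective _ Dir.flip_injective]
  rfl

theorem Equiv.flip {d : Dir} {M N : ℕ} {S T : Seg A} (h : Equiv d M N S T) :
    Equiv d.flip M N S.flip T.flip := fun r h1 h2 => by
  have h3 := h (r.map Step.flip) (by rwa [← wt_map_flip, map_flip_map_flip]) (by simpa using h2)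
  rwa [← cond_flip S, ← cond_flip T, map_flip_map_flip] at h3

theorem wt_le_succ (d d' : Dir) (r : List (Step A)) : wt d r ≤ wt d' r + 1 := by
  have h1 := blocks_cons_le d (r.map Step.dir)
  have h2 := blocks_le_blocks_cons d' (r.map Step.dir)
  simp only [wt]
  omega

/-- Giving up one block makes the direction immaterial. -/
theorem Equiv.change_dir {d : Dir} {M N : ℕ} {S T : Seg A} (h : Equiv d (M + 1) N S T) (d' : Dir) :
    Equiv d' M N S T := fun r h1 h2 => h r (by have := wt_le_succ d d' r; omega) h2

theorem cond_cons_iff {S : Seg A} {z : Step A} {p : ℤ} (h1 : S.lo < p) (h2 : p < S.hi)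
    (h3 : S.Go z (S.start z.dir) p) (r : List (Step A)) :
    S.Cond (z :: r) ↔ match (r.map Step.dir).head? with
      | some .Y => (S.before p).Cond r
      | _ => (S.after p).Cond r := by
  constructor
  · rintro ⟨q, -, -, h3', h4⟩
    rwa [← h3'.unique h3]
  · exact fun h => ⟨p, h1, h2, h3, h⟩

/-- The letters of the initial block of instructions of direction `d`. -/
def lead (d : Dir) (r : List (Step A)) : List A :=
  (r.takeWhile (fun z => decide (z.dir = d))).map Step.letter

theorem length_lead_le (d : Dir) (r : List (Step A)) : (lead d r).length ≤ r.length := by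
  simpa [lead] using (r.takeWhile_prefix (fun z => decide (z.dir = d))).length_le

theorem lead_map_flip (d : Dir) (r : List (Step A)) : lead d.flip (r.map Step.flip) = lead d r := by
  simp only [lead, List.takeWhile_map, List.map_map]
  congr 1
  congr 1
  funext z
  simp [Dir.flip_injective.eq_iff]

/-- A ranker that starts to the left is condensed on a final part of a segment if and only if it is
condensed on the whole segment and its first block stays in that part. -/
theorem cond_after_iff (S : Seg A) (p : ℤ) (hp : S.lo ≤ p) (b : A) (r : List (Step A)) :
    (S.after p).Cond (⟨.Y, b⟩ :: r) ↔
      S.Cond (⟨.Y, b⟩ :: r) ∧ (S.after p).Sub (lead .Y (⟨.Y, b⟩ :: r)).reverse := by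
  induction r generalizing S b with
  | nil =>
    have : lead Dir.Y [(⟨.Y, b⟩ : Step A)] = [b] := rfl
    rw [this, ← cond_map_Y]
    refine ⟨fun h => ⟨?_, h⟩, fun h => h.2⟩
    obtain ⟨q, h1, h2, h3, -⟩ := h
    exact ⟨q, by simp at h1; omega, h2, h3, trivial⟩
  | cons z r ih =>
    rcases z with ⟨_ | _, c⟩
    · have : lead Dir.Y ((⟨.Y, b⟩ : Step A) :: ⟨.X, c⟩ :: r) = [b] := rfl
      rw [this, ← cond_map_Y]
      constructor
      · rintro ⟨q, h1, h2, h3, h4⟩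
        exact ⟨⟨q, by simp at h1; omega, h2, h3, h4⟩, ⟨q, h1, h2, h3, trivial⟩⟩
      · rintro ⟨⟨q, h1, h2, h3, h4⟩, ⟨q', h1', h2', h3', -⟩⟩
        have : q' = q := h3'.unique h3
        subst this
        exact ⟨q', h1', h2', h3', h4⟩
    · have : lead Dir.Y ((⟨.Y, b⟩ : Step A) :: ⟨.Y, c⟩ :: r) =
        b :: lead Dir.Y ((⟨.Y, c⟩ : Step A) :: r) := rfl
      rw [this, List.reverse_cons, sub_append_singleton]
      constructor
      · rintro ⟨q, h1, h2, h3, h4⟩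
        simp only [after_lo, after_hi] at h1 h2
        have h4 : ((S.before q).after p).Cond (⟨.Y, c⟩ :: r) := h4
        rw [ih (S.before q) hp] at h4
        exact ⟨⟨q, by omega, h2, h3, h4.1⟩, q, h1, h2, h3.letter, h4.2⟩
      · rintro ⟨⟨q, h1, h2, h3, h4⟩, x, h5, h6, h7, h8⟩
        simp only [after_lo, after_hi, after_word] at h5 h6 h7
        have hxq : x ≤ q := by
          by_contra hlt
          exact h3.2.2 x (by omega) h6 h7
        refine ⟨q, by simp; omega, h2, h3, ?_⟩
        change ((S.before q).after p).Cond (⟨.Y, c⟩ :: r)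
        rw [ih (S.before q) hp]
        exact ⟨h4, h8.mono rfl le_rfl hxq⟩

/-- The mirror image of `cond_after_iff`. -/
theorem cond_before_iff (S : Seg A) (p : ℤ) (hp : p ≤ S.hi) (b : A) (r : List (Step A)) :
    (S.before p).Cond (⟨.X, b⟩ :: r) ↔
      S.Cond (⟨.X, b⟩ :: r) ∧ (S.before p).Sub (lead .X (⟨.X, b⟩ :: r)) := by
  have h := cond_after_iff S.flip (-p) (by simp; omega) b (r.map Step.flip)
  rw [← flip_before, sub_flip, List.reverse_reverse] at h
  rw [← cond_flip, ← cond_flip S, ← lead_map_flip]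
  exact h

theorem wt_map_X (l : List A) : wt .X (l.map (Step.mk .X)) = 1 := by
  induction l with
  | nil => rfl
  | cons a l ih => simpa [wt] using ih

theorem wt_cons_self (d : Dir) (a : A) (r : List (Step A)) : wt d (⟨d, a⟩ :: r) = wt d r := by
  simp [wt]

theorem wt_cons_flip (d : Dir) (a : A) (r : List (Step A)) :
    wt d.flip (⟨d, a⟩ :: r) = wt d (⟨d, a⟩ :: r) + 1 := by
  cases d <;> simp [wt, blocks_cons_cons, Nat.add_comm]

theorem wt_map_Y (l : List A) : wt .Y (l.map (Step.mk .Y)) = 1 := by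
  induction l with
  | nil => rfl
  | cons a l ih => simpa [wt] using ih

/-- The parts after the first `a` of equivalent segments are equivalent. -/
theorem Equiv.after {M N : ℕ} {S T : Seg A} (h : Equiv .X (M + 1) (N + 1) S T) {a : A} {p q : ℤ}
    (hp1 : S.lo < p) (hp2 : p < S.hi) (hp : S.Go ⟨.X, a⟩ S.lo p)
    (hq1 : T.lo < q) (hq2 : q < T.hi) (hq : T.Go ⟨.X, a⟩ T.lo q) :
    Equiv .X (M + 1) N (S.after p) (T.after q) := by
  intro r h1 h2
  have hX : ∀ r : List (Step A), (r.map Step.dir).head? ≠ some .Y → wt .X r ≤ M + 1 →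
      r.length ≤ N → ((S.after p).Cond r ↔ (T.after q).Cond r) := fun r hr h1 h2 => by
    have h3 := h (⟨.X, a⟩ :: r) (by rwa [wt_cons_self]) (by simpa using h2)
    rw [cond_cons_iff hp1 hp2 hp, cond_cons_iff hq1 hq2 hq] at h3
    rcases r with - | ⟨⟨_ | _, b⟩, r⟩
    · exact h3
    · exact h3
    · simp at hr
  rcases r with - | ⟨⟨_ | _, b⟩, r⟩
  · simp [Cond]
  · exact hX _ (by simp) h1 h2
  · rw [cond_after_iff _ _ hp1.le, cond_after_iff _ _ hq1.le, h _ h1 (by omega),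
      ← cond_map_X, ← cond_map_X, hX]
    · cases (lead Dir.Y ((⟨.Y, b⟩ : Step A) :: r)).reverse <;> simp
    · rw [wt_map_X]; omega
    · rw [List.length_map, List.length_reverse]
      exact (length_lead_le _ _).trans h2

/-- The parts before the first `a` of equivalent segments are equivalent, with one block less. -/
theorem Equiv.before {M N : ℕ} {S T : Seg A} (h : Equiv .X (M + 1) (N + 1) S T) {a : A} {p q : ℤ}
    (hp1 : S.lo < p) (hp2 : p < S.hi) (hp : S.Go ⟨.X, a⟩ S.lo p)
    (hq1 : T.lo < q) (hq2 : q < T.hi) (hq : T.Go ⟨.X, a⟩ T.lo q) :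
    Equiv .Y M N (S.before p) (T.before q) := by
  intro r h1 h2
  have hY : ∀ r : List (Step A), (r.map Step.dir).head? ≠ some .X → wt .Y r ≤ M →
      r.length ≤ N → ((S.before p).Cond r ↔ (T.before q).Cond r) := fun r hr h1 h2 => by
    have h3 := h (⟨.X, a⟩ :: r) (by rw [wt_cons_self]; have := wt_le_succ .X .Y r; omega)
      (by simpa using h2)
    rw [cond_cons_iff hp1 hp2 hp, cond_cons_iff hq1 hq2 hq] at h3
    rcases r with - | ⟨⟨_ | _, b⟩, r⟩
    · simp [Cond]
    · simp at hr
    · exact h3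
  rcases r with - | ⟨⟨_ | _, b⟩, r⟩
  · simp [Cond]
  · rw [cond_before_iff _ _ hp2.le, cond_before_iff _ _ hq2.le,
      h _ (by have := wt_le_succ .X .Y ((⟨.X, b⟩ : Step A) :: r); omega) (by omega),
      ← List.reverse_reverse (lead _ _), ← cond_map_Y, ← cond_map_Y, hY]
    · cases (lead Dir.X ((⟨.X, b⟩ : Step A) :: r)).reverse <;> simp
    · rw [wt_map_Y]
      have := wt_cons_flip .X b r
      have := blocks_cons_pos Dir.X (((⟨.X, b⟩ : Step A) :: r).map Step.dir)
      simp only [wt, Dir.flip_X] at *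
      omega
    · rw [List.length_map, List.length_reverse]
      exact (length_lead_le _ _).trans h2
  · exact hY _ (by simp) h1 h2

/-! ### Runs inside a segment -/

/-- The instructions of `h`, listed with the *last* one first, are executed inside the segment `S`,
without ever leaving it, and lead to position `y`. -/
def Run (S : Seg A) : List (Step A) → ℤ → Prop
  | [], _ => False
  | [z], y => S.lo < y ∧ y < S.hi ∧ S.Go z (S.start z.dir) y
  | z :: z' :: h, y => S.lo < y ∧ y < S.hi ∧ ∃ x, S.Run (z' :: h) x ∧ S.Go z x y

/-- The analogue of `wt` for a ranker that is listed with its last instruction first. -/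
def wtR (d : Dir) (h : List (Step A)) : ℕ := blocks (h.map Step.dir ++ [d])

theorem run_singleton {S : Seg A} {z : Step A} {y : ℤ} :
    S.Run [z] y ↔ S.lo < y ∧ y < S.hi ∧ S.Go z (S.start z.dir) y := Iff.rfl

theorem run_cons {S : Seg A} {z : Step A} {h : List (Step A)} (hh : h ≠ []) {y : ℤ} :
    S.Run (z :: h) y ↔ S.lo < y ∧ y < S.hi ∧ ∃ x, S.Run h x ∧ S.Go z x y := by
  cases h with
  | nil => exact absurd rfl hh
  | cons z' h => exact Iff.rfl

theorem Run.ne_nil {S : Seg A} {h : List (Step A)} {y : ℤ} (hr : S.Run h y) : h ≠ [] := by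
  rintro rfl
  exact hr

theorem Run.mem {S : Seg A} {h : List (Step A)} {y : ℤ} (hr : S.Run h y) :
    S.lo < y ∧ y < S.hi := by
  rcases h with - | ⟨z, - | ⟨z', h⟩⟩
  · exact hr.elim
  · exact ⟨hr.1, hr.2.1⟩
  · exact ⟨hr.1, hr.2.1⟩

theorem Run.letter {S : Seg A} {z : Step A} {h : List (Step A)} {y : ℤ} (hr : S.Run (z :: h) y) :
    S.word y = some z.letter := by
  rcases h with - | ⟨z', h⟩
  · exact hr.2.2.letter
  · obtain ⟨-, -, x, -, hx⟩ := hr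
    exact hx.letter

theorem Run.unique {S : Seg A} {h : List (Step A)} {x y : ℤ} (hx : S.Run h x) (hy : S.Run h y) :
    x = y := by
  induction h generalizing x y with
  | nil => exact hx.elim
  | cons z h ih =>
    rcases h with - | ⟨z', h⟩
    · exact hx.2.2.unique hy.2.2
    · obtain ⟨-, -, x', hx1, hx2⟩ := hx
      obtain ⟨-, -, y', hy1, hy2⟩ := hy
      rw [ih hy1 hx1] at hy2
      exact hx2.unique hy2

theorem Run.first {S : Seg A} {h : List (Step A)} {z : Step A} {y : ℤ}
    (hr : S.Run (h ++ [z]) y) : ∃ x, S.Run [z] x := by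
  induction h generalizing y with
  | nil => exact ⟨y, hr⟩
  | cons z' h ih =>
    rw [List.cons_append, run_cons (by simp)] at hr
    obtain ⟨-, -, x, hx, -⟩ := hr
    exact ih hx

theorem run_flip (S : Seg A) (h : List (Step A)) (y : ℤ) :
    S.flip.Run (h.map Step.flip) y ↔ S.Run h (-y) := by
  induction h generalizing y with
  | nil => exact Iff.rfl
  | cons z h ih =>
    by_cases hh : h = []
    · subst hh
      rw [List.map_cons, List.map_nil, run_singleton, run_singleton, flip_go, Step.flip_dir,
        start_flip, neg_neg, flip_lo, flip_hi]
      constructor <;> rintro ⟨h1, h2, h3⟩ <;> exact ⟨by omega, by omega, h3⟩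
    · rw [List.map_cons, run_cons (by simpa using hh), run_cons hh, flip_lo, flip_hi]
      constructor
      · rintro ⟨h1, h2, x, h3, h4⟩
        exact ⟨by omega, by omega, -x, (ih x).1 h3, (flip_go ..).1 h4⟩
      · rintro ⟨h1, h2, x, h3, h4⟩
        refine ⟨by omega, by omega, -x, (ih _).2 (by rwa [neg_neg]), (flip_go ..).2 ?_⟩
        rwa [neg_neg]

theorem wtR_map_flip (d : Dir) (h : List (Step A)) : wtR d.flip (h.map Step.flip) = wtR d h := by
  have : (h.map Step.flip).map Step.dir ++ [d.flip] = (h.map Step.dir ++ [d]).map Dir.flip := by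
    rw [map_dir_map_flip, List.map_append]; rfl
  rw [wtR, this, blocks_map_of_injective _ Dir.flip_injective]
  rfl

theorem wtR_prefix (d : Dir) (t s : List (Step A)) : wtR d t ≤ wtR d (t ++ s) := by
  simpa [wtR] using blocks_append_concat_le (t.map Step.dir) (s.map Step.dir) d

theorem wtR_append_singleton_flip (d : Dir) (h : List (Step A)) (c : A) :
    wtR d (h ++ [⟨d.flip, c⟩]) = wtR d.flip (h ++ [⟨d.flip, c⟩]) + 1 := by
  have h1 := blocks_append_cons (h.map Step.dir) d.flip [d]
  have h2 := blocks_append_cons (h.map Step.dir) d.flip [d.flip]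
  have : blocks [d.flip, d] = 2 := by cases d <;> rfl
  simp only [wtR, List.map_append, List.map_cons, List.map_nil, List.append_assoc,
    List.cons_append, List.nil_append, blocks_cons_self, blocks_singleton] at h1 h2 ⊢
  omega

theorem one_le_wtR (d : Dir) (h : List (Step A)) : 1 ≤ wtR d h := by
  have := wtR_prefix d [] h
  simpa [wtR] using this

/-! ### Equivalent segments have the same runs -/

/-- Between equivalent segments, runs of at most `k` instructions and bounded weight transfer. -/
def Transfers (A : Type u) (k : ℕ) : Prop :=
  ∀ (d : Dir) (M N : ℕ) (S T : Seg A), Equiv d M N S T → ∀ h : List (Step A), h.length ≤ k →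
    h.length ≤ N → wtR d h ≤ M → ∀ x, S.Run h x → ∃ y, T.Run h y

/-- `x` in `S` and `y` in `T` correspond to each other with respect to cuts of `S` at `p` and of `T`
at `q`: either they are the cutting points, or both are reached by the same most recent part of the
history `h`, executed in the parts before the cuts (and then starting to the left) or in the parts
after the cuts. The number `δ` measures by how much this part of the history is shorter than
`h`. -/
def Located (S T : Seg A) (p q : ℤ) (δ : ℕ) (h : List (Step A)) (x y : ℤ) : Prop :=
  (x = p ∧ y = q) ∨
  (∃ t c s, h = t ++ ⟨.Y, c⟩ :: s ∧ t.length + 1 + δ ≤ h.length ∧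
    (S.before p).Run (t ++ [⟨.Y, c⟩]) x ∧ (T.before q).Run (t ++ [⟨.Y, c⟩]) y) ∨
  (∃ t s, h = t ++ s ∧ t.length + δ ≤ h.length ∧ (S.after p).Run t x ∧ (T.after q).Run t y)

/-- The behaviour of an instruction to the right that starts before the cut and leads to the cut or
beyond it. -/
theorem cross_right {S T : Seg A} {p q x y x' : ℤ} {a c : A} (hp : S.word p = some a)
    (hq : T.word q = some a) (hx : x < p) (hy : y < q)
    (hback : ∀ y', y' < q → T.Go ⟨.X, c⟩ y y' → ∃ x', x' < p ∧ S.Go ⟨.X, c⟩ x x')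
    (hstep : ∀ x', x' < S.hi → S.Go ⟨.X, c⟩ p x' → ∃ y', y' < T.hi ∧ T.Go ⟨.X, c⟩ q y')
    (hgo : S.Go ⟨.X, c⟩ x x') (hpx : p ≤ x') (hx' : x' < S.hi) :
    (x' = p ∧ T.Go ⟨.X, c⟩ y q) ∨
      (S.Go ⟨.X, c⟩ p x' ∧ ∃ y', y' < T.hi ∧ T.Go ⟨.X, c⟩ q y' ∧ T.Go ⟨.X, c⟩ y y') := by
  have hnone : ∀ t, y < t → t < q → T.word t ≠ some c := fun t h1 h2 h3 => by
    obtain ⟨y', h4, h5⟩ := T.exists_go_X h1 h3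
    obtain ⟨x'', h6, h7⟩ := hback y' (by omega) h5
    have := h7.unique hgo
    omega
  rcases hpx.eq_or_lt with rfl | hlt
  · left
    have hca : c = a := by have := hgo.letter; rw [hp] at this; simpa using this.symm
    subst hca
    exact ⟨rfl, hy, hq, hnone⟩
  · right
    have h1 : S.Go ⟨.X, c⟩ p x' := ⟨hlt, hgo.2.1, fun t h1 h2 => hgo.2.2 t (by omega) h2⟩
    obtain ⟨y', h2, h3⟩ := hstep x' hx' h1
    refine ⟨h1, y', h2, h3, hy.trans h3.1, h3.2.1, fun t h4 h5 => ?_⟩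
    rcases lt_trichotomy t q with h6 | h6 | h6
    · exact hnone t h4 h6
    · rw [h6, hq, ← hp]
      exact hgo.2.2 p hx hlt
    · exact h3.2.2 t h6 h5

/-- The mirror image of `cross_right`. -/
theorem cross_left {S T : Seg A} {p q x y x' : ℤ} {a c : A} (hp : S.word p = some a)
    (hq : T.word q = some a) (hx : p < x) (hy : q < y)
    (hback : ∀ y', q < y' → T.Go ⟨.Y, c⟩ y y' → ∃ x', p < x' ∧ S.Go ⟨.Y, c⟩ x x')
    (hstep : ∀ x', S.lo < x' → S.Go ⟨.Y, c⟩ p x' → ∃ y', T.lo < y' ∧ T.Go ⟨.Y, c⟩ q y')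
    (hgo : S.Go ⟨.Y, c⟩ x x') (hpx : x' ≤ p) (hx' : S.lo < x') :
    (x' = p ∧ T.Go ⟨.Y, c⟩ y q) ∨
      (S.Go ⟨.Y, c⟩ p x' ∧ ∃ y', T.lo < y' ∧ T.Go ⟨.Y, c⟩ q y' ∧ T.Go ⟨.Y, c⟩ y y') := by
  have hf : ∀ (U : Seg A) (s t : ℤ), U.flip.Go ⟨.X, c⟩ (-s) (-t) ↔ U.Go ⟨.Y, c⟩ s t :=
    fun U s t => by simpa using flip_go U ⟨.Y, c⟩ (-s) (-t)
  have hf' : ∀ (U : Seg A) (s t : ℤ), U.flip.Go ⟨.X, c⟩ (-s) t ↔ U.Go ⟨.Y, c⟩ s (-t) :=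
    fun U s t => by rw [← hf, neg_neg]
  have := cross_right (S := S.flip) (T := T.flip) (p := -p) (q := -q) (x := -x) (y := -y)
    (x' := -x') (a := a) (c := c) (by simpa using hp) (by simpa using hq) (by omega) (by omega)
    (fun y' h1 h2 => by
      obtain ⟨x'', h3, h4⟩ := hback (-y') (by omega) ((hf' ..).1 h2)
      exact ⟨-x'', by omega, (hf ..).2 h4⟩)
    (fun y' h1 h2 => by
      obtain ⟨x'', h3, h4⟩ := hstep (-y') (by simp at h1; omega) ((hf' ..).1 h2)
      exact ⟨-x'', by simp; omega, (hf ..).2 h4⟩)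
    ((hf ..).2 hgo) (by omega) (by simp; omega)
  rw [hf, hf] at this
  refine this.imp (fun h => ⟨by omega, h.2⟩) (fun h => ⟨h.1, ?_⟩)
  obtain ⟨y', h1, h2, h3⟩ := h.2
  exact ⟨-y', by simp at h1; omega, (hf' ..).1 h2, (hf' ..).1 h3⟩

section Locating

variable {M N k δ : ℕ} {S T : Seg A} {a : A} {p q : ℤ}

/-- The data of two equivalent segments, cut at their first `a`. -/
structure Cut (M N : ℕ) (S T : Seg A) (a : A) (p q : ℤ) : Prop where
  equiv : Equiv .X (M + 1) (N + 1) S T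
  fst : S.Run [⟨.X, a⟩] p
  snd : T.Run [⟨.X, a⟩] q

theorem Cut.symm (C : Cut M N S T a p q) : Cut M N T S a q p := ⟨C.equiv.symm, C.snd, C.fst⟩

theorem Cut.after (C : Cut M N S T a p q) : Equiv .X (M + 1) N (S.after p) (T.after q) :=
  C.equiv.after C.fst.1 C.fst.2.1 C.fst.2.2 C.snd.1 C.snd.2.1 C.snd.2.2

theorem Cut.before (C : Cut M N S T a p q) : Equiv .Y M N (S.before p) (T.before q) :=
  C.equiv.before C.fst.1 C.fst.2.1 C.fst.2.2 C.snd.1 C.snd.2.1 C.snd.2.2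

/-- Runs that start to the left transfer between the parts before the cuts. These parts are
equivalent for one block less only, but the missing block is the one of the instruction that leads
to the cut, which `wtR .X` counts for a run starting to the left. -/
theorem Cut.run_before (C : Cut M N S T a p q) (hk : Transfers A k) {t : List (Step A)} {c : A}
    (h1 : t.length + 1 ≤ k) (h2 : t.length + 1 ≤ N) (h3 : wtR .X (t ++ [⟨.Y, c⟩]) ≤ M + 1) {x : ℤ}
    (hx : (S.before p).Run (t ++ [⟨.Y, c⟩]) x) : ∃ y, (T.before q).Run (t ++ [⟨.Y, c⟩]) y := by
  refine hk _ _ _ _ _ C.before _ (by simpa using h1) (by simpa using h2) ?_ x hx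
  have := wtR_append_singleton_flip .X t c
  simp only [Dir.flip_X] at this
  omega

theorem Cut.run_after (C : Cut M N S T a p q) (hk : Transfers A k) {t : List (Step A)}
    (h1 : t.length ≤ k) (h2 : t.length ≤ N) (h3 : wtR .X t ≤ M + 1) {x : ℤ}
    (hx : (S.after p).Run t x) : ∃ y, (T.after q).Run t y :=
  hk _ _ _ _ _ C.after _ h1 h2 h3 x hx

/-- Corresponding positions stay in correspondence after one more instruction. -/
theorem Cut.step (C : Cut M N S T a p q) (hk : Transfers A k) (hδ : δ ≤ 1) {z : Step A}
    {h : List (Step A)} (hh : h ≠ []) (hlk : h.length + 1 ≤ k + δ) (hlN : h.length + 1 ≤ N + δ)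
    (hw : wtR .X (z :: h) ≤ M + 1) {x y x' : ℤ} (hxy : Located S T p q δ h x y)
    (hgo : S.Go z x x') (hx1 : S.lo < x') (hx2 : x' < S.hi) :
    ∃ y', T.lo < y' ∧ y' < T.hi ∧ T.Go z y y' ∧ Located S T p q δ (z :: h) x' y' := by
  have hp := C.fst.mem
  have hq := C.snd.mem
  have hpa : S.word p = some a := C.fst.letter
  have hqa : T.word q = some a := C.snd.letter
  have hpos : 1 ≤ h.length := List.length_pos_iff.2 hh
  have hwt : ∀ t s, h = t ++ s → wtR .X (z :: t) ≤ M + 1 := fun t s hts =>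
    (wtR_prefix .X (z :: t) s).trans (by rwa [List.cons_append, ← hts])
  have hw1 : wtR .X [z] ≤ M + 1 := hwt [] h rfl
  rcases z with ⟨_ | _, c⟩
  · -- An instruction to the right that starts at the cut, or that crosses it, ends as if it had
    -- been started at the left end of the part after the cut.
    have jump : ∀ x', x' < S.hi → S.Go ⟨.X, c⟩ p x' → ∃ y', y' < T.hi ∧ T.Go ⟨.X, c⟩ q y' :=
      fun x' h1 h2 => by
        obtain ⟨y', h3⟩ := C.run_after (k := k) hk (t := [⟨.X, c⟩]) (by simp; omega)
          (by simp; omega) hw1 (x := x') ⟨h2.1, h1, h2⟩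
        exact ⟨y', h3.2.1, h3.2.2⟩
    have done : ∀ y', y' < T.hi → S.Go ⟨.X, c⟩ p x' → T.Go ⟨.X, c⟩ q y' →
        Located S T p q δ (⟨.X, c⟩ :: h) x' y' := fun y' h1 h2 h3 =>
      Or.inr (Or.inr ⟨[⟨.X, c⟩], h, rfl, by simp; omega, ⟨h2.1, hx2, h2⟩, ⟨h3.1, h1, h3⟩⟩)
    rcases hxy with ⟨rfl, rfl⟩ | ⟨t, b, s, rfl, hlen, hS, hT⟩ | ⟨t, s, rfl, hlen, hS, hT⟩
    · obtain ⟨y', h1, h2⟩ := jump x' hx2 hgo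
      exact ⟨y', hq.1.trans h2.1, h1, h2, done y' h1 hgo h2⟩
    · simp only [List.length_append, List.length_cons] at hlen hlk hlN
      have hwt' := hwt (t ++ [⟨.Y, b⟩]) s (by simp)
      have hmS := hS.mem
      have hmT := hT.mem
      simp only [before_lo, before_hi] at hmS hmT
      rcases lt_or_ge x' p with hlt | hge
      · have hS' : (S.before p).Run (⟨.X, c⟩ :: t ++ [⟨.Y, b⟩]) x' := by
          rw [List.cons_append, run_cons (by simp)]
          exact ⟨hx1, hlt, x, hS, hgo⟩
        obtain ⟨y', hT'⟩ := C.run_before hk (by simp; omega) (by simp; omega) hwt' hS'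
        have hT'' := hT'
        rw [List.cons_append, run_cons (by simp)] at hT''
        obtain ⟨h1, h2, y0, h3, h4⟩ := hT''
        rw [h3.unique hT] at h4
        simp only [before_lo, before_hi] at h1 h2
        exact ⟨y', h1, by omega, h4, Or.inr (Or.inl ⟨_, b, s, rfl, by simp; omega, hS', hT'⟩)⟩
      · rcases cross_right hpa hqa hmS.2 hmT.2 (fun y' h1 h2 => by
          have hT' : (T.before q).Run (⟨.X, c⟩ :: t ++ [⟨.Y, b⟩]) y' := by
            rw [List.cons_append, run_cons (by simp)]
            exact ⟨hmT.1.trans h2.1, h1, y, hT, h2⟩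
          obtain ⟨x'', hS'⟩ := C.symm.run_before hk (by simp; omega) (by simp; omega) hwt' hT'
          rw [List.cons_append, run_cons (by simp)] at hS'
          obtain ⟨-, h4, x0, h5, h6⟩ := hS'
          rw [h5.unique hS] at h6
          exact ⟨x'', h4, h6⟩) jump hgo hge hx2 with ⟨rfl, h1⟩ | ⟨h1, y', h2, h3, h4⟩
        · exact ⟨q, hq.1, hq.2, h1, Or.inl ⟨rfl, rfl⟩⟩
        · exact ⟨y', hq.1.trans h3.1, h2, h4, done y' h2 h1 h3⟩
    · simp only [List.length_append] at hlen hlk hlN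
      have hmS := hS.mem
      have hmT := hT.mem
      simp only [after_lo, after_hi] at hmS hmT
      have hS' : (S.after p).Run (⟨.X, c⟩ :: t) x' := by
        rw [run_cons hS.ne_nil]
        exact ⟨hmS.1.trans hgo.1, hx2, x, hS, hgo⟩
      obtain ⟨y', hT'⟩ := C.run_after hk (by simp; omega) (by simp; omega) (hwt t s rfl) hS'
      have hT'' := hT'
      rw [run_cons hS.ne_nil] at hT''
      obtain ⟨h1, h2, y0, h3, h4⟩ := hT''
      rw [h3.unique hT] at h4
      simp only [after_lo, after_hi] at h1 h2
      exact ⟨y', by omega, h2, h4, Or.inr (Or.inr ⟨_, s, rfl, by simp; omega, hS', hT'⟩)⟩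
  · -- An instruction to the left that starts at the cut, or that crosses it, ends as if it had been
    -- started at the right end of the part before the cut.
    have jump : ∀ x', S.lo < x' → S.Go ⟨.Y, c⟩ p x' → ∃ y', T.lo < y' ∧ T.Go ⟨.Y, c⟩ q y' :=
      fun x' h1 h2 => by
        obtain ⟨y', h3⟩ := C.run_before (k := k) hk (t := []) (c := c) (by simp; omega)
          (by simp; omega) hw1 (x := x') ⟨h1, h2.1, h2⟩
        exact ⟨y', h3.1, h3.2.2⟩
    have done : ∀ y', T.lo < y' → S.Go ⟨.Y, c⟩ p x' → T.Go ⟨.Y, c⟩ q y' →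
        Located S T p q δ (⟨.Y, c⟩ :: h) x' y' := fun y' h1 h2 h3 =>
      Or.inr (Or.inl ⟨[], c, h, rfl, by simp; omega, ⟨hx1, h2.1, h2⟩, ⟨h1, h3.1, h3⟩⟩)
    rcases hxy with ⟨rfl, rfl⟩ | ⟨t, b, s, rfl, hlen, hS, hT⟩ | ⟨t, s, rfl, hlen, hS, hT⟩
    · obtain ⟨y', h1, h2⟩ := jump x' hx1 hgo
      exact ⟨y', h1, h2.1.trans hq.2, h2, done y' h1 hgo h2⟩
    · simp only [List.length_append, List.length_cons] at hlen hlk hlN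
      have hwt' := hwt (t ++ [⟨.Y, b⟩]) s (by simp)
      have hmS := hS.mem
      simp only [before_lo, before_hi] at hmS
      have hS' : (S.before p).Run (⟨.Y, c⟩ :: t ++ [⟨.Y, b⟩]) x' := by
        rw [List.cons_append, run_cons (by simp)]
        exact ⟨hx1, hgo.1.trans hmS.2, x, hS, hgo⟩
      obtain ⟨y', hT'⟩ := C.run_before hk (by simp; omega) (by simp; omega) hwt' hS'
      have hT'' := hT'
      rw [List.cons_append, run_cons (by simp)] at hT''
      obtain ⟨h1, h2, y0, h3, h4⟩ := hT''
      rw [h3.unique hT] at h4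
      simp only [before_lo, before_hi] at h1 h2
      exact ⟨y', h1, by omega, h4, Or.inr (Or.inl ⟨_, b, s, rfl, by simp; omega, hS', hT'⟩)⟩
    · simp only [List.length_append] at hlen hlk hlN
      have hmS := hS.mem
      have hmT := hT.mem
      simp only [after_lo, after_hi] at hmS hmT
      rcases lt_or_ge p x' with hlt | hge
      · have hS' : (S.after p).Run (⟨.Y, c⟩ :: t) x' := by
          rw [run_cons hS.ne_nil]
          exact ⟨hlt, hx2, x, hS, hgo⟩
        obtain ⟨y', hT'⟩ := C.run_after hk (by simp; omega) (by simp; omega) (hwt t s rfl) hS'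
        have hT'' := hT'
        rw [run_cons hS.ne_nil] at hT''
        obtain ⟨h1, h2, y0, h3, h4⟩ := hT''
        rw [h3.unique hT] at h4
        simp only [after_lo, after_hi] at h1 h2
        exact ⟨y', by omega, h2, h4, Or.inr (Or.inr ⟨_, s, rfl, by simp; omega, hS', hT'⟩)⟩
      · rcases cross_left hpa hqa hmS.1 hmT.1 (fun y' h1 h2 => by
          have hT' : (T.after q).Run (⟨.Y, c⟩ :: t) y' := by
            rw [run_cons hS.ne_nil]
            exact ⟨h1, h2.1.trans hmT.2, y, hT, h2⟩
          obtain ⟨x'', hS'⟩ := C.symm.run_after hk (by simp; omega) (by simp; omega)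
            (hwt t s rfl) hT'
          rw [run_cons hS.ne_nil] at hS'
          obtain ⟨h4, -, x0, h5, h6⟩ := hS'
          rw [h5.unique hS] at h6
          exact ⟨x'', h4, h6⟩) jump hgo hge hx1 with ⟨rfl, h1⟩ | ⟨h1, y', h2, h3, h4⟩
        · exact ⟨q, hq.1, hq.2, h1, Or.inl ⟨rfl, rfl⟩⟩
        · exact ⟨y', h2, h3.1.trans hq.2, h4, done y' h2 h1 h3⟩

/-- Runs whose first instruction can be located with respect to the cuts can be located
altogether. -/
theorem Cut.locate (C : Cut M N S T a p q) (hk : Transfers A k) (hδ : δ ≤ 1) {z : Step A}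
    (base : ∀ x, S.Run [z] x → ∃ y, T.Run [z] y ∧ Located S T p q δ [z] x y)
    {h : List (Step A)} (hlk : h.length + 1 ≤ k + δ) (hlN : h.length + 1 ≤ N + δ)
    (hw : wtR .X (h ++ [z]) ≤ M + 1) {x : ℤ} (hx : S.Run (h ++ [z]) x) :
    ∃ y, T.Run (h ++ [z]) y ∧ Located S T p q δ (h ++ [z]) x y := by
  induction h generalizing x with
  | nil => exact base x hx
  | cons z' h ih =>
    simp only [List.length_cons] at hlk hlN
    have hne : h ++ [z] ≠ [] := by simp
    rw [List.cons_append, run_cons hne] at hx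
    obtain ⟨h1, h2, x0, h3, h4⟩ := hx
    have hw' : wtR .X (h ++ [z]) ≤ M + 1 := by
      refine le_trans ?_ hw
      simp only [wtR, List.cons_append, List.map_cons]
      exact blocks_le_blocks_cons ..
    obtain ⟨y0, h5, h6⟩ := ih (by omega) (by omega) hw' h3
    obtain ⟨y, h7, h8, h9, h10⟩ := C.step hk hδ hne (by simp; omega) (by simp; omega) hw h6 h4 h1 h2
    refine ⟨y, ?_, h10⟩
    rw [List.cons_append, run_cons hne]
    exact ⟨h7, h8, y0, h5, h9⟩

/-- A run whose first instruction leads to the cut. What remains of it after the cut is shorter by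
one instruction (`δ = 1`), which makes induction on the length possible. -/
theorem Cut.locate_self (C : Cut M N S T a p q) (hk : Transfers A k)
    {h : List (Step A)} (hlk : h.length ≤ k) (hlN : h.length ≤ N)
    (hw : wtR .X (h ++ [⟨.X, a⟩]) ≤ M + 1) {x : ℤ} (hx : S.Run (h ++ [⟨.X, a⟩]) x) :
    ∃ y, T.Run (h ++ [⟨.X, a⟩]) y ∧ Located S T p q 1 (h ++ [⟨.X, a⟩]) x y :=
  C.locate hk le_rfl (fun _ hx => ⟨q, C.snd, Or.inl ⟨hx.unique C.fst, rfl⟩⟩) (by omega) (by omega)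
    hw hx

end Locating

theorem Equiv.exists_run_singleton {M N : ℕ} {S T : Seg A} (h : Equiv .X (M + 1) (N + 1) S T)
    {a : A} {p : ℤ} (hp : S.Run [⟨.X, a⟩] p) : ∃ q, T.Run [⟨.X, a⟩] q := by
  obtain ⟨q, h1, h2, h3, -⟩ := (h [⟨.X, a⟩] (by simp [wt]) (by simp)).1
    ⟨p, hp.1, hp.2.1, hp.2.2, trivial⟩
  exact ⟨q, h1, h2, h3⟩

/-- The induction step for runs that start to the right: the segments are cut at the position that
the first instruction leads to. -/
theorem Transfers.X_start {k : ℕ} (hk : Transfers A k) {M N : ℕ} {S T : Seg A}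
    (hE : Equiv .X M N S T) {h : List (Step A)} {a : A} (hlk : h.length ≤ k)
    (hlN : h.length + 1 ≤ N) (hw : wtR .X (h ++ [⟨.X, a⟩]) ≤ M) {x : ℤ}
    (hx : S.Run (h ++ [⟨.X, a⟩]) x) : ∃ y, T.Run (h ++ [⟨.X, a⟩]) y := by
  have := one_le_wtR .X (h ++ [⟨.X, a⟩])
  obtain ⟨M, rfl⟩ : ∃ M', M = M' + 1 := ⟨M - 1, by omega⟩
  obtain ⟨N, rfl⟩ : ∃ N', N = N' + 1 := ⟨N - 1, by omega⟩
  obtain ⟨p, hp⟩ := hx.first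
  obtain ⟨q, hq⟩ := hE.exists_run_singleton hp
  obtain ⟨y, hy, -⟩ := Cut.locate_self ⟨hE, hp, hq⟩ hk hlk (by omega) hw hx
  exact ⟨y, hy⟩

theorem Transfers.Y_start {k : ℕ} (hk : Transfers A k) {M N : ℕ} {S T : Seg A}
    (hE : Equiv .Y M N S T) {h : List (Step A)} {a : A} (hlk : h.length ≤ k)
    (hlN : h.length + 1 ≤ N) (hw : wtR .Y (h ++ [⟨.Y, a⟩]) ≤ M) {x : ℤ}
    (hx : S.Run (h ++ [⟨.Y, a⟩]) x) : ∃ y, T.Run (h ++ [⟨.Y, a⟩]) y := by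
  have hx' : S.flip.Run (h.map Step.flip ++ [⟨.X, a⟩]) (-x) := by
    have := (run_flip S (h ++ [⟨.Y, a⟩]) (-x)).2 (by rwa [neg_neg])
    simpa using this
  obtain ⟨y, hy⟩ := hk.X_start hE.flip (by simpa using hlk) (by simpa using hlN)
    (by rw [← wtR_map_flip] at hw; simpa using hw) hx'
  refine ⟨-y, (run_flip ..).1 ?_⟩
  simpa using hy

theorem transfers (k : ℕ) : Transfers A k := by
  induction k with
  | zero =>
    intro d M N S T _ h hl _ _ x hx
    exact absurd (List.length_eq_zero_iff.1 (Nat.le_zero.1 hl)) hx.ne_nil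
  | succ k ih =>
    intro d M N S T hE h hlk hlN hw x hx
    obtain ⟨h, ⟨d', a⟩, rfl⟩ : ∃ h' z, h = h' ++ [z] :=
      ⟨_, _, (List.dropLast_append_getLast hx.ne_nil).symm⟩
    simp only [List.length_append, List.length_cons, List.length_nil] at hlk hlN
    have hwflip := wtR_append_singleton_flip d h a
    rcases d with _ | _ <;> rcases d' with _ | _
    · exact ih.X_start hE (by omega) (by omega) hw hx
    · simp only [Dir.flip_X] at hwflip
      obtain ⟨M, rfl⟩ : ∃ M', M = M' + 1 := ⟨M - 1, by omega⟩
      exact ih.Y_start (hE.change_dir .Y) (by omega) (by omega) (by omega) hx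
    · simp only [Dir.flip_Y] at hwflip
      obtain ⟨M, rfl⟩ : ∃ M', M = M' + 1 := ⟨M - 1, by omega⟩
      exact ih.X_start (hE.change_dir .X) (by omega) (by omega) (by omega) hx
    · exact ih.Y_start hE (by omega) (by omega) hw hx

/-- Runs of bounded weight transfer between equivalent segments. -/
theorem Equiv.exists_run {d : Dir} {M N : ℕ} {S T : Seg A} (hE : Equiv d M N S T)
    {h : List (Step A)} (hl : h.length ≤ N) (hw : wtR d h ≤ M) {x : ℤ} (hx : S.Run h x) :
    ∃ y, T.Run h y :=
  transfers h.length d M N S T hE h le_rfl hl hw x hx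

/-! ### Equivalent segments order the runs in the same way -/

/-- The pairs `(x, y)` and `(x', y')` are ordered in the same way. -/
def SameOrder (x y x' y' : ℤ) : Prop := (x < y ↔ x' < y') ∧ (y < x ↔ y' < x')

/-- Between equivalent segments, the order of the end points of two runs of total length at most
`L` transfers, unless the weights of both runs attain the bound. -/
def OrderTransfers (A : Type u) (L : ℕ) : Prop :=
  ∀ (d : Dir) (M N : ℕ) (S T : Seg A), Equiv d M N S T → ∀ g h : List (Step A),
    g.length + h.length ≤ L → g.length + h.length ≤ N → wtR d g ≤ M → wtR d h ≤ M →
    wtR d g + wtR d h < 2 * M → ∀ x y x' y', S.Run g x → S.Run h y → T.Run g x' → T.Run h y' →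
    SameOrder x y x' y'

section Order

variable {L M N : ℕ} {S T : Seg A} {a : A} {p q : ℤ}

theorem Cut.sameOrder_of_located (C : Cut M N S T a p q) (hL : OrderTransfers A L)
    {g h : List (Step A)} (hlL : g.length + h.length ≤ L + 1) (hlN : g.length + h.length ≤ N + 1)
    (hwg : wtR .X g ≤ M + 1) (hwh : wtR .X h ≤ M + 1) (hw : wtR .X g + wtR .X h < 2 * (M + 1))
    {x y x' y' : ℤ} (hg : Located S T p q 1 g x x') (hh : Located S T p q 0 h y y') :
    SameOrder x y x' y' := by
  rcases hg with ⟨rfl, rfl⟩ | ⟨t, b, s, rfl, hlen, hS, hT⟩ | ⟨t, s, rfl, hlen, hS, hT⟩ <;>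
  rcases hh with ⟨rfl, rfl⟩ | ⟨t', b', s', rfl, hlen', hS', hT'⟩ | ⟨t', s', rfl, hlen', hS', hT'⟩
  · exact ⟨by omega, by omega⟩
  · have h1 := hS'.mem.2; have h2 := hT'.mem.2; simp at h1 h2; exact ⟨by omega, by omega⟩
  · have h1 := hS'.mem.1; have h2 := hT'.mem.1; simp at h1 h2; exact ⟨by omega, by omega⟩
  · have h1 := hS.mem.2; have h2 := hT.mem.2; simp at h1 h2; exact ⟨by omega, by omega⟩
  · have e1 := wtR_prefix .X (t ++ [⟨.Y, b⟩]) s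
    have e2 := wtR_prefix .X (t' ++ [⟨.Y, b'⟩]) s'
    have e3 := wtR_append_singleton_flip .X t b
    have e4 := wtR_append_singleton_flip .X t' b'
    simp only [Dir.flip_X, List.append_assoc, List.cons_append, List.nil_append] at e1 e2 e3 e4
    refine hL .Y M N _ _ C.before _ _ ?_ ?_ ?_ ?_ ?_ _ _ _ _ hS hS' hT hT'
    · simp at *; omega
    · simp at *; omega
    all_goals omega
  · have h1 := hS.mem.2; have h2 := hT.mem.2; have h3 := hS'.mem.1; have h4 := hT'.mem.1
    simp at h1 h2 h3 h4; exact ⟨by omega, by omega⟩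
  · have h1 := hS.mem.1; have h2 := hT.mem.1; simp at h1 h2; exact ⟨by omega, by omega⟩
  · have h1 := hS.mem.1; have h2 := hT.mem.1; have h3 := hS'.mem.2; have h4 := hT'.mem.2
    simp at h1 h2 h3 h4; exact ⟨by omega, by omega⟩
  · have e1 := wtR_prefix .X t s
    have e2 := wtR_prefix .X t' s'
    refine hL .X (M + 1) N _ _ C.after _ _ ?_ ?_ ?_ ?_ ?_ _ _ _ _ hS hS' hT hT'
    · simp at *; omega
    · simp at *; omega
    all_goals omega

/-- A first instruction to the left can be located. -/
theorem Cut.base_Y (C : Cut M N S T a p q) (hN : 1 ≤ N) (hM : 1 ≤ M) (b : A) (x : ℤ)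
    (hx : S.Run [⟨.Y, b⟩] x) : ∃ y, T.Run [⟨.Y, b⟩] y ∧ Located S T p q 0 [⟨.Y, b⟩] x y := by
  have hp := C.fst.mem
  have hq := C.snd.mem
  have hk := transfers (A := A) 1
  have hw : wtR .X [(⟨.Y, b⟩ : Step A)] ≤ M + 1 := by
    have : wtR .X [(⟨.Y, b⟩ : Step A)] = 2 := rfl
    omega
  obtain ⟨hx1, hx2, hgo⟩ := hx
  rcases lt_or_ge p x with hlt | hge
  · have hS : (S.after p).Run [⟨.Y, b⟩] x := ⟨hlt, hx2, hgo⟩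
    obtain ⟨y, hT⟩ := C.run_after hk (by simp) (by simpa using hN) hw hS
    have h1 := hT.1
    simp only [after_lo] at h1
    exact ⟨y, ⟨by omega, hT.2.1, hT.2.2⟩, Or.inr (Or.inr ⟨_, [], rfl, by simp, hS, hT⟩)⟩
  · rcases cross_left C.fst.letter C.snd.letter hp.2 hq.2 (fun y' h1 h2 => by
      obtain ⟨x', h3⟩ := C.symm.run_after hk (t := [⟨.Y, b⟩]) (by simp) (by simpa using hN) hw
        (x := y') ⟨h1, h2.1, h2⟩
      exact ⟨x', h3.1, h3.2.2⟩) (fun x' h1 h2 => by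
      obtain ⟨y', h3⟩ := C.run_before hk (t := []) (c := b) (by simp) (by simpa using hN) hw
        (x := x') ⟨h1, h2.1, h2⟩
      exact ⟨y', h3.1, h3.2.2⟩) hgo hge hx1 with ⟨rfl, h1⟩ | ⟨h1, y', h2, h3, h4⟩
    · exact ⟨q, ⟨hq.1, hq.2, h1⟩, Or.inl ⟨rfl, rfl⟩⟩
    · exact ⟨y', ⟨h2, h3.1.trans hq.2, h4⟩, Or.inr (Or.inl ⟨[], b, [], rfl, by simp,
        ⟨hx1, h1.1, h1⟩, ⟨h2, h3.1, h3⟩⟩)⟩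

/-- A first instruction to the right that does not stop before the cut can be located. -/
theorem Cut.base_X (C : Cut M N S T a p q) (hN : 1 ≤ N) (hM : 1 ≤ M) (b : A) (x : ℤ)
    (hpx : p ≤ x) (hx : S.Run [⟨.X, b⟩] x) :
    ∃ y, T.Run [⟨.X, b⟩] y ∧ Located S T p q 0 [⟨.X, b⟩] x y := by
  have hp := C.fst.mem
  have hq := C.snd.mem
  have hk := transfers (A := A) 1
  have hw : wtR .X [(⟨.Y, b⟩ : Step A)] ≤ M + 1 := by
    have : wtR .X [(⟨.Y, b⟩ : Step A)] = 2 := rfl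
    omega
  obtain ⟨hx1, hx2, hgo⟩ := hx
  rcases cross_right C.fst.letter C.snd.letter hp.1 hq.1 (fun y' h1 h2 => by
      -- An occurrence of `b` before the cut can be reached from the left and from the right.
      obtain ⟨y'', h3, h4⟩ := T.exists_go_Y h1 h2.2.1
      obtain ⟨x', h5⟩ := C.symm.run_before hk (t := []) (c := b) (by simp) (by simpa using hN) hw
        (x := y'') ⟨h2.1.trans_le h3, h4.1, h4⟩
      obtain ⟨x'', h6, h7⟩ := S.exists_go_X h5.1 h5.letter
      exact ⟨x'', h6.trans_lt h5.2.1, h7⟩) (fun x' h1 h2 => by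
      obtain ⟨y', h3⟩ := C.run_after hk (t := [⟨.X, b⟩]) (by simp) (by simpa using hN)
        (by simp [wtR]) (x := x') ⟨h2.1, h1, h2⟩
      exact ⟨y', h3.2.1, h3.2.2⟩) hgo hpx hx2 with ⟨rfl, h1⟩ | ⟨h1, y', h2, h3, h4⟩
  · exact ⟨q, ⟨hq.1, hq.2, h1⟩, Or.inl ⟨rfl, rfl⟩⟩
  · exact ⟨y', ⟨hq.1.trans h3.1, h2, h4⟩, Or.inr (Or.inr ⟨[⟨.X, b⟩], [], rfl, by simp,
      ⟨h1.1, hx2, h1⟩, ⟨h3.1, h2, h3⟩⟩)⟩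

/-- The induction step for a run `g ++ [X_a]` and a run `h ++ [z]`, where the first instruction of
the latter does not stop before the first `a`. Both are located with respect to the first `a`, and
if they end in the same part, the induction hypothesis applies there, the first of the two runs
having become shorter. -/
theorem OrderTransfers.X_start (hL : OrderTransfers A L) (hE : Equiv .X M N S T)
    {g h : List (Step A)} {z : Step A} (hlL : g.length + h.length + 2 ≤ L + 1)
    (hlN : g.length + h.length + 2 ≤ N) (hwg : wtR .X (g ++ [⟨.X, a⟩]) ≤ M)
    (hwh : wtR .X (h ++ [z]) ≤ M) (hw : wtR .X (g ++ [⟨.X, a⟩]) + wtR .X (h ++ [z]) < 2 * M)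
    (hz : z.dir = .X → ∀ p x, S.Run [⟨.X, a⟩] p → S.Run [z] x → p ≤ x) {x y x' y' : ℤ}
    (hx : S.Run (g ++ [⟨.X, a⟩]) x) (hy : S.Run (h ++ [z]) y)
    (hx' : T.Run (g ++ [⟨.X, a⟩]) x') (hy' : T.Run (h ++ [z]) y') : SameOrder x y x' y' := by
  have e1 := one_le_wtR .X (g ++ [⟨.X, a⟩])
  have e2 := one_le_wtR .X (h ++ [z])
  obtain ⟨M, rfl⟩ : ∃ M', M = M' + 1 := ⟨M - 1, by omega⟩
  obtain ⟨N, rfl⟩ : ∃ N', N = N' + 1 := ⟨N - 1, by omega⟩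
  obtain ⟨p, hp⟩ := hx.first
  obtain ⟨q, hq⟩ := hE.exists_run_singleton hp
  have C : Cut M N S T a p q := ⟨hE, hp, hq⟩
  have hk := transfers (A := A) (N + 1)
  obtain ⟨x'', h1, h2⟩ := C.locate_self hk (by omega) (by omega) hwg hx
  obtain ⟨y'', h3, h4⟩ := C.locate hk (δ := 0) (by omega) (z := z) (fun x hx => by
    rcases z with ⟨_ | _, b⟩
    · exact C.base_X (by omega) (by omega) b x (hz rfl p x hp hx) hx
    · exact C.base_Y (by omega) (by omega) b x hx) (by omega) (by omega) hwh hy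
  rw [h1.unique hx'] at h2
  rw [h3.unique hy'] at h4
  exact C.sameOrder_of_located hL (by simp; omega) (by simp; omega) hwg hwh hw h2 h4

/-- The induction step if at least one of the two runs starts to the right. -/
theorem OrderTransfers.some_X_start (hL : OrderTransfers A L) (hE : Equiv .X M N S T)
    {g h : List (Step A)} {z z' : Step A} (hlL : g.length + h.length + 2 ≤ L + 1)
    (hlN : g.length + h.length + 2 ≤ N) (hwg : wtR .X (g ++ [z]) ≤ M)
    (hwh : wtR .X (h ++ [z']) ≤ M) (hw : wtR .X (g ++ [z]) + wtR .X (h ++ [z']) < 2 * M)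
    (hz : z.dir = .X ∨ z'.dir = .X) {x y x' y' : ℤ}
    (hx : S.Run (g ++ [z]) x) (hy : S.Run (h ++ [z']) y)
    (hx' : T.Run (g ++ [z]) x') (hy' : T.Run (h ++ [z']) y') : SameOrder x y x' y' := by
  obtain ⟨p, hp⟩ := hx.first
  obtain ⟨p', hp'⟩ := hy.first
  rcases z with ⟨_ | _, a⟩ <;> rcases z' with ⟨_ | _, a'⟩
  · rcases le_total p p' with hle | hle
    · refine hL.X_start hE hlL hlN hwg hwh hw (fun _ r s hr hs => ?_) hx hy hx' hy'
      rwa [hr.unique hp, hs.unique hp']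
    · refine (hL.X_start hE (by omega) (by omega) hwh hwg (by omega) (fun _ r s hr hs => ?_)
        hy hx hy' hx').symm
      rwa [hr.unique hp', hs.unique hp]
  · exact hL.X_start hE hlL hlN hwg hwh hw (by simp) hx hy hx' hy'
  · exact (hL.X_start hE (by omega) (by omega) hwh hwg (by omega) (by simp) hy hx hy' hx').symm
  · simp at hz

theorem OrderTransfers.some_Y_start (hL : OrderTransfers A L) (hE : Equiv .Y M N S T)
    {g h : List (Step A)} {z z' : Step A} (hlL : g.length + h.length + 2 ≤ L + 1)
    (hlN : g.length + h.length + 2 ≤ N) (hwg : wtR .Y (g ++ [z]) ≤ M)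
    (hwh : wtR .Y (h ++ [z']) ≤ M) (hw : wtR .Y (g ++ [z]) + wtR .Y (h ++ [z']) < 2 * M)
    (hz : z.dir = .Y ∨ z'.dir = .Y) {x y x' y' : ℤ}
    (hx : S.Run (g ++ [z]) x) (hy : S.Run (h ++ [z']) y)
    (hx' : T.Run (g ++ [z]) x') (hy' : T.Run (h ++ [z']) y') : SameOrder x y x' y' := by
  have hr : ∀ (U : Seg A) (g : List (Step A)) (z : Step A) (x : ℤ), U.Run (g ++ [z]) x →
      U.flip.Run (g.map Step.flip ++ [z.flip]) (-x) := fun U g z x hx => by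
    have := (run_flip U (g ++ [z]) (-x)).2 (by rwa [neg_neg])
    simpa using this
  have hwt : ∀ (g : List (Step A)) (z : Step A),
      wtR .X (g.map Step.flip ++ [z.flip]) = wtR .Y (g ++ [z]) := fun g z => by
    rw [← wtR_map_flip]
    simp [Function.comp_def]
  have := hL.some_X_start (M := M) (N := N) hE.flip (g := g.map Step.flip) (h := h.map Step.flip)
    (z := z.flip) (z' := z'.flip) (by simpa using hlL) (by simpa using hlN) (by rwa [hwt])
    (by rwa [hwt]) (by rwa [hwt, hwt]) (by
      rcases z with ⟨_ | _, a⟩ <;> rcases z' with ⟨_ | _, a'⟩ <;> simp_all)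
    (hr _ _ _ _ hx) (hr _ _ _ _ hy) (hr _ _ _ _ hx') (hr _ _ _ _ hy')
  simp only [SameOrder, neg_lt_neg_iff] at this
  exact this.symm

end Order

theorem orderTransfers (L : ℕ) : OrderTransfers A L := by
  induction L with
  | zero =>
    intro d M N S T _ g h hl _ _ _ _ x y x' y' hx
    exact absurd (List.length_eq_zero_iff.1 (by omega)) hx.ne_nil
  | succ L ih =>
    intro d M N S T hE g h hlL hlN hwg hwh hw x y x' y' hx hy hx' hy'
    obtain ⟨g, ⟨d1, a⟩, rfl⟩ : ∃ g' z, g = g' ++ [z] :=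
      ⟨_, _, (List.dropLast_append_getLast hx.ne_nil).symm⟩
    obtain ⟨h, ⟨d2, b⟩, rfl⟩ : ∃ h' z, h = h' ++ [z] :=
      ⟨_, _, (List.dropLast_append_getLast hy.ne_nil).symm⟩
    simp only [List.length_append, List.length_cons, List.length_nil] at hlL hlN
    have e1 := wtR_append_singleton_flip d g a
    have e2 := wtR_append_singleton_flip d h b
    -- If both runs start against the direction `d`, one block is spared by changing `d`.
    rcases d with _ | _
    · by_cases hd : d1 = .X ∨ d2 = .X
      · exact ih.some_X_start hE (by omega) (by omega) hwg hwh hw hd hx hy hx' hy'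
      · obtain ⟨rfl, rfl⟩ : d1 = .Y ∧ d2 = .Y := by
          cases d1 <;> cases d2 <;> simp_all
        simp only [Dir.flip_X] at e1 e2
        obtain ⟨M, rfl⟩ : ∃ M', M = M' + 1 := ⟨M - 1, by omega⟩
        exact ih.some_Y_start (hE.change_dir .Y) (by omega) (by omega) (by omega) (by omega)
          (by omega) (by simp) hx hy hx' hy'
    · by_cases hd : d1 = .Y ∨ d2 = .Y
      · exact ih.some_Y_start hE (by omega) (by omega) hwg hwh hw hd hx hy hx' hy'
      · obtain ⟨rfl, rfl⟩ : d1 = .X ∧ d2 = .X := by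
          cases d1 <;> cases d2 <;> simp_all
        simp only [Dir.flip_Y] at e1 e2
        obtain ⟨M, rfl⟩ : ∃ M', M = M' + 1 := ⟨M - 1, by omega⟩
        exact ih.some_X_start (hE.change_dir .X) (by omega) (by omega) (by omega) (by omega)
          (by omega) (by simp) hx hy hx' hy'

/-- Equivalent segments order runs in the same way, unless the weights of both runs attain the
bound. -/
theorem Equiv.sameOrder {d : Dir} {M N : ℕ} {S T : Seg A} (hE : Equiv d M N S T)
    {g h : List (Step A)} (hl : g.length + h.length ≤ N) (hwg : wtR d g ≤ M) (hwh : wtR d h ≤ M)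
    (hw : wtR d g + wtR d h < 2 * M) {x y x' y' : ℤ} (hx : S.Run g x) (hy : S.Run h y)
    (hx' : T.Run g x') (hy' : T.Run h y') : SameOrder x y x' y' :=
  orderTransfers _ d M N S T hE g h le_rfl hl hwg hwh hw x y x' y' hx hy hx' hy'

end Seg

/-! ### Words as segments -/

/-- The letters of `w` at the positions `1, …, w.length`, as a function on the integers. -/
def letterFn (w : List A) (x : ℤ) : Option A := if 1 ≤ x then w[(x - 1).toNat]? else none

/-- A word as a segment. -/
def ofWord (w : List A) : Seg A := ⟨letterFn w, 0, w.length + 1⟩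

theorem letterAt_iff {w : List A} {i : ℕ} {a : A} :
    LetterAt w i a ↔ letterFn w i = some a := by
  unfold LetterAt letterFn
  have : ((i : ℤ) - 1).toNat = i - 1 := by omega
  split_ifs with h
  · rw [this]
    exact and_iff_right (by omega)
  · simp
    omega

theorem letterFn_ne_none {w : List A} {x : ℤ} : letterFn w x ≠ none ↔ 1 ≤ x ∧ x ≤ w.length := by
  unfold letterFn
  split_ifs with h
  · simp only [ne_eq, List.getElem?_eq_none_iff, h, true_and]
    omega
  · simp [h]

theorem letterFn_append_append (x u y : List A) (t : ℤ) (h1 : 0 < t) (h2 : t < u.length + 1) :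
    letterFn (x ++ u ++ y) (t + x.length) = letterFn u t := by
  unfold letterFn
  rw [if_pos (by omega), if_pos (by omega), List.append_assoc,
    List.getElem?_append_right (by omega), List.getElem?_append_left (by omega)]
  congr 1
  omega

theorem letterFn_append_left (x y : List A) (t : ℤ) (h : t ≤ x.length) :
    letterFn (x ++ y) t = letterFn x t := by
  unfold letterFn
  split_ifs with h1
  · rw [List.getElem?_append_left (by omega)]
  · rfl

theorem letterFn_append_right (x y : List A) (t : ℤ) (h : x.length + 1 ≤ t) :
    letterFn (x ++ y) t = letterFn y (t - x.length) := by
  unfold letterFn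
  rw [if_pos (by omega), if_pos (by omega), List.getElem?_append_right (by omega)]
  congr 1
  omega

/-- Instructions on words, in terms of segments. The ends `lo` and `hi` play no role. -/
theorem goes_iff {w : List A} {lo hi : ℤ} {z : Step A} {x y : ℕ} :
    z.Goes w x y ↔ (Seg.mk (letterFn w) lo hi).Go z x y := by
  rcases z with ⟨_ | _, a⟩
  · simp only [Step.Goes, Seg.go_X, IsLeast, mem_lowerBounds, Set.mem_ofPred_eq, letterAt_iff,
      and_assoc, Nat.cast_lt, and_imp]
    refine and_congr_right fun _ => and_congr_right fun _ => ⟨fun h t h1 h2 h3 => ?_,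
      fun h t h1 h2 => ?_⟩
    · obtain ⟨t, rfl⟩ := Int.eq_ofNat_of_zero_le (a := t) (by omega)
      have := h t (by omega) h3
      omega
    · by_contra hlt
      exact h t (by omega) (by omega) h2
  · simp only [Step.Goes, Seg.go_Y, IsGreatest, mem_upperBounds, Set.mem_ofPred_eq, letterAt_iff,
      and_assoc, Nat.cast_lt, and_imp]
    refine and_congr_right fun _ => and_congr_right fun _ => ⟨fun h t h1 h2 h3 => ?_,
      fun h t h1 h2 => ?_⟩
    · obtain ⟨t, rfl⟩ := Int.eq_ofNat_of_zero_le (a := t) (by omega)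
      have := h t (by omega) h3
      omega
    · by_contra hlt
      exact h t (by omega) (by omega) h2

/-- The condition that defines condensed rankers, for `z :: r` and for chains of intervals that
start with `(i₀, j₀)`. -/
def CondensedOn (w : List A) (i₀ j₀ : ℕ) (z : Step A) (r : List (Step A)) : Prop :=
  ∃ p, RunsTo w (z :: r) (match z.dir with | .X => i₀ | .Y => j₀) p ∧
    ∃ i j : ℕ → ℕ, i 0 = i₀ ∧ j 0 = j₀ ∧
      (∀ (k : ℕ) (y y' : Step A), (z :: r)[k]? = some y → (z :: r)[k + 1]? = some y' →
        Set.Ioo (i (k + 1)) (j (k + 1)) ⊂ Set.Ioo (i k) (j k) ∧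
        Narrows w y y' (i k) (j k) (i (k + 1)) (j (k + 1))) ∧
      p ∈ Set.Ioo (i r.length) (j r.length)

/-- The chain of intervals of a condensed ranker is determined by its first interval, and its strict
monotonicity says that every instruction stays inside the current interval. -/
theorem condensedOn_iff_cond (w : List A) (z : Step A) (r : List (Step A)) (i₀ j₀ : ℕ) :
    CondensedOn w i₀ j₀ z r ↔ (Seg.mk (letterFn w) i₀ j₀).Cond (z :: r) := by
  have hstart : ((match z.dir with | .X => i₀ | .Y => j₀ : ℕ) : ℤ) =
      (Seg.mk (letterFn w) i₀ j₀).start z.dir := by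
    rcases z with ⟨_ | _, a⟩ <;> rfl
  induction r generalizing z i₀ j₀ with
  | nil =>
    constructor
    · rintro ⟨p, ⟨q, hq, rfl⟩, i, j, rfl, rfl, -, hp⟩
      rw [goes_iff, hstart] at hq
      simp only [List.length_nil, Set.mem_Ioo] at hp
      exact ⟨p, by simp; omega, by simp; omega, hq, trivial⟩
    · rintro ⟨p, h1, h2, h3, -⟩
      simp only at h1 h2
      obtain ⟨p, rfl⟩ := Int.eq_ofNat_of_zero_le (a := p) (by omega)
      rw [← hstart] at h3
      exact ⟨p, ⟨p, goes_iff.2 h3, rfl⟩, fun _ => i₀, fun _ => j₀, rfl, rfl, by simp,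
        by simp; omega⟩
  | cons z' r ih =>
    have hstart' : ∀ i₁ j₁ : ℕ, ((match z'.dir with | .X => i₁ | .Y => j₁ : ℕ) : ℤ) =
        (Seg.mk (letterFn w) i₁ j₁).start z'.dir := by
      rcases z' with ⟨_ | _, a⟩ <;> exact fun _ _ => rfl
    constructor
    · rintro ⟨p, ⟨q, hq, hrun⟩, i, j, rfl, rfl, hchain, hp⟩
      obtain ⟨hss, hnar⟩ := hchain 0 z z' rfl rfl
      simp only [zero_add] at hss hnar
      have hnext : RunsTo w (z' :: r) (match z'.dir with | .X => i 1 | .Y => j 1) p →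
          (Seg.mk (letterFn w) (i 1) (j 1)).Cond (z' :: r) := fun hrun =>
        (ih z' (i 1) (j 1) (hstart' _ _)).1 ⟨p, hrun, fun k => i (k + 1), fun k => j (k + 1), rfl,
          rfl, fun k y y' h1 h2 => hchain (k + 1) y y' h1 h2, hp⟩
      have hne : (Seg.mk (letterFn w) (i 1) (j 1)).Cond (z' :: r) → i 1 + 1 < j 1 := fun h => by
        obtain ⟨P, h1, h2, -⟩ := h
        simp only at h1 h2
        omega
      have hq' := goes_iff (lo := i 0) (hi := j 0) |>.1 hq
      have hlt := hq
      rcases z with ⟨_ | _, a⟩ <;> rcases z' with ⟨_ | _, a'⟩ <;>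
        simp only [Narrows] at hnar hrun hnext hq hq'
      · obtain ⟨h1, h2⟩ := hnar
        obtain rfl : q = i 1 := hq.unique h1
        have h3 := hnext hrun
        have h4 := hne h3
        have := hq.1.1
        refine ⟨(i 1 : ℕ), by simp; omega, by simp; omega, hq', ?_⟩
        rw [h2] at h3
        exact h3
      · obtain ⟨h1, h2⟩ := hnar
        obtain rfl : q = j 1 := hq.unique h2
        have h3 := hnext hrun
        have h4 := hne h3
        have := hq.1.1
        have h5 : j 1 < j 0 := by
          by_contra hle
          exact hss.2 (by rw [h1]; exact Set.Ioo_subset_Ioo_right (by omega))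
        refine ⟨(j 1 : ℕ), by simp; omega, by simp; omega, hq', ?_⟩
        rw [h1] at h3
        exact h3
      · obtain ⟨h1, h2⟩ := hnar
        obtain rfl : q = i 1 := hq.unique h1
        have h3 := hnext hrun
        have h4 := hne h3
        have := hq.1.1
        have h5 : i 0 < i 1 := by
          by_contra hle
          exact hss.2 (by rw [h2]; exact Set.Ioo_subset_Ioo_left (by omega))
        refine ⟨(i 1 : ℕ), by simp; omega, by simp; omega, hq', ?_⟩
        rw [h2] at h3
        exact h3
      · obtain ⟨h1, h2⟩ := hnar
        obtain rfl : q = j 1 := hq.unique h2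
        have h3 := hnext hrun
        have h4 := hne h3
        have := hq.1.1
        refine ⟨(j 1 : ℕ), by simp; omega, by simp; omega, hq', ?_⟩
        rw [h1] at h3
        exact h3
    · rintro ⟨q, h1, h2, h3, h4⟩
      simp only at h1 h2
      obtain ⟨q, rfl⟩ := Int.eq_ofNat_of_zero_le (a := q) (by omega)
      rw [← hstart] at h3
      have hq := goes_iff.2 h3
      have extend : ∀ i₁ j₁ : ℕ, Set.Ioo i₁ j₁ ⊂ Set.Ioo i₀ j₀ → Narrows w z z' i₀ j₀ i₁ j₁ →
          (match z'.dir with | .X => i₁ | .Y => j₁) = q →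
          (Seg.mk (letterFn w) i₁ j₁).Cond (z' :: r) → CondensedOn w i₀ j₀ z (z' :: r) := by
        intro i₁ j₁ hss hnar hqe hc
        obtain ⟨p, hrun, i, j, rfl, rfl, hchain, hp⟩ := (ih z' i₁ j₁ (hstart' _ _)).2 hc
        rw [hqe] at hrun
        refine ⟨p, ⟨q, hq, hrun⟩, fun k => Nat.casesOn k i₀ i, fun k => Nat.casesOn k j₀ j, rfl,
          rfl, fun k y y' hy hy' => ?_, hp⟩
        rcases k with - | k
        · obtain rfl : z = y := by simpa using hy
          obtain rfl : z' = y' := by simpa using hy'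
          exact ⟨hss, hnar⟩
        · exact hchain k y y' hy hy'
      have hright : Set.Ioo q j₀ ⊂ Set.Ioo i₀ j₀ :=
        ⟨Set.Ioo_subset_Ioo_left (by omega), fun h => by
          have := (h (show q ∈ Set.Ioo i₀ j₀ from ⟨by omega, by omega⟩)).1
          omega⟩
      have hleft : Set.Ioo i₀ q ⊂ Set.Ioo i₀ j₀ :=
        ⟨Set.Ioo_subset_Ioo_right (by omega), fun h => by
          have := (h (show q ∈ Set.Ioo i₀ j₀ from ⟨by omega, by omega⟩)).2
          omega⟩
      rcases z with ⟨_ | _, a⟩ <;> rcases z' with ⟨_ | _, a'⟩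
      · exact extend q j₀ hright ⟨hq, rfl⟩ rfl h4
      · exact extend i₀ q hleft ⟨rfl, hq⟩ rfl h4
      · exact extend q j₀ hright ⟨hq, rfl⟩ rfl h4
      · exact extend i₀ q hleft ⟨rfl, hq⟩ rfl h4

theorem condensed_iff_cond {w : List A} {r : List (Step A)} (hr : r ≠ []) :
    Condensed w r ↔ (ofWord w).Cond r := by
  rcases r with - | ⟨z, r⟩
  · exact absurd rfl hr
  · have := condensedOn_iff_cond w z r 0 (w.length + 1)
    push_cast at this
    exact this

/-- The depth decreases by one, since `CondEquiv d M n` only considers depth less than `n` for the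
rankers with fewer than `M` blocks. -/
theorem CondEquiv.equiv {d : Dir} {M N : ℕ} {v w : List A} (h : CondEquiv d M (N + 1) v w) :
    Seg.Equiv d M N (ofWord v) (ofWord w) := by
  intro r h1 h2
  rcases r with - | ⟨⟨d', a⟩, r⟩
  · simp [Seg.Cond]
  · rw [← condensed_iff_cond (by simp), ← condensed_iff_cond (by simp)]
    refine h _ ?_
    have hflip := Seg.wt_cons_flip d' a r
    have hself : Seg.wt d' (⟨d', a⟩ :: r) =
        blocks (((⟨d', a⟩ : Step A) :: r).map Step.dir) := by simp [Seg.wt]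
    by_cases hd : d' = d
    · subst hd
      rcases h1.eq_or_lt with h1 | h1
      · exact Or.inl ⟨_, by omega, by simp, by omega, rfl⟩
      · exact Or.inr ⟨d', _, h1, _, Nat.lt_succ_of_le h2, by simp, by omega, rfl⟩
    · obtain rfl : d = d'.flip := by cases d <;> cases d' <;> simp_all
      exact Or.inr ⟨d', _, by omega, _, Nat.lt_succ_of_le h2, by simp, rfl, rfl⟩

/-- The factor `u` of `x ++ u ++ y` as a segment. -/
def factor (x u y : List A) : Seg A :=
  ⟨letterFn (x ++ u ++ y), x.length, x.length + u.length + 1⟩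

theorem cond_factor (x u y : List A) (r : List (Step A)) :
    (factor x u y).Cond r ↔ (ofWord u).Cond r :=
  Seg.cond_shift (ofWord u) (factor x u y) x.length (by simp [factor, ofWord])
    (by simp [factor, ofWord]; omega) (fun t h1 h2 => letterFn_append_append x u y t h1 h2) r

theorem Seg.Equiv.factor {d : Dir} {M N : ℕ} {u v : List A}
    (h : Seg.Equiv d M N (ofWord u) (ofWord v)) (x y : List A) :
    Seg.Equiv d M N (factor x u y) (factor x v y) := fun r h1 h2 => by
  rw [cond_factor, cond_factor]
  exact h r h1 h2

/-! ### The two-pebble game -/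

open Seg

/-- The information on two segments that is needed to play the game with `m` blocks of quantifiers
and depth at most `n`: runs with at most `m` blocks transfer, and the order of their end points
transfers unless both have `m` blocks and end in the same direction. Since runs are listed with
their last instruction first, `wt d h ≤ m` bounds the number of blocks of `h` followed by an
instruction of direction `d`. -/
structure Similar (m n : ℕ) (S T : Seg A) : Prop where
  run : ∀ h : List (Step A), h.length ≤ n → blocks (h.map Step.dir) ≤ m →
    ∀ x, S.Run h x → ∃ y, T.Run h y
  run' : ∀ h : List (Step A), h.length ≤ n → blocks (h.map Step.dir) ≤ m →
    ∀ x, T.Run h x → ∃ y, S.Run h y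
  order : ∀ g h : List (Step A), g.length ≤ n → h.length ≤ n → blocks (g.map Step.dir) < m →
    blocks (h.map Step.dir) ≤ m → ∀ x y x' y', S.Run g x → S.Run h y → T.Run g x' → T.Run h y' →
    SameOrder x y x' y'
  order' : ∀ g h : List (Step A), g.length ≤ n → h.length ≤ n → wt .X g ≤ m → wt .Y h ≤ m →
    ∀ x y x' y', S.Run g x → S.Run h y → T.Run g x' → T.Run h y' → SameOrder x y x' y'

theorem Seg.SameOrder.swap {x y x' y' : ℤ} (h : SameOrder x y x' y') : SameOrder x' y' x y :=
  ⟨h.1.symm, h.2.symm⟩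

theorem Similar.symm {m n : ℕ} {S T : Seg A} (h : Similar m n S T) : Similar m n T S where
  run := h.run'
  run' := h.run
  order g k h1 h2 h3 h4 x y x' y' h5 h6 h7 h8 :=
    (h.order g k h1 h2 h3 h4 x' y' x y h7 h8 h5 h6).swap
  order' g k h1 h2 h3 h4 x y x' y' h5 h6 h7 h8 :=
    (h.order' g k h1 h2 h3 h4 x' y' x y h7 h8 h5 h6).swap

/-- The parity of the number of blocks is determined by the two ends of a sequence. -/
theorem blocks_mod_two (e d : Dir) (l : List Dir) :
    blocks (e :: (l ++ [d])) % 2 = if e = d then 1 else 0 := by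
  induction l generalizing e with
  | nil => cases e <;> cases d <;> rfl
  | cons f l ih =>
    rw [List.cons_append, blocks_cons_cons]
    have := ih f
    cases e <;> cases d <;> cases f <;> simp at this ⊢ <;> omega

/-- The game with `m` blocks of quantifiers can be played on segments that agree on the condensed
rankers with `m + 1` blocks. The factor `2` is due to the comparison of two runs. -/
theorem Seg.Equiv.similar {d : Dir} {m n : ℕ} {S T : Seg A} (hE : Equiv d (m + 1) (2 * n) S T) :
    Similar m n S T := by
  have hR : ∀ h : List (Step A), wtR d h ≤ blocks (h.map Step.dir) + 1 := fun h => by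
    have := blocks_cons_le d (h.map Step.dir).reverse
    rw [← blocks_reverse (h.map Step.dir), wtR, ← blocks_reverse]
    simpa using this
  refine ⟨fun h h1 h2 x hx => ?_, fun h h1 h2 x hx => ?_,
    fun g h h1 h2 h3 h4 x y x' y' hx hy hx' hy' => ?_,
    fun g h h1 h2 h3 h4 x y x' y' hx hy hx' hy' => ?_⟩
  · exact hE.exists_run (by omega) ((hR h).trans (by omega)) hx
  · exact hE.symm.exists_run (by omega) ((hR h).trans (by omega)) hx
  · have e1 := hR g
    have e2 := hR h
    exact hE.sameOrder (by omega) (by omega) (by omega) (by omega) hx hy hx' hy'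
  · -- For reasons of parity, the weights of the two runs cannot both be `m + 1`.
    have hle : ∀ (e : Dir) (h : List (Step A)), wt e h ≤ m →
        wtR d h ≤ blocks (e :: (h.map Step.dir ++ [d])) ∧
        blocks (e :: (h.map Step.dir ++ [d])) ≤ m + 1 := fun e h hm => by
      refine ⟨blocks_le_blocks_cons .., ?_⟩
      have h1 := blocks_cons_le d (e :: h.map Step.dir).reverse
      rw [← List.cons_append, ← blocks_reverse]
      rw [blocks_reverse] at h1
      simp only [wt] at hm
      simp only [List.reverse_append, List.reverse_cons, List.reverse_nil, List.nil_append,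
        List.cons_append] at h1 ⊢
      omega
    have e1 := hle .X g h3
    have e2 := hle .Y h h4
    have p1 := blocks_mod_two .X d (g.map Step.dir)
    have p2 := blocks_mod_two .Y d (h.map Step.dir)
    refine hE.sameOrder (by omega) (by omega) (by omega) ?_ hx hy hx' hy'
    cases d <;> simp at p1 p2 <;> omega

theorem blocks_map_dir_flip (h : List (Step A)) :
    blocks ((h.map Step.flip).map Step.dir) = blocks (h.map Step.dir) := by
  rw [map_dir_map_flip, blocks_map_of_injective _ Dir.flip_injective]

theorem run_flip' {S : Seg A} {h : List (Step A)} {x : ℤ} :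
    S.flip.Run h x ↔ S.Run (h.map Step.flip) (-x) := by
  rw [← run_flip, map_flip_map_flip]

theorem Similar.flip {m n : ℕ} {S T : Seg A} (h : Similar m n S T) :
    Similar m n S.flip T.flip where
  run g h1 h2 x hx := by
    obtain ⟨y, hy⟩ := h.run (g.map Step.flip) (by simpa using h1) (by rwa [blocks_map_dir_flip]) _
      (run_flip'.1 hx)
    exact ⟨-y, run_flip'.2 (by rwa [neg_neg])⟩
  run' g h1 h2 x hx := by
    obtain ⟨y, hy⟩ := h.run' (g.map Step.flip) (by simpa using h1) (by rwa [blocks_map_dir_flip]) _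
      (run_flip'.1 hx)
    exact ⟨-y, run_flip'.2 (by rwa [neg_neg])⟩
  order g k h1 h2 h3 h4 x y x' y' h5 h6 h7 h8 := by
    have := h.order (g.map Step.flip) (k.map Step.flip) (by simpa using h1) (by simpa using h2)
      (by rwa [blocks_map_dir_flip]) (by rwa [blocks_map_dir_flip]) _ _ _ _
      (run_flip'.1 h5) (run_flip'.1 h6) (run_flip'.1 h7) (run_flip'.1 h8)
    simp only [SameOrder, neg_lt_neg_iff] at this
    exact this.symm
  order' g k h1 h2 h3 h4 x y x' y' h5 h6 h7 h8 := by
    have := h.order' (k.map Step.flip) (g.map Step.flip) (by simpa using h2) (by simpa using h1)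
      (by rw [← wt_map_flip] at h4; exact h4) (by rw [← wt_map_flip] at h3; exact h3) _ _ _ _
      (run_flip'.1 h6) (run_flip'.1 h5) (run_flip'.1 h8) (run_flip'.1 h7)
    simp only [SameOrder, neg_lt_neg_iff] at this
    exact this

/-- The position `x` of `S` may be answered by the position `y` of `T` when at most `k` blocks of
quantifiers, the first of which is existential over `S`, and depth at most `n` remain to be played:
the order of `x` and of the end points of runs in `S` is inherited by `y` and `T`. -/
structure PebbleLE (k n : ℕ) (S T : Seg A) (x y : ℤ) : Prop where
  letter : S.word x = T.word y
  lt : ∀ h : List (Step A), h.length ≤ n → wt .X h ≤ k → ∀ p q, S.Run h p → T.Run h q →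
    p < x → q < y
  gt : ∀ h : List (Step A), h.length ≤ n → wt .Y h ≤ k → ∀ p q, S.Run h p → T.Run h q →
    x < p → y < q
  eq : ∀ h : List (Step A), h.length ≤ n → blocks (h.map Step.dir) < k → ∀ p q, S.Run h p →
    T.Run h q → p = x → q = y

theorem PebbleLE.flip {k n : ℕ} {S T : Seg A} {x y : ℤ} (h : PebbleLE k n S T x y) :
    PebbleLE k n S.flip T.flip (-x) (-y) where
  letter := by simpa using h.letter
  lt g h1 h2 p q h3 h4 h5 := by
    have := h.gt (g.map Step.flip) (by simpa using h1) (by rw [← wt_map_flip] at h2; exact h2)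
      (-p) (-q) (run_flip'.1 h3) (run_flip'.1 h4) (by omega)
    omega
  gt g h1 h2 p q h3 h4 h5 := by
    have := h.lt (g.map Step.flip) (by simpa using h1) (by rw [← wt_map_flip] at h2; exact h2)
      (-p) (-q) (run_flip'.1 h3) (run_flip'.1 h4) (by omega)
    omega
  eq g h1 h2 p q h3 h4 h5 := by
    have := h.eq (g.map Step.flip) (by simpa using h1) (by rwa [blocks_map_dir_flip])
      (-p) (-q) (run_flip'.1 h3) (run_flip'.1 h4) (by omega)
    omega

theorem wt_le_blocks_succ (d : Dir) (h : List (Step A)) :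
    wt d h ≤ blocks (h.map Step.dir) + 1 := blocks_cons_le ..

theorem blocks_le_wt (d : Dir) (h : List (Step A)) :
    blocks (h.map Step.dir) ≤ wt d h := blocks_le_blocks_cons ..

/-- For the runs with fewer than `k` blocks, a `PebbleLE k` compares in both directions. -/
theorem PebbleLE.sameOrder {k n : ℕ} {S T : Seg A} {x y : ℤ} (hP : PebbleLE k n S T x y)
    {h : List (Step A)} (h1 : h.length ≤ n) (h2 : blocks (h.map Step.dir) < k) {p q : ℤ}
    (hp : S.Run h p) (hq : T.Run h q) : SameOrder x p y q := by
  have a1 := hP.lt h h1 (by have := wt_le_blocks_succ .X h; omega) p q hp hq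
  have a2 := hP.gt h h1 (by have := wt_le_blocks_succ .Y h; omega) p q hp hq
  have a3 := hP.eq h h1 h2 p q hp hq
  constructor <;> omega

/-- When the first block of quantifiers is finished, the roles of the two sides are exchanged. -/
theorem PebbleLE.symm {k n : ℕ} {S T : Seg A} {x y : ℤ} (hP : PebbleLE (k + 1) n S T x y) :
    PebbleLE k n T S y x where
  letter := hP.letter.symm
  lt h h1 h2 p q hp hq := by
    have := hP.sameOrder h1 (by have := blocks_le_wt .X h; omega) hq hp
    exact this.2.2
  gt h h1 h2 p q hp hq := by
    have := hP.sameOrder h1 (by have := blocks_le_wt .Y h; omega) hq hp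
    exact this.1.2
  eq h h1 h2 p q hp hq := by
    have := hP.sameOrder h1 (by omega) hq hp
    obtain ⟨h3, h4⟩ := this
    omega

/-- The answer to a new position that is not marked by a run with fewer than `k` blocks, and is to
the right of the other pebble. -/
theorem PebbleLE.step_right {m k n N : ℕ} {S T : Seg A} {x y : ℤ} (hS : Similar m N S T)
    (hN : n + 1 ≤ N) (hk : 1 ≤ k) (hkm : k ≤ m) (hP : PebbleLE k (n + 1) S T x y) {x' : ℤ} {b : A}
    (hb : S.word x' = some b) (hx1 : S.lo < x') (hx2 : x' < S.hi)
    (hno : ∀ h : List (Step A), h.length ≤ n → blocks (h.map Step.dir) < k → ¬ S.Run h x')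
    (hxx : x < x') : ∃ y', T.lo < y' ∧ y' < T.hi ∧ PebbleLE k n S T x' y' ∧ y < y' := by
  -- `f` is the leftmost among the positions of `T` that have to stay to the right of the answer.
  obtain ⟨f, hf, hmin⟩ := Int.exists_least_of_bdd
    (P := fun f => f = T.hi ∨ ∃ h : List (Step A), h.length ≤ n ∧ wt .Y h ≤ k ∧
      ∃ p, S.Run h p ∧ x' < p ∧ T.Run h f)
    ⟨min T.lo T.hi, fun f hf => by
      rcases hf with rfl | ⟨h, -, -, p, -, -, hf⟩
      · exact min_le_right _ _
      · exact (min_le_left _ _).trans hf.mem.1.le⟩ ⟨T.hi, Or.inl rfl⟩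
  -- The answer is the last `b` before `f`; it is reached by the run `R`.
  obtain ⟨R, g, y', hR1, hR2, hg, hxg, hy, hyf, hyb⟩ : ∃ (R : List (Step A)) (g y' : ℤ),
      R.length ≤ n + 1 ∧ wt .Y R ≤ k ∧ S.Run R g ∧ x' ≤ g ∧ T.Run R y' ∧ y' < f ∧
      T.word y' = some b := by
    rcases hf with rfl | ⟨h, h1, h2, p, hp, hxp, hf⟩
    · obtain ⟨g, hxg, hg⟩ := S.exists_go_Y hx2 hb
      have hg' : S.Run [⟨.Y, b⟩] g := ⟨by omega, hg.1, hg⟩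
      obtain ⟨y', hy'⟩ := hS.run [⟨.Y, b⟩] (by simp; omega) (by simp; omega) g hg'
      exact ⟨_, g, y', by simp, by simpa [wt] using hk, hg', hxg, hy', hy'.2.1, hy'.letter⟩
    · obtain ⟨g, hxg, hg⟩ := S.exists_go_Y hxp hb
      have hpm := hp.mem
      have hg' : S.Run (⟨.Y, b⟩ :: h) g := by
        rw [run_cons hp.ne_nil]
        have := hg.1
        exact ⟨by omega, by omega, p, hp, hg⟩
      obtain ⟨y', hy'⟩ := hS.run (⟨.Y, b⟩ :: h) (by simp; omega)
        (by simp only [wt] at h2; simp; omega) g hg'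
      refine ⟨_, g, y', by simp; omega, by simpa [wt] using h2, hg', hxg, hy', ?_, hy'.letter⟩
      rw [run_cons hp.ne_nil] at hy'
      obtain ⟨-, -, f', hf', hgo⟩ := hy'
      rw [hf'.unique hf] at hgo
      exact hgo.1
  refine ⟨y', hy.mem.1, hy.mem.2, ⟨by rw [hb, hyb], fun h h1 h2 p q hp hq hlt => ?_,
    fun h h1 h2 p q hp hq hlt => ?_, fun h h1 h2 p q hp hq he => ?_⟩,
    hP.gt R hR1 hR2 g y' hg hy (by omega)⟩
  · exact (hS.order' h R (by omega) (by omega) (by omega) (by omega) _ _ _ _ hp hg hq hy).1.1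
      (by omega)
  · have := hmin q (Or.inr ⟨h, h1, h2, p, hp, hlt, hq⟩)
    omega
  · rw [he] at hp
    exact absurd hp (hno h h1 h2)

/-- Every new position in `S` can be answered in `T`. -/
theorem PebbleLE.step {m k n N : ℕ} {S T : Seg A} {x y : ℤ} (hS : Similar m N S T)
    (hN : n + 1 ≤ N) (hk : 1 ≤ k) (hkm : k ≤ m) (hP : PebbleLE k (n + 1) S T x y)
    (hxy : S.lo < x → x < S.hi → T.lo < y ∧ y < T.hi) {x' : ℤ} {b : A}
    (hb : S.word x' = some b) (hx1 : S.lo < x') (hx2 : x' < S.hi) :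
    ∃ y', T.lo < y' ∧ y' < T.hi ∧ PebbleLE k n S T x' y' ∧ SameOrder x x' y y' := by
  by_cases hex : ∃ h : List (Step A), h.length ≤ n ∧ blocks (h.map Step.dir) < k ∧ S.Run h x'
  · obtain ⟨h, h1, h2, hx'⟩ := hex
    obtain ⟨y', hy'⟩ := hS.run h (by omega) (by omega) x' hx'
    refine ⟨y', hy'.mem.1, hy'.mem.2, ⟨?_, fun g h3 h4 p q hp hq => ?_, fun g h3 h4 p q hp hq => ?_,
      fun g h3 h4 p q hp hq => ?_⟩, hP.sameOrder (by omega) h2 hx' hy'⟩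
    · rcases h with - | ⟨z, h⟩
      · exact hx'.elim
      · rw [hx'.letter, hy'.letter]
    · exact (hS.order h g (by omega) (by omega) (by omega)
        (by have := blocks_le_wt .X g; omega) _ _ _ _ hx' hp hy' hq).2.1
    · exact (hS.order h g (by omega) (by omega) (by omega)
        (by have := blocks_le_wt .Y g; omega) _ _ _ _ hx' hp hy' hq).1.1
    · obtain ⟨h5, h6⟩ := hS.order h g (by omega) (by omega) (by omega) (by omega) _ _ _ _
        hx' hp hy' hq
      omega
  · push Not at hex
    rcases lt_trichotomy x x' with hlt | rfl | hlt
    · obtain ⟨y', h1, h2, h3, h4⟩ := hP.step_right hS hN hk hkm hb hx1 hx2 hex hlt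
      exact ⟨y', h1, h2, h3, by constructor <;> omega⟩
    · obtain ⟨h1, h2⟩ := hxy hx1 hx2
      exact ⟨y, h1, h2, ⟨hP.letter, fun h h1 => hP.lt h (by omega), fun h h1 => hP.gt h (by omega),
        fun h h1 => hP.eq h (by omega)⟩, by constructor <;> omega⟩
    · obtain ⟨y', h1, h2, h3, h4⟩ := hP.flip.step_right (x' := -x') hS.flip hN hk hkm
        (by simpa using hb) (by simp; omega) (by simp; omega) (fun h h1 h2 h3 => by
          rw [run_flip', neg_neg] at h3
          exact hex _ (by simpa using h1) (by rwa [blocks_map_dir_flip]) h3) (by omega)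
      have h5 := h3.flip
      simp only [Seg.flip_flip, neg_neg] at h5
      simp only [flip_lo, flip_hi] at h1 h2
      exact ⟨-y', by omega, by omega, h5, by constructor <;> omega⟩

/-! ### Formulas and the game -/

namespace Formula

/-- The quantifier depth. -/
def depth : Formula A → ℕ
  | and φ ψ => max φ.depth ψ.depth
  | or φ ψ => max φ.depth ψ.depth
  | quant _ _ φ => φ.depth + 1
  | _ => 0

/-- Inside a block of quantifiers `q`, at most `k` blocks occur on every path of `φ`, including the
current one. -/
def Fits (q : Quant) (k : ℕ) (φ : Formula A) : Prop := ∀ l ∈ φ.labels, blocks (q :: l) ≤ k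

theorem labels_ne_nil (φ : Formula A) : φ.labels ≠ [] := by
  induction φ with
  | and φ ψ h1 h2 => simp [labels, h1]
  | or φ ψ h1 h2 => simp [labels, h1]
  | quant q x φ h => simpa [labels] using h
  | _ => simp [labels]

theorem Fits.one_le {q : Quant} {k : ℕ} {φ : Formula A} (h : φ.Fits q k) : 1 ≤ k := by
  obtain ⟨l, hl⟩ := List.exists_mem_of_ne_nil _ φ.labels_ne_nil
  exact (blocks_cons_pos q l).trans (h l hl)

theorem fits_and {q : Quant} {k : ℕ} {φ ψ : Formula A} :
    (Formula.and φ ψ).Fits q k ↔ φ.Fits q k ∧ ψ.Fits q k := by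
  simp [Fits, labels, or_imp, forall_and]

theorem fits_or {q : Quant} {k : ℕ} {φ ψ : Formula A} :
    (Formula.or φ ψ).Fits q k ↔ φ.Fits q k ∧ ψ.Fits q k := by
  simp [Fits, labels, or_imp, forall_and]

theorem fits_quant_self {q : Quant} {k : ℕ} {x : Fin 2} {φ : Formula A} :
    (quant q x φ).Fits q k ↔ φ.Fits q k := by
  simp [Fits, labels]

theorem Fits.of_quant_ne {q q' : Quant} {k : ℕ} {x : Fin 2} {φ : Formula A} (hq : q ≠ q')
    (h : (quant q' x φ).Fits q k) : ∃ k', k = k' + 1 ∧ φ.Fits q' k' := by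
  refine ⟨k - 1, by have := h.one_le; omega, fun l hl => ?_⟩
  have := h (q' :: l) (by simpa [labels] using hl)
  rw [blocks_cons_cons, if_neg hq] at this
  omega

end Formula

/-- The two boards of the game: words `v` and `w`, and segments of them to which the comparison by
runs applies. The prefixes before the segments coincide, and so do the suffixes after them. -/
structure Board (m n : ℕ) (v w : List A) (S T : Seg A) : Prop where
  similar : Similar m n S T
  word_fst : S.word = letterFn v
  word_snd : T.word = letterFn w
  lo_eq : S.lo = T.lo
  lo_nonneg : 0 ≤ S.lo
  lt_fst : S.lo < S.hi
  lt_snd : T.lo < T.hi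
  hi_eq : v.length - S.hi = w.length - T.hi
  hi_le : S.hi ≤ v.length + 1
  before : ∀ x, x ≤ S.lo → letterFn v x = letterFn w x
  after : ∀ x, S.hi ≤ x → letterFn v x = letterFn w (x + (T.hi - S.hi))

theorem Board.symm {m n : ℕ} {v w : List A} {S T : Seg A} (B : Board m n v w S T) :
    Board m n w v T S where
  similar := B.similar.symm
  word_fst := B.word_snd
  word_snd := B.word_fst
  lo_eq := B.lo_eq.symm
  lo_nonneg := B.lo_eq ▸ B.lo_nonneg
  lt_fst := B.lt_snd
  lt_snd := B.lt_fst
  hi_eq := B.hi_eq.symm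
  hi_le := by have := B.hi_eq; have := B.hi_le; omega
  before x hx := (B.before x (B.lo_eq ▸ hx)).symm
  after x hx := by
    rw [B.after _ (by omega)]
    congr 1
    omega

/-- Positions outside of the segments are answered by the same positions of the common prefix or
suffix. -/
def Placed (S T : Seg A) (x y : ℤ) : Prop :=
  (S.lo < x ∧ x < S.hi ∧ T.lo < y ∧ y < T.hi) ∨ (x ≤ S.lo ∧ y = x) ∨
    (S.hi ≤ x ∧ y = x + (T.hi - S.hi))

/-- The positions of the game in which the existential player may win: the pebbles `ν` on `S` and
`μ` on `T` correspond to each other. -/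
structure Position (k n : ℕ) (S T : Seg A) (ν μ : Fin 2 → ℕ) : Prop where
  pebble : ∀ i, PebbleLE k n S T (ν i) (μ i)
  placed : ∀ i, Placed S T (ν i) (μ i)
  order : ∀ i j, SameOrder (ν i) (ν j) (μ i) (μ j)

/-- At a change of quantifiers the sides are exchanged, at the expense of one block. -/
theorem Position.symm {m N k n : ℕ} {v w : List A} {S T : Seg A} (B : Board m N v w S T)
    {ν μ : Fin 2 → ℕ} (P : Position (k + 1) n S T ν μ) : Position k n T S μ ν where
  pebble i := (P.pebble i).symm
  placed i := by
    have := B.lo_eq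
    rcases P.placed i with h | h | h
    · exact Or.inl ⟨h.2.2.1, h.2.2.2, h.1, h.2.1⟩
    · exact Or.inr (Or.inl ⟨by omega, by omega⟩)
    · exact Or.inr (Or.inr ⟨by omega, by omega⟩)
  order i j := (P.order i j).swap

/-- Outside of the segments, no run matters. -/
theorem PebbleLE.of_outside {k n : ℕ} {S T : Seg A} {x y : ℤ} (h : S.word x = T.word y)
    (hxy : (x ≤ S.lo ∧ y ≤ T.lo) ∨ (S.hi ≤ x ∧ T.hi ≤ y)) : PebbleLE k n S T x y where
  letter := h
  lt g _ _ p q hp hq hlt := by have := hp.mem; have := hq.mem; omega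
  gt g _ _ p q hp hq hlt := by have := hp.mem; have := hq.mem; omega
  eq g _ _ p q hp hq hlt := by have := hp.mem; have := hq.mem; omega

theorem PebbleLE.mono {k n : ℕ} {S T : Seg A} {x y : ℤ} (h : PebbleLE k (n + 1) S T x y) :
    PebbleLE k n S T x y where
  letter := h.letter
  lt g h1 := h.lt g (by omega)
  gt g h1 := h.gt g (by omega)
  eq g h1 := h.eq g (by omega)

/-- Every move of one of the pebbles on `v` can be answered on `w`. -/
theorem Position.move {m N k n : ℕ} {v w : List A} {S T : Seg A} (B : Board m N v w S T)
    (hn : n + 1 ≤ N) (hk : 1 ≤ k) (hkm : k ≤ m) {ν μ : Fin 2 → ℕ}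
    (P : Position k (n + 1) S T ν μ) (c : Fin 2) {i : ℕ} (h1 : 1 ≤ i) (h2 : i ≤ v.length) :
    ∃ j, 1 ≤ j ∧ j ≤ w.length ∧
      Position k n S T (Function.update ν c i) (Function.update μ c j) := by
  obtain ⟨e, hec, hcases⟩ : ∃ e : Fin 2, e ≠ c ∧ ∀ i, i = c ∨ i = e := by
    fin_cases c
    · exact ⟨1, by decide, by decide⟩
    · exact ⟨0, by decide, by decide⟩
  have hlo := B.lo_eq
  have hlo0 := B.lo_nonneg
  have hhi := B.hi_eq
  have hhi' := B.hi_le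
  have hls := B.lt_fst
  have hlt := B.lt_snd
  obtain ⟨y, hy1, hy2, hpeb, hpl, hord⟩ : ∃ y : ℤ, 1 ≤ y ∧ y ≤ w.length ∧
      PebbleLE k n S T i y ∧ Placed S T i y ∧ SameOrder (ν e) i (μ e) y := by
    by_cases hin : S.lo < i ∧ (i : ℤ) < S.hi
    · obtain ⟨b, hb⟩ := Option.ne_none_iff_exists'.1
        (letterFn_ne_none.2 ⟨by omega, by omega⟩ : letterFn v (i : ℤ) ≠ none)
      obtain ⟨y, h3, h4, h5, h6⟩ := (P.pebble e).step B.similar hn hk hkm (fun h3 h4 => by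
        rcases P.placed e with h | h | h <;> omega) (by rw [B.word_fst]; exact hb) hin.1 hin.2
      exact ⟨y, by omega, by omega, h5, Or.inl ⟨hin.1, hin.2, h3, h4⟩, h6⟩
    · rcases le_or_gt (i : ℤ) S.lo with h3 | h3
      · refine ⟨i, by omega, by omega, .of_outside ?_ (Or.inl ⟨h3, by omega⟩),
          Or.inr (Or.inl ⟨h3, rfl⟩), ?_⟩
        · rw [B.word_fst, B.word_snd, B.before _ h3]
        · rcases P.placed e with h | h | h <;> constructor <;> omega
      · have h4 : S.hi ≤ i := by omega
        refine ⟨i + (T.hi - S.hi), by omega, by omega,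
          .of_outside ?_ (Or.inr ⟨h4, by omega⟩), Or.inr (Or.inr ⟨h4, rfl⟩), ?_⟩
        · rw [B.word_fst, B.word_snd, B.after _ h4]
        · rcases P.placed e with h | h | h <;> constructor <;> omega
  obtain ⟨j, rfl⟩ := Int.eq_ofNat_of_zero_le (a := y) (by omega)
  refine ⟨j, by omega, by omega, ⟨fun i => ?_, fun i => ?_, fun i i' => ?_⟩⟩
  · rcases hcases i with rfl | rfl
    · simpa using hpeb
    · simpa [hec] using (P.pebble _).mono
  · rcases hcases i with rfl | rfl
    · simpa using hpl
    · simpa [hec] using P.placed _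
  · rcases hcases i with rfl | rfl <;> rcases hcases i' with rfl | rfl
    · simp [SameOrder]
    · simpa [hec, SameOrder] using hord.symm
    · simpa [hec] using hord
    · simp [SameOrder]

/-- The two directions of the game: if `φ` continues an existential block of quantifiers, its truth
transfers from `v` to `w`; if it continues a universal block, its truth transfers back. -/
theorem Position.sat {m N : ℕ} (φ : Formula A) {v w : List A} {S T : Seg A}
    (B : Board m N v w S T) {k n : ℕ} (hn : n ≤ N) (hd : φ.depth ≤ n) (hkm : k ≤ m)
    {ν μ : Fin 2 → ℕ} (P : Position k n S T ν μ) :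
    (φ.Fits .ex k → φ.Sat v ν → φ.Sat w μ) ∧ (φ.Fits .all k → φ.Sat w μ → φ.Sat v ν) := by
  have hletter : ∀ a x, LetterAt v (ν x) a ↔ LetterAt w (μ x) a := fun a x => by
    rw [letterAt_iff, letterAt_iff, ← B.word_fst, ← B.word_snd, (P.pebble x).letter]
  have hlt : ∀ x y, ν x < ν y ↔ μ x < μ y := fun x y => by simpa using (P.order x y).1
  have heq : ∀ x y, ν x = ν y ↔ μ x = μ y := fun x y => by
    have h1 := hlt x y; have h2 := hlt y x; omega
  induction φ generalizing v w S T k n ν μ with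
  | letter a x => simp [Formula.Sat, hletter]
  | notLetter a x => simp [Formula.Sat, hletter]
  | lt x y => simp [Formula.Sat, hlt]
  | notLt x y => simp only [Formula.Sat, hlt]; tauto
  | eq x y => simp [Formula.Sat, heq]
  | notEq x y => simp [Formula.Sat, heq]
  | and φ ψ ih1 ih2 =>
    simp only [Formula.depth, max_le_iff] at hd
    have h1 := ih1 B hn hd.1 hkm P hletter hlt heq
    have h2 := ih2 B hn hd.2 hkm P hletter hlt heq
    simp only [Formula.fits_and, Formula.Sat]
    tauto
  | or φ ψ ih1 ih2 =>
    simp only [Formula.depth, max_le_iff] at hd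
    have h1 := ih1 B hn hd.1 hkm P hletter hlt heq
    have h2 := ih2 B hn hd.2 hkm P hletter hlt heq
    simp only [Formula.fits_or, Formula.Sat]
    tauto
  | quant q c φ ih =>
    clear hletter hlt heq
    replace ih : ∀ {v w : List A} {S T : Seg A}, Board m N v w S T → ∀ {k n : ℕ}, n ≤ N →
        φ.depth ≤ n → k ≤ m → ∀ {ν μ : Fin 2 → ℕ}, Position k n S T ν μ →
        (φ.Fits .ex k → φ.Sat v ν → φ.Sat w μ) ∧ (φ.Fits .all k → φ.Sat w μ → φ.Sat v ν) := by
      intro v w S T B k n hn hd hkm ν μ P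
      refine ih B hn hd hkm P (fun a x => ?_) (fun x y => ?_) fun x y => ?_
      · rw [letterAt_iff, letterAt_iff, ← B.word_fst, ← B.word_snd, (P.pebble x).letter]
      · simpa using (P.order x y).1
      · obtain ⟨h1, h2⟩ := P.order x y
        omega
    simp only [Formula.depth] at hd
    obtain ⟨n, rfl⟩ : ∃ n', n = n' + 1 := ⟨n - 1, by omega⟩
    have hex : ∀ {v w : List A} {S T : Seg A}, Board m N v w S T → ∀ {k : ℕ}, k ≤ m →
        ∀ {ν μ : Fin 2 → ℕ}, Position k (n + 1) S T ν μ → φ.Fits .ex k →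
        (Formula.quant .ex c φ).Sat v ν → (Formula.quant .ex c φ).Sat w μ := by
      rintro v w S T B k hkm ν μ P hf ⟨i, h1, h2, h3⟩
      obtain ⟨j, h4, h5, P'⟩ := P.move B hn hf.one_le hkm c h1 h2
      exact ⟨j, h4, h5, (ih B (by omega) (by omega) hkm P').1 hf h3⟩
    have hall : ∀ {v w : List A} {S T : Seg A}, Board m N v w S T → ∀ {k : ℕ}, k ≤ m →
        ∀ {ν μ : Fin 2 → ℕ}, Position k (n + 1) S T ν μ → φ.Fits .all k →
        (Formula.quant .all c φ).Sat w μ → (Formula.quant .all c φ).Sat v ν := by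
      intro v w S T B k hkm ν μ P hf hs i h1 h2
      obtain ⟨j, h4, h5, P'⟩ := P.move B hn hf.one_le hkm c h1 h2
      exact (ih B (by omega) (by omega) hkm P').2 hf (hs j h4 h5)
    cases q with
    | ex =>
      refine ⟨fun hf => hex B hkm P (Formula.fits_quant_self.1 hf), fun hf => ?_⟩
      obtain ⟨k', rfl, hf'⟩ := hf.of_quant_ne (by decide)
      exact hex B.symm (by omega) (P.symm B) hf'
    | all =>
      refine ⟨fun hf => ?_, fun hf => hall B hkm P (Formula.fits_quant_self.1 hf)⟩
      obtain ⟨k', rfl, hf'⟩ := hf.of_quant_ne (by decide)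
      exact hall B.symm (by omega) (P.symm B) hf'

/-- Formulas with at most `m` blocks do not distinguish positions that are related in both
directions. -/
theorem Position.sat_iff {m N : ℕ} (φ : Formula A) {v w : List A} {S T : Seg A}
    (B : Board m N v w S T) (hd : φ.depth ≤ N) (hm : 1 ≤ m) (hφ : ∀ l ∈ φ.labels, blocks l ≤ m)
    {ν μ : Fin 2 → ℕ} (P : Position m N S T ν μ) (P' : Position m N T S μ ν) :
    φ.Sat v ν ↔ φ.Sat w μ := by
  have fits : ∀ φ : Formula A, φ.depth ≤ N → φ.Fits .ex m → (φ.Sat v ν ↔ φ.Sat w μ) :=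
    fun φ hd hf =>
      ⟨(P.sat φ B le_rfl hd le_rfl).1 hf, (P'.sat φ B.symm le_rfl hd le_rfl).1 hf⟩
  induction φ with
  | and φ ψ ih1 ih2 =>
    simp only [Formula.depth, max_le_iff] at hd
    simp only [Formula.labels, List.mem_append, or_imp, forall_and] at hφ
    simp only [Formula.Sat, ih1 hd.1 hφ.1, ih2 hd.2 hφ.2]
  | or φ ψ ih1 ih2 =>
    simp only [Formula.depth, max_le_iff] at hd
    simp only [Formula.labels, List.mem_append, or_imp, forall_and] at hφ
    simp only [Formula.Sat, ih1 hd.1 hφ.1, ih2 hd.2 hφ.2]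
  | quant q c φ ih =>
    have hf : (Formula.quant q c φ).Fits q m := by
      rw [Formula.fits_quant_self]
      intro l hl
      exact hφ _ (by simpa [Formula.labels] using hl)
    cases q with
    | ex => exact fits _ hd hf
    | all => exact ⟨(P'.sat _ B.symm le_rfl hd le_rfl).2 hf, (P.sat _ B le_rfl hd le_rfl).2 hf⟩
  | _ => exact fits _ hd (by simpa [Formula.Fits, Formula.labels] using hm)

/-- A definable language with `m` blocks does not distinguish words that agree on sufficiently many
condensed rankers with `m + 1` blocks, in any context. -/
theorem FO2Definable.exists_condEquiv {m : ℕ} (hm : 1 ≤ m) {L : Language A}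
    (hL : FO2Definable m L) (d : Dir) : ∃ N, m + 1 ≤ N ∧ ∀ u v : List A,
      CondEquiv d (m + 1) N u v → ∀ x y : List A, x ++ u ++ y ∈ L ↔ x ++ v ++ y ∈ L := by
  obtain ⟨φ, -, hφ, hs⟩ := hL
  -- The summand `m` only serves to make the depth at least `m + 1`.
  refine ⟨2 * (φ.depth + m) + 1, by omega, fun u v huv x y => ?_⟩
  have B : Board m (φ.depth + m) (x ++ u ++ y) (x ++ v ++ y) (factor x u y) (factor x v y) :=
    { similar := (huv.equiv.factor x y).similar
      word_fst := rfl
      word_snd := rfl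
      lo_eq := rfl
      lo_nonneg := by simp [factor]
      lt_fst := by simp only [factor]; omega
      lt_snd := by simp only [factor]; omega
      hi_eq := by simp only [factor, List.length_append]; push_cast; omega
      hi_le := by simp only [factor, List.length_append]; push_cast; omega
      before := fun t ht => by
        simp only [factor] at ht
        rw [List.append_assoc, List.append_assoc, letterFn_append_left _ _ _ ht,
          letterFn_append_left _ _ _ ht]
      after := fun t ht => by
        simp only [factor] at ht ⊢
        rw [letterFn_append_right _ _ _ (by simp; omega),
          letterFn_append_right _ _ _ (by simp; omega)]
        congr 1
        simp
        omega }
  -- Pebbles that have not been placed yet are thought of as lying on the position `0`, which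
  -- carries no letter and is outside of the segments.
  have hP : ∀ S T : Seg A, S.word 0 = T.word 0 → 0 ≤ S.lo → 0 ≤ T.lo →
      Position m (φ.depth + m) S T (fun _ => 0) (fun _ => 0) := fun S T h1 h2 h3 =>
    ⟨fun _ => .of_outside (by simpa using h1) (Or.inl ⟨by simpa, by simpa⟩),
      fun _ => Or.inr (Or.inl ⟨by simpa, rfl⟩), fun _ _ => by simp [SameOrder]⟩
  rw [hs _ (fun _ => 0), hs _ (fun _ => 0)]
  exact Position.sat_iff φ B (by omega) hm hφ (hP _ _ rfl (by simp [factor]) (by simp [factor]))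
    (hP _ _ rfl (by simp [factor]) (by simp [factor]))

end FO2Alt

namespace FO2Alt

universe v

variable {A : Type u} {B : Type v} {K : Type}

/-! ### Boolean operations on definable languages -/

/-- The dual quantifier. -/
def Quant.dual : Quant → Quant
  | .ex => .all
  | .all => .ex

theorem Quant.dual_injective : Function.Injective Quant.dual := by
  intro a b h
  cases a <;> cases b <;> first | rfl | cases h

namespace Formula

/-- The negation of a formula, pushed to the atomic formulas. -/
def neg : Formula A → Formula A
  | letter a x => notLetter a x
  | notLetter a x => letter a x
  | lt x y => notLt x y
  | notLt x y => lt x y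
  | eq x y => notEq x y
  | notEq x y => eq x y
  | and φ ψ => or φ.neg ψ.neg
  | or φ ψ => and φ.neg ψ.neg
  | quant q x φ => quant q.dual x φ.neg

theorem sat_neg (w : List A) (φ : Formula A) (ν : Fin 2 → ℕ) : φ.neg.Sat w ν ↔ ¬ φ.Sat w ν := by
  induction φ generalizing ν with
  | quant q x φ ih => cases q <;> simp [neg, Quant.dual, Sat, ih]
  | and φ ψ h1 h2 => simp only [neg, Sat, h1, h2]; tauto
  | or φ ψ h1 h2 => simp only [neg, Sat, h1, h2]; tauto
  | _ => simp [neg, Sat]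

theorem free_neg (φ : Formula A) : φ.neg.free = φ.free := by
  induction φ <;> simp_all [neg, free]

theorem labels_neg (φ : Formula A) : φ.neg.labels = φ.labels.map (List.map Quant.dual) := by
  induction φ <;> simp_all [neg, labels, Function.comp_def]

theorem blocks_le_of_mem_labels_neg {φ : Formula A} {k : ℕ} {q : Quant}
    (h : ∀ l ∈ φ.labels, blocks (q :: l) ≤ k) :
    ∀ l ∈ φ.neg.labels, blocks (q.dual :: l) ≤ k := by
  intro l hl
  rw [labels_neg, List.mem_map] at hl
  obtain ⟨l', hl', rfl⟩ := hl
  rw [← List.map_cons, blocks_map_of_injective _ Quant.dual_injective]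
  exact h l' hl'

/-- A finite disjunction. The variable `x` is used to express the empty one. -/
def bigOr (x : Fin 2) : List (Formula A) → Formula A
  | [] => lt x x
  | φ :: l => or φ (bigOr x l)

/-- A finite conjunction. -/
def bigAnd (x : Fin 2) : List (Formula A) → Formula A
  | [] => notLt x x
  | φ :: l => and φ (bigAnd x l)

theorem sat_bigOr {w : List A} {x : Fin 2} {l : List (Formula A)} {ν : Fin 2 → ℕ} :
    (bigOr x l).Sat w ν ↔ ∃ φ ∈ l, φ.Sat w ν := by
  induction l <;> simp_all [bigOr, Sat]

theorem sat_bigAnd {w : List A} {x : Fin 2} {l : List (Formula A)} {ν : Fin 2 → ℕ} :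
    (bigAnd x l).Sat w ν ↔ ∀ φ ∈ l, φ.Sat w ν := by
  induction l <;> simp_all [bigAnd, Sat]

theorem mem_free_bigOr {x y : Fin 2} {l : List (Formula A)} (h : y ∈ (bigOr x l).free) :
    y = x ∨ ∃ φ ∈ l, y ∈ φ.free := by
  induction l <;> simp_all [bigOr, free]
  tauto

theorem mem_free_bigAnd {x y : Fin 2} {l : List (Formula A)} (h : y ∈ (bigAnd x l).free) :
    y = x ∨ ∃ φ ∈ l, y ∈ φ.free := by
  induction l <;> simp_all [bigAnd, free]
  tauto

theorem mem_labels_bigOr {x : Fin 2} {l : List (Formula A)} {s : List Quant}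
    (h : s ∈ (bigOr x l).labels) : s = [] ∨ ∃ φ ∈ l, s ∈ φ.labels := by
  induction l <;> simp_all [bigOr, labels]
  tauto

theorem mem_labels_bigAnd {x : Fin 2} {l : List (Formula A)} {s : List Quant}
    (h : s ∈ (bigAnd x l).labels) : s = [] ∨ ∃ φ ∈ l, s ∈ φ.labels := by
  induction l <;> simp_all [bigAnd, labels]
  tauto

end Formula

/-- `FO2Definable` for a property of words. -/
def Definable (m : ℕ) (p : List A → Prop) : Prop :=
  ∃ φ : Formula A, φ.free = ∅ ∧ (∀ l ∈ φ.labels, blocks l ≤ m) ∧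
    ∀ (w : List A) (ν : Fin 2 → ℕ), p w ↔ φ.Sat w ν

theorem Definable.congr {m : ℕ} {p q : List A → Prop} (hp : Definable m p)
    (h : ∀ w, q w ↔ p w) : Definable m q := by
  obtain rfl : q = p := funext fun w => propext (h w)
  exact hp

theorem Definable.mono {m n : ℕ} {p : List A → Prop} (hp : Definable m p) (h : m ≤ n) :
    Definable n p := by
  obtain ⟨φ, h1, h2, h3⟩ := hp
  exact ⟨φ, h1, fun l hl => (h2 l hl).trans h, h3⟩

theorem Definable.not {m : ℕ} {p : List A → Prop} (hp : Definable m p) :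
    Definable m fun w => ¬ p w := by
  obtain ⟨φ, h1, h2, h3⟩ := hp
  refine ⟨φ.neg, by rw [φ.free_neg, h1], fun l hl => ?_,
    fun w ν => (not_congr (h3 w ν)).trans (Formula.sat_neg w φ ν).symm⟩
  rw [φ.labels_neg, List.mem_map] at hl
  obtain ⟨l', hl', rfl⟩ := hl
  rw [blocks_map_of_injective _ Quant.dual_injective]
  exact h2 l' hl'

theorem Definable.and {m : ℕ} {p q : List A → Prop} (hp : Definable m p) (hq : Definable m q) :
    Definable m fun w => p w ∧ q w := by
  obtain ⟨φ, h1, h2, h3⟩ := hp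
  obtain ⟨ψ, h4, h5, h6⟩ := hq
  refine ⟨.and φ ψ, by simp [Formula.free, h1, h4], fun l hl => ?_,
    fun w ν => and_congr (h3 w ν) (h6 w ν)⟩
  rcases List.mem_append.1 hl with hl | hl
  · exact h2 l hl
  · exact h5 l hl

/-- The assumption `1 ≤ m` is needed since without quantifiers there are no sentences at all. -/
theorem definable_true {m : ℕ} (hm : 1 ≤ m) : Definable m fun _ : List A => True :=
  ⟨.quant .all 0 (.notLt 0 0), by simp [Formula.free], by simpa [Formula.labels] using hm,
    by simp [Formula.Sat]⟩

theorem Definable.const {m : ℕ} (hm : 1 ≤ m) (c : Prop) : Definable m fun _ : List A => c := by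
  by_cases hc : c
  · exact (definable_true hm).congr (by simp [hc])
  · exact (definable_true hm).not.congr (by simp [hc])

theorem Definable.forall {m : ℕ} (hm : 1 ≤ m) {ι : Type*} [Finite ι] {p : ι → List A → Prop}
    (hp : ∀ i, Definable m (p i)) : Definable m fun w => ∀ i, p i w := by
  have : Fintype ι := Fintype.ofFinite ι
  have key : ∀ s : List ι, Definable m fun w => ∀ i ∈ s, p i w := fun s => by
    induction s with
    | nil => exact (definable_true hm).congr (by simp)
    | cons i s ih => exact ((hp i).and ih).congr (by simp)
  exact (key Finset.univ.toList).congr (by simp)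

theorem Definable.exists {m : ℕ} (hm : 1 ≤ m) {ι : Type*} [Finite ι] {p : ι → List A → Prop}
    (hp : ∀ i, Definable m (p i)) : Definable m fun w => ∃ i, p i w :=
  (Definable.forall hm fun i => (hp i).not).not.congr (by simp)

/-- A property that depends only on the truth values of finitely many definable properties is
definable. -/
theorem Definable.of_finite_family {m : ℕ} (hm : 1 ≤ m) {ι : Type*} [Finite ι]
    {p : ι → List A → Prop} (hp : ∀ i, Definable m (p i)) {q : List A → Prop}
    (hq : ∀ v w, (∀ i, p i v ↔ p i w) → (q v ↔ q w)) : Definable m q := by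
  have h1 : Definable m fun w => ∃ f : ι → Prop, (∃ v, q v ∧ ∀ i, p i v ↔ f i) ∧
      ∀ i, (p i w ↔ f i) := by
    refine Definable.exists hm fun f => (Definable.const hm _).and (Definable.forall hm fun i => ?_)
    by_cases hf : f i
    · exact (hp i).congr (by simp [hf])
    · exact (hp i).not.congr (by simp [hf])
  refine h1.congr fun w => ⟨fun h => ⟨fun i => p i w, ⟨w, h, by simp⟩, by simp⟩, ?_⟩
  rintro ⟨f, ⟨v, h2, h3⟩, h4⟩
  exact (hq v w fun i => (h3 i).trans (h4 i).symm).1 h2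

/-! ### Interpretations -/

/-- The syntactic data of an interpretation of words over `B` in words over `A`: a position of the
interpreted word is represented by a position of the given word together with an index from the
list `indices`, and `guard` singles out the pairs that represent a position. -/
structure Interp (A : Type u) (B : Type v) (K : Type) where
  indices : List K
  letter : B → K → Fin 2 → Formula A
  lt : K → K → Fin 2 → Fin 2 → Formula A
  eq : K → K → Fin 2 → Fin 2 → Formula A
  guard : K → Fin 2 → Formula A

namespace Interp

/-- The translation of formulas over `B` to formulas over `A`, for variables with the indices
`κ`. -/
def trans (I : Interp A B K) : Formula B → (Fin 2 → K) → Formula A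
  | .letter b x, κ => I.letter b (κ x) x
  | .notLetter b x, κ => (I.letter b (κ x) x).neg
  | .lt x y, κ => I.lt (κ x) (κ y) x y
  | .notLt x y, κ => (I.lt (κ x) (κ y) x y).neg
  | .eq x y, κ => I.eq (κ x) (κ y) x y
  | .notEq x y, κ => (I.eq (κ x) (κ y) x y).neg
  | .and φ ψ, κ => .and (I.trans φ κ) (I.trans ψ κ)
  | .or φ ψ, κ => .or (I.trans φ κ) (I.trans ψ κ)
  | .quant .ex x φ, κ => .quant .ex x (.bigOr x
      (I.indices.map fun k => .and (I.guard k x) (I.trans φ (Function.update κ x k))))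
  | .quant .all x φ, κ => .quant .all x (.bigAnd x
      (I.indices.map fun k => .or (I.guard k x).neg (I.trans φ (Function.update κ x k))))

/-- The interpretation uses the variables as it should, its atomic formulas are free of quantifiers,
and its guards add at most `c` blocks below an existential quantifier. -/
structure Costs (I : Interp A B K) (c : ℕ) : Prop where
  free_letter : ∀ b k x, (I.letter b k x).free ⊆ {x}
  free_lt : ∀ k l x y, (I.lt k l x y).free ⊆ {x, y}
  free_eq : ∀ k l x y, (I.eq k l x y).free ⊆ {x, y}
  free_guard : ∀ k x, (I.guard k x).free ⊆ {x}
  labels_letter : ∀ b k x, ∀ l ∈ (I.letter b k x).labels, l = []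
  labels_lt : ∀ k k' x y, ∀ l ∈ (I.lt k k' x y).labels, l = []
  labels_eq : ∀ k k' x y, ∀ l ∈ (I.eq k k' x y).labels, l = []
  labels_guard : ∀ k x, ∀ l ∈ (I.guard k x).labels, blocks (Quant.ex :: l) ≤ 1 + c

theorem free_trans {I : Interp A B K} {c : ℕ} (h : I.Costs c) (φ : Formula B)
    (κ : Fin 2 → K) : (I.trans φ κ).free ⊆ φ.free := by
  induction φ generalizing κ with
  | letter b x => exact h.free_letter ..
  | notLetter b x => rw [trans, Formula.free_neg]; exact h.free_letter ..
  | lt x y => exact h.free_lt ..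
  | notLt x y => rw [trans, Formula.free_neg]; exact h.free_lt ..
  | eq x y => exact h.free_eq ..
  | notEq x y => rw [trans, Formula.free_neg]; exact h.free_eq ..
  | and φ ψ h1 h2 => exact Finset.union_subset_union (h1 κ) (h2 κ)
  | or φ ψ h1 h2 => exact Finset.union_subset_union (h1 κ) (h2 κ)
  | quant q x φ ih =>
    intro y hy
    have hx : ∀ k, y ∈ (I.guard k x).free → y = x := fun k hy => by
      simpa using h.free_guard k x hy
    cases q with
    | ex =>
      simp only [trans, Formula.free, Finset.mem_erase] at hy ⊢
      refine ⟨hy.1, ?_⟩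
      obtain h1 | ⟨ψ, h1, h2⟩ := Formula.mem_free_bigOr hy.2
      · exact absurd h1 hy.1
      · obtain ⟨k, -, rfl⟩ := List.mem_map.1 h1
        rcases Finset.mem_union.1 h2 with h2 | h2
        · exact absurd (hx k h2) hy.1
        · exact ih _ h2
    | all =>
      simp only [trans, Formula.free, Finset.mem_erase] at hy ⊢
      refine ⟨hy.1, ?_⟩
      obtain h1 | ⟨ψ, h1, h2⟩ := Formula.mem_free_bigAnd hy.2
      · exact absurd h1 hy.1
      · obtain ⟨k, -, rfl⟩ := List.mem_map.1 h1
        rcases Finset.mem_union.1 h2 with h2 | h2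
        · rw [Formula.free_neg] at h2
          exact absurd (hx k h2) hy.1
        · exact ih _ h2

/-- The translation adds at most `c` blocks of quantifiers. The sequence `pre` consists of the
quantifiers above the formula. -/
theorem blocks_trans {I : Interp A B K} {c : ℕ} (h : I.Costs c) (φ : Formula B)
    (κ : Fin 2 → K) (pre : List Quant) (n : ℕ) (hφ : ∀ l ∈ φ.labels, blocks (pre ++ l) ≤ n) :
    ∀ l ∈ (I.trans φ κ).labels, blocks (pre ++ l) ≤ n + c := by
  have atom : ∀ {pre : List Quant} {ψ : Formula A}, (∀ l ∈ ψ.labels, l = []) → blocks pre ≤ n →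
      (∀ l ∈ ψ.labels, blocks (pre ++ l) ≤ n + c) ∧ ∀ l ∈ ψ.neg.labels, blocks (pre ++ l) ≤ n + c :=
    fun {pre ψ} hψ hpre => by
      refine ⟨fun l hl => ?_, fun l hl => ?_⟩
      · rw [hψ l hl, List.append_nil]; omega
      · rw [Formula.labels_neg, List.mem_map] at hl
        obtain ⟨l', hl', rfl⟩ := hl
        rw [hψ l' hl', List.map_nil, List.append_nil]; omega
  induction φ generalizing κ pre with
  | letter b x => exact (atom (h.labels_letter _ _ _) (by simpa [Formula.labels] using hφ)).1
  | notLetter b x => exact (atom (h.labels_letter _ _ _) (by simpa [Formula.labels] using hφ)).2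
  | lt x y => exact (atom (h.labels_lt _ _ _ _) (by simpa [Formula.labels] using hφ)).1
  | notLt x y => exact (atom (h.labels_lt _ _ _ _) (by simpa [Formula.labels] using hφ)).2
  | eq x y => exact (atom (h.labels_eq _ _ _ _) (by simpa [Formula.labels] using hφ)).1
  | notEq x y => exact (atom (h.labels_eq _ _ _ _) (by simpa [Formula.labels] using hφ)).2
  | and φ ψ h1 h2 =>
    simp only [Formula.labels, List.mem_append, or_imp, forall_and] at hφ
    simp only [trans, Formula.labels, List.mem_append, or_imp, forall_and]
    exact ⟨h1 κ pre hφ.1, h2 κ pre hφ.2⟩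
  | or φ ψ h1 h2 =>
    simp only [Formula.labels, List.mem_append, or_imp, forall_and] at hφ
    simp only [trans, Formula.labels, List.mem_append, or_imp, forall_and]
    exact ⟨h1 κ pre hφ.1, h2 κ pre hφ.2⟩
  | quant q x φ ih =>
    have hφ' : ∀ l ∈ φ.labels, blocks (pre ++ [q] ++ l) ≤ n := fun l hl => by
      simpa using hφ (q :: l) (by simpa [Formula.labels] using hl)
    obtain ⟨l₀, hl₀⟩ := List.exists_mem_of_ne_nil _ φ.labels_ne_nil
    have hpre : blocks (pre ++ [q]) ≤ n := by
      have h1 := hφ' l₀ hl₀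
      have h2 := blocks_append_cons pre q l₀
      have h3 := blocks_cons_pos q l₀
      simp only [List.append_assoc, List.cons_append, List.nil_append] at h1
      omega
    have hguard : ∀ l, blocks (q :: l) ≤ 1 + c → blocks (pre ++ q :: l) ≤ n + c := fun l hl => by
      have h2 := blocks_append_cons pre q l
      omega
    have hrec : ∀ κ, ∀ l ∈ (I.trans φ κ).labels, blocks (pre ++ q :: l) ≤ n + c := fun κ l hl => by
      have := ih κ (pre ++ [q]) hφ' l hl
      simpa using this
    intro l hl
    cases q with
    | ex =>
      simp only [trans, Formula.labels, List.mem_map] at hl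
      obtain ⟨l, hl, rfl⟩ := hl
      obtain rfl | ⟨ψ, h1, h2⟩ := Formula.mem_labels_bigOr hl
      · omega
      · obtain ⟨k, -, rfl⟩ := List.mem_map.1 h1
        rcases List.mem_append.1 h2 with h2 | h2
        · exact hguard l (h.labels_guard _ _ l h2)
        · exact hrec _ l h2
    | all =>
      simp only [trans, Formula.labels, List.mem_map] at hl
      obtain ⟨l, hl, rfl⟩ := hl
      obtain rfl | ⟨ψ, h1, h2⟩ := Formula.mem_labels_bigAnd hl
      · omega
      · obtain ⟨k, -, rfl⟩ := List.mem_map.1 h1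
        rcases List.mem_append.1 h2 with h2 | h2
        · exact hguard l (Formula.blocks_le_of_mem_labels_neg (h.labels_guard _ _) l h2)
        · exact hrec _ l h2

/-- The word `t` is interpreted in the word `w`: the pair of the index `k` and the position `i` with
`V k i` represents the position `pos k i`. -/
structure Models (I : Interp A B K) (w : List A) (t : List B) (V : K → ℕ → Prop)
    (pos : K → ℕ → ℕ) : Prop where
  guard : ∀ k x ν, 1 ≤ ν x → ν x ≤ w.length → ((I.guard k x).Sat w ν ↔ V k (ν x))
  surj : ∀ j, 1 ≤ j → j ≤ t.length →
    ∃ k ∈ I.indices, ∃ i, 1 ≤ i ∧ i ≤ w.length ∧ V k i ∧ pos k i = j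
  mem : ∀ k i, V k i → 1 ≤ pos k i ∧ pos k i ≤ t.length
  letter : ∀ b k x ν, V k (ν x) → ((I.letter b k x).Sat w ν ↔ LetterAt t (pos k (ν x)) b)
  lt : ∀ k l x y ν, V k (ν x) → V l (ν y) →
    ((I.lt k l x y).Sat w ν ↔ pos k (ν x) < pos l (ν y))
  eq : ∀ k l x y ν, V k (ν x) → V l (ν y) →
    ((I.eq k l x y).Sat w ν ↔ pos k (ν x) = pos l (ν y))

theorem Models.sat_trans {I : Interp A B K} {w : List A} {t : List B} {V : K → ℕ → Prop}
    {pos : K → ℕ → ℕ} (h : I.Models w t V pos) (φ : Formula B) (κ : Fin 2 → K)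
    (ν : Fin 2 → ℕ) (hV : ∀ x ∈ φ.free, V (κ x) (ν x)) :
    (I.trans φ κ).Sat w ν ↔ φ.Sat t fun x => pos (κ x) (ν x) := by
  induction φ generalizing κ ν with
  | letter b x => exact h.letter _ _ _ _ (hV x (by simp [Formula.free]))
  | notLetter b x =>
    rw [trans, Formula.sat_neg, h.letter _ _ _ _ (hV x (by simp [Formula.free]))]; rfl
  | lt x y =>
    exact h.lt _ _ _ _ _ (hV x (by simp [Formula.free])) (hV y (by simp [Formula.free]))
  | notLt x y =>
    rw [trans, Formula.sat_neg,
      h.lt _ _ _ _ _ (hV x (by simp [Formula.free])) (hV y (by simp [Formula.free]))]; rfl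
  | eq x y =>
    exact h.eq _ _ _ _ _ (hV x (by simp [Formula.free])) (hV y (by simp [Formula.free]))
  | notEq x y =>
    rw [trans, Formula.sat_neg,
      h.eq _ _ _ _ _ (hV x (by simp [Formula.free])) (hV y (by simp [Formula.free]))]; rfl
  | and φ ψ h1 h2 =>
    exact and_congr (h1 κ ν fun x hx => hV x (Finset.mem_union_left _ hx))
      (h2 κ ν fun x hx => hV x (Finset.mem_union_right _ hx))
  | or φ ψ h1 h2 =>
    exact or_congr (h1 κ ν fun x hx => hV x (Finset.mem_union_left _ hx))
      (h2 κ ν fun x hx => hV x (Finset.mem_union_right _ hx))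
  | quant q x φ ih =>
    have hupd : ∀ k i, V k i → ((I.trans φ (Function.update κ x k)).Sat w (Function.update ν x i) ↔
        φ.Sat t (Function.update (fun y => pos (κ y) (ν y)) x (pos k i))) := fun k i hki => by
      rw [ih]
      · have : (fun y => pos (Function.update κ x k y) (Function.update ν x i y)) =
            Function.update (fun y => pos (κ y) (ν y)) x (pos k i) := by
          funext y
          by_cases hy : y = x
          · subst hy; simp
          · simp [hy]
        rw [this]
      · intro y hy
        by_cases hyx : y = x
        · subst hyx; simpa using hki
        · simpa [hyx] using hV y (by simp [Formula.free, hyx, hy])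
    have hguard : ∀ k i, 1 ≤ i → i ≤ w.length →
        ((I.guard k x).Sat w (Function.update ν x i) ↔ V k i) := fun k i h1 h2 => by
      simpa using h.guard k x (Function.update ν x i) (by simpa) (by simpa)
    cases q with
    | ex =>
      simp only [trans, Formula.Sat, Formula.sat_bigOr, List.mem_map]
      constructor
      · rintro ⟨i, h1, h2, _, ⟨k, hk, rfl⟩, h3, h4⟩
        rw [hguard k i h1 h2] at h3
        obtain ⟨h5, h6⟩ := h.mem k i h3
        exact ⟨pos k i, h5, h6, (hupd k i h3).1 h4⟩
      · rintro ⟨j, h1, h2, h3⟩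
        obtain ⟨k, hk, i, h4, h5, h6, rfl⟩ := h.surj j h1 h2
        exact ⟨i, h4, h5, _, ⟨k, hk, rfl⟩, (hguard k i h4 h5).2 h6, (hupd k i h6).2 h3⟩
    | all =>
      simp only [trans, Formula.Sat, Formula.sat_bigAnd, List.forall_mem_map, Formula.sat_neg]
      constructor
      · intro hs j h1 h2
        obtain ⟨k, hk, i, h4, h5, h6, rfl⟩ := h.surj j h1 h2
        rcases hs i h4 h5 k hk with h7 | h7
        · exact absurd ((hguard k i h4 h5).2 h6) h7
        · exact (hupd k i h6).1 h7
      · intro hs i h1 h2 k hk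
        by_cases h3 : V k i
        · obtain ⟨h5, h6⟩ := h.mem k i h3
          exact Or.inr ((hupd k i h3).2 (hs _ h5 h6))
        · exact Or.inl (by rwa [hguard k i h1 h2])

end Interp

/-- Definability is inherited along interpretations. The relation `R w t` says that `t` is the word
interpreted in `w`. -/
theorem Definable.interp {m c : ℕ} {q : List B → Prop} (hq : Definable m q) (I : Interp A B K)
    [Inhabited K] (hI : I.Costs c) (R : List A → List B → Prop)
    (hR : ∀ w t, R w t → ∃ V pos, I.Models w t V pos)
    (hdom : Definable (m + c) fun w => ∃ t, R w t) :
    Definable (m + c) fun w => ∃ t, R w t ∧ q t := by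
  obtain ⟨φ, h1, h2, h3⟩ := hq
  have htrans : Definable (m + c) fun w => (I.trans φ fun _ => default).Sat w fun _ => 0 := by
    refine ⟨I.trans φ fun _ => default, ?_, ?_, fun w ν => ?_⟩
    · rw [← Finset.subset_empty, ← h1]
      exact I.free_trans hI φ _
    · exact I.blocks_trans hI φ _ [] m h2
    · have : ∀ (ψ : Formula A) (ν μ : Fin 2 → ℕ), (∀ x ∈ ψ.free, ν x = μ x) →
          (ψ.Sat w ν ↔ ψ.Sat w μ) := fun ψ => by
        induction ψ with
        | quant q x ψ ih =>
          intro ν μ h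
          have : ∀ i, ψ.Sat w (Function.update ν x i) ↔ ψ.Sat w (Function.update μ x i) :=
            fun i => ih _ _ fun y hy => by
              by_cases hyx : y = x
              · subst hyx; simp
              · simpa [hyx] using h y (by simp [Formula.free, hyx, hy])
          cases q <;> simp [Formula.Sat, this]
        | and ψ χ h1 h2 =>
          intro ν μ h
          exact and_congr (h1 _ _ fun x hx => h x (Finset.mem_union_left _ hx))
            (h2 _ _ fun x hx => h x (Finset.mem_union_right _ hx))
        | or ψ χ h1 h2 =>
          intro ν μ h
          exact or_congr (h1 _ _ fun x hx => h x (Finset.mem_union_left _ hx))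
            (h2 _ _ fun x hx => h x (Finset.mem_union_right _ hx))
        | _ =>
          intro ν μ h
          simp only [Formula.free, Finset.mem_singleton, Finset.mem_insert, forall_eq,
            forall_eq_or_imp] at h
          simp [Formula.Sat, h]
      refine this _ _ _ fun x hx => ?_
      have := I.free_trans hI φ _ hx
      rw [h1] at this
      simp at this
  refine (hdom.and htrans).congr fun w => ?_
  have key : ∀ t, R w t → ((I.trans φ fun _ => default).Sat w (fun _ => 0) ↔ q t) := fun t ht => by
    obtain ⟨V, pos, hM⟩ := hR w t ht
    rw [hM.sat_trans φ _ _ (by simp [h1]), ← h3]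
  constructor
  · rintro ⟨t, ht, hqt⟩
    exact ⟨⟨t, ht⟩, (key t ht).2 hqt⟩
  · rintro ⟨⟨t, ht⟩, hs⟩
    exact ⟨t, ht, (key t ht).1 hs⟩

/-! ### Relativization to factors -/

theorem letterAt_factor {x t y : List A} {i : ℕ} (h1 : x.length < i)
    (h2 : i ≤ x.length + t.length) (b : A) :
    LetterAt (x ++ t ++ y) i b ↔ LetterAt t (i - x.length) b := by
  unfold LetterAt
  rw [List.append_assoc, List.getElem?_append_right (by omega),
    List.getElem?_append_left (by omega)]
  have : i - 1 - x.length = i - x.length - 1 := by omega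
  rw [this]
  constructor <;> rintro ⟨-, h⟩ <;> exact ⟨by omega, h⟩

/-- Relativization of formulas to the positions that satisfy `G`. -/
def relativize (G : Fin 2 → Formula A) : Interp A A Unit where
  indices := [()]
  letter b _ x := .letter b x
  lt _ _ x y := .lt x y
  eq _ _ x y := .eq x y
  guard _ x := G x

/-- Suppose that `R x t y` selects factors `t` of words `x ++ t ++ y`, and that `G` defines the
positions of the selected factors. -/
theorem Definable.factor {m c : ℕ} {q : List A → Prop} (hq : Definable m q)
    (G : Fin 2 → Formula A) (hfree : ∀ x, (G x).free ⊆ {x})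
    (hG : ∀ x, ∀ l ∈ (G x).labels, blocks (Quant.ex :: l) ≤ 1 + c)
    (R : List A → List A → List A → Prop)
    (hR : ∀ x t y, R x t y → ∀ z ν, 1 ≤ ν z → ν z ≤ (x ++ t ++ y).length →
      ((G z).Sat (x ++ t ++ y) ν ↔ x.length < ν z ∧ ν z ≤ x.length + t.length))
    (hdom : Definable (m + c) fun w => ∃ x t y, w = x ++ t ++ y ∧ R x t y) :
    Definable (m + c) fun w => ∃ x t y, w = x ++ t ++ y ∧ R x t y ∧ q t := by
  have hcost : (relativize G).Costs c :=
    { free_letter := fun _ _ _ => by simp [relativize, Formula.free]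
      free_lt := fun _ _ _ _ => by simp [relativize, Formula.free]
      free_eq := fun _ _ _ _ => by simp [relativize, Formula.free]
      free_guard := fun _ x => hfree x
      labels_letter := by simp [relativize, Formula.labels]
      labels_lt := by simp [relativize, Formula.labels]
      labels_eq := by simp [relativize, Formula.labels]
      labels_guard := fun _ x => hG x }
  refine (hq.interp (relativize G) hcost (fun w t => ∃ x y, w = x ++ t ++ y ∧ R x t y) ?_ ?_).congr
    fun w => ?_
  · rintro _ t ⟨x, y, rfl, hxy⟩
    refine ⟨fun _ i => x.length < i ∧ i ≤ x.length + t.length, fun _ i => i - x.length,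
      fun _ z ν h1 h2 => hR x t y hxy z ν h1 h2, fun j h1 h2 => ?_, fun _ i h => by omega,
      fun b _ z ν h => letterAt_factor h.1 h.2 b, fun _ _ z z' ν h1 h2 => ?_,
      fun _ _ z z' ν h1 h2 => ?_⟩
    · exact ⟨(), List.mem_cons_self, j + x.length, by omega, by simp; omega, by omega, by omega⟩
    · simp only [relativize, Formula.Sat]; omega
    · simp only [relativize, Formula.Sat]; omega
  · refine hdom.congr fun w => ?_
    constructor
    · rintro ⟨t, x, y, h⟩; exact ⟨x, t, y, h⟩
    · rintro ⟨x, t, y, h⟩; exact ⟨t, x, y, h⟩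
  · constructor
    · rintro ⟨x, t, y, h1, h2, h3⟩; exact ⟨t, ⟨x, y, h1, h2⟩, h3⟩
    · rintro ⟨t, ⟨x, y, h1, h2⟩, h3⟩; exact ⟨x, t, y, h1, h2, h3⟩

theorem definable_mem {m : ℕ} (hm : 1 ≤ m) (a : A) : Definable m fun w : List A => a ∈ w := by
  refine ⟨.quant .ex 0 (.letter a 0), by simp [Formula.free], by simpa [Formula.labels] using hm,
    fun w ν => ?_⟩
  simp only [Formula.Sat, Function.update_self]
  rw [List.mem_iff_getElem?]
  constructor
  · rintro ⟨i, hi⟩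
    have := (List.getElem?_eq_some_iff.1 hi).1
    exact ⟨i + 1, by omega, by omega, by omega, hi⟩
  · rintro ⟨i, -, -, -, hi⟩
    exact ⟨_, hi⟩

theorem letterAt_mid (x y : List A) (a : A) : LetterAt (x ++ a :: y) (x.length + 1) a := by
  simp [LetterAt]

theorem le_of_letterAt {x y : List A} {a : A} (h : a ∉ x) {i : ℕ}
    (hi : LetterAt (x ++ a :: y) i a) : x.length + 1 ≤ i := by
  by_contra hlt
  have h1 := hi.1
  have h2 := hi.2
  rw [List.getElem?_append_left (by omega)] at h2
  exact h (List.mem_of_getElem? h2)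

theorem ge_of_letterAt {x y : List A} {a : A} (h : a ∉ y) {i : ℕ}
    (hi : LetterAt (x ++ a :: y) i a) : i ≤ x.length + 1 := by
  by_contra hlt
  have h1 := hi.1
  have h2 := hi.2
  rw [List.getElem?_append_right (by omega), List.getElem?_cons] at h2
  rw [if_neg (by omega)] at h2
  exact h (List.mem_of_getElem? h2)

theorem exists_first_occurrence {a : A} {w : List A} :
    a ∈ w ↔ ∃ x y, w = x ++ a :: y ∧ a ∉ x := by
  classical
  constructor
  · intro h
    obtain ⟨x, y, h1, h2⟩ := List.eq_append_cons_of_mem h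
    exact ⟨x, y, h1, h2⟩
  · rintro ⟨x, y, rfl, -⟩
    simp

theorem exists_last_occurrence {a : A} {w : List A} :
    a ∈ w ↔ ∃ x y, w = x ++ a :: y ∧ a ∉ y := by
  rw [← List.mem_reverse, exists_first_occurrence]
  constructor
  · rintro ⟨x, y, h1, h2⟩
    refine ⟨y.reverse, x.reverse, ?_, by simpa⟩
    rw [← List.reverse_reverse w, h1]
    simp
  · rintro ⟨x, y, rfl, h⟩
    exact ⟨y.reverse, x.reverse, by simp, by simpa⟩

/-- The variable other than `x`. -/
def other (x : Fin 2) : Fin 2 := 1 - x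

theorem other_ne (x : Fin 2) : other x ≠ x := by fin_cases x <;> decide

/-- Relativization to the suffix after the first `a` is free of charge. -/
theorem Definable.after_first {m : ℕ} (hm : 1 ≤ m) {q : List A → Prop} (hq : Definable m q)
    (a : A) : Definable m fun w => ∃ x y, w = x ++ a :: y ∧ a ∉ x ∧ q y := by
  refine (hq.factor (c := 0)
    (fun x => .quant .ex (other x) (.and (.lt (other x) x) (.letter a (other x))))
    (fun x => ?_) (fun x => by simp [Formula.labels])
    (fun x _ y => y = [] ∧ ∃ x', x = x' ++ [a] ∧ a ∉ x') ?_ ?_).congr fun w => ?_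
  · intro y; simp [Formula.free]; tauto
  · rintro _ t _ ⟨rfl, x, rfl, hx⟩ z ν h1 h2
    simp only [Formula.Sat, Function.update_self, Function.update_of_ne (other_ne z).symm,
      List.append_nil, List.append_assoc, List.cons_append, List.nil_append, List.length_append,
      List.length_cons, List.length_nil] at h1 h2 ⊢
    constructor
    · rintro ⟨i, -, -, h3, h4⟩
      have := le_of_letterAt hx h4
      omega
    · rintro ⟨h3, -⟩
      exact ⟨x.length + 1, by omega, by omega, by omega, letterAt_mid ..⟩
  · refine (definable_mem hm a).congr fun w => ?_
    rw [exists_first_occurrence]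
    constructor
    · rintro ⟨_, t, _, rfl, rfl, x, rfl, hx⟩; exact ⟨x, t, by simp, hx⟩
    · rintro ⟨x, y, rfl, hx⟩; exact ⟨x ++ [a], y, [], by simp, rfl, x, rfl, hx⟩
  · constructor
    · rintro ⟨x, y, rfl, hx, hy⟩; exact ⟨x ++ [a], y, [], by simp, ⟨rfl, x, rfl, hx⟩, hy⟩
    · rintro ⟨_, t, _, rfl, ⟨rfl, x, rfl, hx⟩, ht⟩; exact ⟨x, t, by simp, hx, ht⟩

/-- Relativization to the prefix before the last `a` is free of charge. -/
theorem Definable.before_last {m : ℕ} (hm : 1 ≤ m) {q : List A → Prop} (hq : Definable m q)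
    (a : A) : Definable m fun w => ∃ x y, w = x ++ a :: y ∧ a ∉ y ∧ q x := by
  refine (hq.factor (c := 0)
    (fun x => .quant .ex (other x) (.and (.lt x (other x)) (.letter a (other x))))
    (fun x => ?_) (fun x => by simp [Formula.labels])
    (fun x _ y => x = [] ∧ ∃ y', y = a :: y' ∧ a ∉ y') ?_ ?_).congr fun w => ?_
  · intro y; simp [Formula.free]; tauto
  · rintro _ t _ ⟨rfl, y, rfl, hy⟩ z ν h1 h2
    simp only [Formula.Sat, Function.update_self, Function.update_of_ne (other_ne z).symm,
      List.nil_append, List.length_append, List.length_cons, List.length_nil] at h1 h2 ⊢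
    constructor
    · rintro ⟨i, -, -, h3, h4⟩
      have := ge_of_letterAt hy h4
      omega
    · rintro ⟨-, h3⟩
      exact ⟨t.length + 1, by omega, by omega, by omega, letterAt_mid ..⟩
  · refine (definable_mem hm a).congr fun w => ?_
    rw [exists_last_occurrence]
    constructor
    · rintro ⟨_, t, _, rfl, rfl, y, rfl, hy⟩; exact ⟨t, y, by simp, hy⟩
    · rintro ⟨x, y, rfl, hy⟩; exact ⟨[], x, a :: y, by simp, rfl, y, rfl, hy⟩
  · constructor
    · rintro ⟨x, y, rfl, hy, hx⟩; exact ⟨[], x, a :: y, by simp, ⟨rfl, y, rfl, hy⟩, hx⟩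
    · rintro ⟨_, t, _, rfl, ⟨rfl, y, rfl, hy⟩, ht⟩; exact ⟨t, y, by simp, hy, ht⟩

/-- Relativization to the prefix before the first `a` costs one block of quantifiers. -/
theorem Definable.before_first {m : ℕ} {q : List A → Prop} (hq : Definable m q)
    (a : A) : Definable (m + 1) fun w => ∃ x y, w = x ++ a :: y ∧ a ∉ x ∧ q x := by
  refine (hq.factor (c := 1)
    (fun x => .quant .all (other x) (.or (.notLetter a (other x)) (.lt x (other x))))
    (fun x => ?_) (fun x => by simp [Formula.labels, blocks_cons_cons])
    (fun x t y => x = [] ∧ a ∉ t ∧ ∃ y', y = a :: y') ?_ ?_).congr fun w => ?_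
  · intro y; simp [Formula.free]; tauto
  · rintro _ t _ ⟨rfl, ht, y, rfl⟩ z ν h1 h2
    simp only [Formula.Sat, Function.update_self, Function.update_of_ne (other_ne z).symm,
      List.nil_append, List.length_append, List.length_cons, List.length_nil] at h1 h2 ⊢
    constructor
    · intro h
      have := (h (t.length + 1) (by omega) (by omega)).resolve_left (not_not.2 (letterAt_mid ..))
      omega
    · rintro ⟨-, h3⟩ i - -
      by_cases h4 : LetterAt (t ++ a :: y) i a
      · have := le_of_letterAt ht h4
        exact Or.inr (by omega)
      · exact Or.inl h4
  · refine (definable_mem (by omega) a).congr fun w => ?_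
    rw [exists_first_occurrence]
    constructor
    · rintro ⟨_, t, _, rfl, rfl, ht, y, rfl⟩; exact ⟨t, y, by simp, ht⟩
    · rintro ⟨x, y, rfl, hx⟩; exact ⟨[], x, a :: y, by simp, rfl, hx, y, rfl⟩
  · constructor
    · rintro ⟨x, y, rfl, hx, hq⟩; exact ⟨[], x, a :: y, by simp, ⟨rfl, hx, y, rfl⟩, hq⟩
    · rintro ⟨_, t, _, rfl, ⟨rfl, ht, y, rfl⟩, hq⟩; exact ⟨t, y, by simp, ht, hq⟩

/-- Relativization to the suffix after the last `a` costs one block of quantifiers. -/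
theorem Definable.after_last {m : ℕ} {q : List A → Prop} (hq : Definable m q)
    (a : A) : Definable (m + 1) fun w => ∃ x y, w = x ++ a :: y ∧ a ∉ y ∧ q y := by
  refine (hq.factor (c := 1)
    (fun x => .quant .all (other x) (.or (.notLetter a (other x)) (.lt (other x) x)))
    (fun x => ?_) (fun x => by simp [Formula.labels, blocks_cons_cons])
    (fun x t y => y = [] ∧ a ∉ t ∧ ∃ x', x = x' ++ [a]) ?_ ?_).congr fun w => ?_
  · intro y; simp [Formula.free]
  · rintro _ t _ ⟨rfl, ht, x, rfl⟩ z ν h1 h2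
    simp only [Formula.Sat, Function.update_self, Function.update_of_ne (other_ne z).symm,
      List.append_nil, List.append_assoc, List.cons_append, List.nil_append, List.length_append,
      List.length_cons, List.length_nil] at h1 h2 ⊢
    constructor
    · intro h
      have := (h (x.length + 1) (by omega) (by omega)).resolve_left (not_not.2 (letterAt_mid ..))
      omega
    · rintro ⟨h3, -⟩ i - -
      by_cases h4 : LetterAt (x ++ a :: t) i a
      · have := ge_of_letterAt ht h4
        exact Or.inr (by omega)
      · exact Or.inl h4
  · refine (definable_mem (by omega) a).congr fun w => ?_
    rw [exists_last_occurrence]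
    constructor
    · rintro ⟨_, t, _, rfl, rfl, ht, x, rfl⟩; exact ⟨x, t, by simp, ht⟩
    · rintro ⟨x, y, rfl, hy⟩; exact ⟨x ++ [a], y, [], by simp, rfl, hy, x, rfl⟩
  · constructor
    · rintro ⟨x, y, rfl, hy, hq⟩; exact ⟨x ++ [a], y, [], by simp, ⟨rfl, hy, x, rfl⟩, hq⟩
    · rintro ⟨_, t, _, rfl, ⟨rfl, ht, x, rfl⟩, hq⟩; exact ⟨x, t, by simp, ht, hq⟩

/-! ### Condensed rankers are definable -/

theorem letterFn_eq_some_iff {w : List A} {t : ℤ} {a : A} :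
    letterFn w t = some a ↔ ∃ i : ℕ, t = i ∧ LetterAt w i a := by
  constructor
  · intro h
    have := (letterFn_ne_none (w := w) (x := t)).1 (by simp [h])
    obtain ⟨i, rfl⟩ := Int.eq_ofNat_of_zero_le (a := t) (by omega)
    exact ⟨i, rfl, letterAt_iff.2 h⟩
  · rintro ⟨i, rfl, h⟩
    exact letterAt_iff.1 h

theorem go_first {x y : List A} {a : A} (hx : a ∉ x) :
    (ofWord (x ++ a :: y)).Go ⟨.X, a⟩ 0 (x.length + 1) := by
  refine ⟨by omega, ?_, fun t h1 h2 h3 => ?_⟩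
  · exact letterFn_eq_some_iff.2 ⟨x.length + 1, by simp, letterAt_mid ..⟩
  · obtain ⟨i, rfl, hi⟩ := letterFn_eq_some_iff.1 h3
    have := le_of_letterAt hx hi
    omega

theorem go_last {x y : List A} {a : A} (hy : a ∉ y) :
    (ofWord (x ++ a :: y)).Go ⟨.Y, a⟩ (ofWord (x ++ a :: y)).hi (x.length + 1) := by
  refine ⟨by simp [ofWord], ?_, fun t h1 h2 h3 => ?_⟩
  · exact letterFn_eq_some_iff.2 ⟨x.length + 1, by simp, letterAt_mid ..⟩
  · obtain ⟨i, rfl, hi⟩ := letterFn_eq_some_iff.1 h3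
    have := ge_of_letterAt hy hi
    omega

theorem mem_of_cond_cons {w : List A} {z : Step A} {r : List (Step A)}
    (h : (ofWord w).Cond (z :: r)) : z.letter ∈ w := by
  obtain ⟨p, -, -, h, -⟩ := h
  obtain ⟨i, -, hi⟩ := letterFn_eq_some_iff.1 h.letter
  exact List.mem_of_getElem? hi.2

theorem cond_after_mid (x y : List A) (a : A) (r : List (Step A)) :
    ((ofWord (x ++ a :: y)).after (x.length + 1)).Cond r ↔ (ofWord y).Cond r := by
  rw [← cond_factor (x ++ [a]) y []]
  have : (ofWord (x ++ a :: y)).after (x.length + 1) = factor (x ++ [a]) y [] := by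
    simp [ofWord, Seg.after, factor]
    omega
  rw [this]

theorem cond_before_mid (x y : List A) (a : A) (r : List (Step A)) :
    ((ofWord (x ++ a :: y)).before (x.length + 1)).Cond r ↔ (ofWord x).Cond r := by
  rw [← cond_factor [] x (a :: y)]
  have : (ofWord (x ++ a :: y)).before (x.length + 1) = factor [] x (a :: y) := by
    simp [ofWord, Seg.before, factor]
  rw [this]

/-- A condensed ranker that starts with `X_a` cuts the word at its first `a`. -/
theorem cond_X_cons_iff (w : List A) (a : A) (r : List (Step A)) :
    (ofWord w).Cond (⟨.X, a⟩ :: r) ↔ ∃ x y, w = x ++ a :: y ∧ a ∉ x ∧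
      match (r.map Step.dir).head? with
      | some .Y => (ofWord x).Cond r
      | _ => (ofWord y).Cond r := by
  have key : ∀ x y : List A, a ∉ x → ((ofWord (x ++ a :: y)).Cond (⟨.X, a⟩ :: r) ↔
      match (r.map Step.dir).head? with
      | some .Y => (ofWord x).Cond r
      | _ => (ofWord y).Cond r) := fun x y hx => by
    rw [Seg.cond_cons_iff (p := x.length + 1) (by simp only [ofWord]; omega) (by simp [ofWord])
      (go_first hx)]
    have h1 := cond_after_mid x y a r
    have h2 := cond_before_mid x y a r
    rcases r with - | ⟨⟨_ | _, b⟩, r⟩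
    · exact h1
    · exact h1
    · exact h2
  constructor
  · intro h
    obtain ⟨x, y, rfl, hx⟩ := exists_first_occurrence.1 (mem_of_cond_cons h)
    exact ⟨x, y, rfl, hx, (key x y hx).1 h⟩
  · rintro ⟨x, y, rfl, hx, h⟩
    exact (key x y hx).2 h

/-- A condensed ranker that starts with `Y_a` cuts the word at its last `a`. -/
theorem cond_Y_cons_iff (w : List A) (a : A) (r : List (Step A)) :
    (ofWord w).Cond (⟨.Y, a⟩ :: r) ↔ ∃ x y, w = x ++ a :: y ∧ a ∉ y ∧
      match (r.map Step.dir).head? with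
      | some .Y => (ofWord x).Cond r
      | _ => (ofWord y).Cond r := by
  have key : ∀ x y : List A, a ∉ y → ((ofWord (x ++ a :: y)).Cond (⟨.Y, a⟩ :: r) ↔
      match (r.map Step.dir).head? with
      | some .Y => (ofWord x).Cond r
      | _ => (ofWord y).Cond r) := fun x y hy => by
    rw [Seg.cond_cons_iff (p := x.length + 1) (by simp only [ofWord]; omega) (by simp [ofWord])
      (go_last hy)]
    have h1 := cond_after_mid x y a r
    have h2 := cond_before_mid x y a r
    rcases r with - | ⟨⟨_ | _, b⟩, r⟩
    · exact h1
    · exact h1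
    · exact h2
  constructor
  · intro h
    obtain ⟨x, y, rfl, hx⟩ := exists_last_occurrence.1 (mem_of_cond_cons h)
    exact ⟨x, y, rfl, hx, (key x y hx).1 h⟩
  · rintro ⟨x, y, rfl, hx, h⟩
    exact (key x y hx).2 h

/-- Being condensed on a word is definable with as many blocks of quantifiers as the ranker has
blocks: a block is only spent when the direction changes, since passing to the suffix after a first
occurrence, or to the prefix before a last one, is free of charge. -/
theorem definable_cond (z : Step A) (r : List (Step A)) :
    Definable (blocks ((z :: r).map Step.dir)) fun w => (ofWord w).Cond (z :: r) := by
  induction r generalizing z with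
  | nil =>
    rcases z with ⟨_ | _, a⟩
    · refine (definable_mem le_rfl a).congr fun w => ?_
      rw [cond_X_cons_iff, exists_first_occurrence]
      simp [Seg.Cond]
    · refine (definable_mem le_rfl a).congr fun w => ?_
      rw [cond_Y_cons_iff, exists_last_occurrence]
      simp [Seg.Cond]
  | cons z' r ih =>
    have h := ih z'
    rcases z with ⟨_ | _, a⟩ <;> rcases z' with ⟨_ | _, a'⟩ <;>
      simp only [List.map_cons, blocks_cons_self] at h ⊢
    · exact (h.after_first (blocks_cons_pos ..) a).congr fun w => cond_X_cons_iff ..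
    · rw [blocks_cons_cons, if_neg (by simp), Nat.add_comm]
      exact (h.before_first a).congr fun w => cond_X_cons_iff ..
    · rw [blocks_cons_cons, if_neg (by simp), Nat.add_comm]
      exact (h.after_last a).congr fun w => cond_Y_cons_iff ..
    · exact (h.before_last (blocks_cons_pos ..) a).congr fun w => cond_Y_cons_iff ..

theorem finite_rankersLE [Finite A] (d : Dir) (m n : ℕ) : (rankersLE A d m n).Finite := by
  have : Finite (Step A) := Finite.of_injective (fun z : Step A => (z.dir = .X, z.letter)) (by
    rintro ⟨_ | _, a⟩ ⟨_ | _, b⟩ h <;> simp_all)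
  refine (List.finite_length_le (Step A) n).subset ?_
  rintro r (⟨n', h1, -, -, h2⟩ | ⟨d', m', -, n', h1, -, -, h2⟩)
  · exact h2.le.trans h1
  · exact h2.le.trans h1.le

theorem definable_condensed {d : Dir} {m n : ℕ} {r : List (Step A)} (hr : r ∈ rankersLE A d m n) :
    Definable m fun w => Condensed w r := by
  obtain ⟨h1, h2⟩ : r ≠ [] ∧ blocks (r.map Step.dir) ≤ m := by
    rcases hr with ⟨n', -, h1, h2, -⟩ | ⟨d', m', h0, n', -, h1, h2, -⟩
    · exact ⟨by rintro rfl; simp at h1, h2.le⟩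
    · exact ⟨by rintro rfl; simp at h1, by omega⟩
  rcases r with - | ⟨z, r⟩
  · exact absurd rfl h1
  · exact ((definable_cond z r).mono h2).congr fun w => condensed_iff_cond h1

/-- A property that is invariant under `CondEquiv d m n` is definable with `m` blocks. -/
theorem definable_of_condEquiv [Finite A] {d : Dir} {m n : ℕ} (hm : 1 ≤ m) {q : List A → Prop}
    (hq : ∀ v w, CondEquiv d m n v w → (q v ↔ q w)) : Definable m q := by
  have : Finite (rankersLE A d m n) := finite_rankersLE d m n
  exact Definable.of_finite_family hm (ι := rankersLE A d m n)
    (p := fun r w => Condensed w r) (fun r => definable_condensed r.2)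
    fun v w h => hq v w fun r hr => h ⟨r, hr⟩

/-! ### Inverse images under morphisms -/

section Morphism

variable (g : A → List B)

theorem length_flatMap_take_succ (w : List A) (i : ℕ) (a : A) (h : w[i]? = some a) :
    ((w.take (i + 1)).flatMap g).length = ((w.take i).flatMap g).length + (g a).length := by
  rw [List.take_add_one, h]
  simp

theorem length_flatMap_take_mono (w : List A) {i j : ℕ} (h : i ≤ j) :
    ((w.take i).flatMap g).length ≤ ((w.take j).flatMap g).length := by
  obtain ⟨k, rfl⟩ := Nat.exists_eq_add_of_le h
  rw [List.take_add, List.flatMap_append, List.length_append]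
  omega

theorem getElem?_flatMap_take (w : List A) (i k : ℕ) (a : A) (h : w[i]? = some a)
    (hk : k < (g a).length) :
    (w.flatMap g)[((w.take i).flatMap g).length + k]? = (g a)[k]? := by
  obtain ⟨hi, hia⟩ := List.getElem?_eq_some_iff.1 h
  conv_lhs => rw [← List.take_append_drop i w, List.drop_eq_getElem_cons hi, hia]
  rw [List.flatMap_append, List.flatMap_cons, List.take_append_of_le_length (by simp; omega),
    List.take_take, min_self, List.getElem?_append_right (by omega),
    List.getElem?_append_left (by omega)]
  congr 1
  omega

open Classical in
/-- The interpretation of the image of a word under a morphism: the position `k + 1` of the image of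
the letter at position `i` is represented by `i` with the index `k`. -/
noncomputable def morphismInterp (l : List A) (n : ℕ) : Interp A B ℕ where
  indices := List.range n
  letter b k x := .bigOr x ((l.filter fun a => (g a)[k]? = some b).map fun a => .letter a x)
  lt k k' x y := if k < k' then .or (.lt x y) (.eq x y) else .lt x y
  eq k k' x y := if k = k' then .eq x y else .lt x x
  guard k x := .bigOr x ((l.filter fun a => k < (g a).length).map fun a => .letter a x)

/-- All formulas of the interpretation are free of quantifiers. -/
theorem morphismInterp_costs (l : List A) (n : ℕ) : (morphismInterp g l n).Costs 0 := by
  classical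
  have free : ∀ (s : List A) (x : Fin 2), (Formula.bigOr x (s.map fun a => .letter a x)).free ⊆
      {x} := fun s x y hy => by
    obtain rfl | ⟨φ, hφ, hy⟩ := Formula.mem_free_bigOr hy
    · simp
    · obtain ⟨a, -, rfl⟩ := List.mem_map.1 hφ
      exact hy
  have labels : ∀ (s : List A) (x : Fin 2),
      ∀ l ∈ (Formula.bigOr x (s.map fun a => .letter a x)).labels, l = [] := fun s x l hl => by
    obtain rfl | ⟨φ, hφ, hl⟩ := Formula.mem_labels_bigOr hl
    · rfl
    · obtain ⟨a, -, rfl⟩ := List.mem_map.1 hφ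
      simpa [Formula.labels] using hl
  refine ⟨fun b k x => free _ x, fun k k' x y => ?_, fun k k' x y => ?_, fun k x => free _ x,
    fun b k x => labels _ x, fun k k' x y => ?_, fun k k' x y => ?_, fun k x l hl => ?_⟩
  · simp only [morphismInterp]; split_ifs <;> simp [Formula.free]
  · simp only [morphismInterp]; split_ifs <;> simp [Formula.free]
  · simp only [morphismInterp]; split_ifs <;> simp [Formula.labels]
  · simp only [morphismInterp]; split_ifs <;> simp [Formula.labels]
  · rw [labels _ x l hl]; simp

theorem morphismInterp_models {l : List A} (hl : ∀ a, a ∈ l) {n : ℕ}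
    (hn : ∀ a, (g a).length ≤ n) (w : List A) :
    (morphismInterp g l n).Models w (w.flatMap g)
      (fun k i => ∃ a, LetterAt w i a ∧ k < (g a).length)
      (fun k i => ((w.take (i - 1)).flatMap g).length + k + 1) := by
  classical
  have bound : ∀ (k i : ℕ) (a : A), LetterAt w i a → k < (g a).length →
      ((w.take (i - 1)).flatMap g).length + k + 1 ≤ ((w.take i).flatMap g).length :=
    fun k i a h hk => by
      have := length_flatMap_take_succ g w (i - 1) a h.2
      rw [Nat.sub_add_cancel h.1] at this
      omega
  have bound' : ∀ i, ((w.take i).flatMap g).length ≤ (w.flatMap g).length := fun i => by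
    conv_rhs => rw [← List.take_append_drop i w, List.flatMap_append, List.length_append]
    omega
  have order : ∀ k k' i i', (∃ a, LetterAt w i a ∧ k < (g a).length) → i < i' →
      ((w.take (i - 1)).flatMap g).length + k + 1 < ((w.take (i' - 1)).flatMap g).length + k' + 1 :=
    fun k k' i i' ⟨a, h1, h2⟩ hlt => by
      have h3 := bound k i a h1 h2
      have h4 := length_flatMap_take_mono g w (i := i) (j := i' - 1) (by omega)
      omega
  refine ⟨fun k x ν h1 h2 => ?_, fun j h1 h2 => ?_, fun k i ⟨a, h1, h2⟩ => ?_,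
    fun b k x ν ⟨a, h1, h2⟩ => ?_, fun k k' x y ν h1 h2 => ?_, fun k k' x y ν h1 h2 => ?_⟩
  · simp only [morphismInterp, Formula.sat_bigOr, List.mem_map, List.mem_filter, decide_eq_true_eq]
    constructor
    · rintro ⟨_, ⟨a, ⟨-, h3⟩, rfl⟩, h4⟩
      exact ⟨a, h4, h3⟩
    · rintro ⟨a, h3, h4⟩
      exact ⟨_, ⟨a, ⟨hl a, h4⟩, rfl⟩, h3⟩
  · -- The position `j` lies in the image of the first prefix whose image has length at least `j`.
    have hex : ∃ i, j ≤ ((w.take i).flatMap g).length := ⟨w.length, by simpa using h2⟩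
    have hi := Nat.find_spec hex
    set i := Nat.find hex with hidef
    have hi0 : i ≠ 0 := fun h => by rw [h] at hi; simp at hi; omega
    have hlt : ((w.take (i - 1)).flatMap g).length < j := by
      have := Nat.find_min hex (m := i - 1) (by omega)
      omega
    have hiw : i ≤ w.length := Nat.find_min' hex (by simpa using h2)
    have hget : w[i - 1]? = some w[i - 1] := List.getElem?_eq_getElem (by omega)
    have hsucc := length_flatMap_take_succ g w (i - 1) _ hget
    rw [Nat.sub_add_cancel (by omega)] at hsucc
    have := hn w[i - 1]
    exact ⟨j - 1 - ((w.take (i - 1)).flatMap g).length, List.mem_range.2 (by omega), i, by omega,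
      hiw, ⟨w[i - 1], ⟨by omega, hget⟩, by omega⟩, by omega⟩
  · have := bound k i a h1 h2
    have := bound' i
    omega
  · have hget := getElem?_flatMap_take g w (ν x - 1) k a h1.2 h2
    simp only [morphismInterp, Formula.sat_bigOr, List.mem_map, List.mem_filter, decide_eq_true_eq,
      LetterAt, Nat.add_sub_cancel, hget]
    constructor
    · rintro ⟨_, ⟨a', ⟨-, h3⟩, rfl⟩, -, h4⟩
      rw [h1.2, Option.some_inj] at h4
      subst h4
      exact ⟨by omega, h3⟩
    · rintro ⟨-, h3⟩
      exact ⟨_, ⟨a, ⟨hl a, h3⟩, rfl⟩, h1⟩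
  · have h3 := order k k' (ν x) (ν y) h1
    have h4 := order k' k (ν y) (ν x) h2
    rcases lt_trichotomy (ν x) (ν y) with h | h | h
    · have := h3 h
      simp only [morphismInterp]
      split_ifs <;> simp only [Formula.Sat] <;> omega
    · simp only [morphismInterp]
      split_ifs <;> simp only [Formula.Sat, h, or_true, true_iff] <;> omega
    · have := h4 h
      simp only [morphismInterp]
      split_ifs <;> simp only [Formula.Sat] <;> omega
  · have h3 := order k k' (ν x) (ν y) h1
    have h4 := order k' k (ν y) (ν x) h2
    rcases lt_trichotomy (ν x) (ν y) with h | h | h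
    · have := h3 h
      simp only [morphismInterp]
      split_ifs <;> simp only [Formula.Sat] <;> omega
    · simp only [morphismInterp]
      split_ifs <;> simp only [Formula.Sat, h, true_iff] <;> omega
    · have := h4 h
      simp only [morphismInterp]
      split_ifs <;> simp only [Formula.Sat] <;> omega

/-- Definability is preserved by inverse images under morphisms of free monoids, given by the images
`g a` of the letters. -/
theorem Definable.flatMap [Finite A] {m : ℕ} (hm : 1 ≤ m) {q : List B → Prop}
    (hq : Definable m q) : Definable m fun w => q (w.flatMap g) := by
  have : Fintype A := Fintype.ofFinite A
  refine (hq.interp _ (morphismInterp_costs g Finset.univ.toList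
    (Finset.univ.sup fun a => (g a).length)) (fun w t => t = w.flatMap g) ?_ ?_).congr
    fun w => by simp
  · rintro w _ rfl
    exact ⟨_, _, morphismInterp_models g (by simp)
      (fun a => Finset.le_sup (f := fun a => (g a).length) (Finset.mem_univ a)) w⟩
  · exact (definable_true hm).congr (by simp)

end Morphism

/-- `Definable.flatMap` in terms of monoid homomorphisms. -/
theorem Definable.comap [Finite A] {m : ℕ} (hm : 1 ≤ m) (f : FreeMonoid A →* FreeMonoid B)
    {q : List B → Prop} (hq : Definable m q) :
    Definable m fun w => q (f (FreeMonoid.ofList w)).toList := by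
  refine (Definable.flatMap (fun a => (f (FreeMonoid.of a)).toList) hm hq).congr fun w => ?_
  have : (f (FreeMonoid.ofList w)).toList = w.flatMap fun a => (f (FreeMonoid.of a)).toList := by
    induction w with
    | nil => simp
    | cons a w ih => rw [FreeMonoid.ofList_cons, map_mul, FreeMonoid.toList_mul, ih]; rfl
  rw [this]

end FO2Alt

namespace FO2Alt

/-! ### The quotients by the congruences of condensed rankers -/

section

variable {A : Type u} {d : Dir} {m n : ℕ}

theorem CondEquiv.condCon {v w : List A} (h : CondEquiv d m n v w) :
    FO2Alt.condCon A d m n (FreeMonoid.ofList v) (FreeMonoid.ofList w) :=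
  ConGen.Rel.of _ _ h

/-- The congruence generated by `CondEquiv` contains it, and `CondEquiv` is of finite index. -/
theorem finite_condCon_quotient [Finite A] (d : Dir) (m n : ℕ) :
    Finite (condCon A d m n).Quotient := by
  have : Finite (rankersLE A d m n) := (finite_rankersLE d m n).to_subtype
  -- A word is determined up to `CondEquiv` by the set of rankers that are condensed on it.
  let F : List A → rankersLE A d m n → Prop := fun w r => Condensed w r
  have hF : ∀ v w : List A, F v = F w →
      (condCon A d m n).mk' (FreeMonoid.ofList v) = (condCon A d m n).mk' (FreeMonoid.ofList w) :=
    fun v w h => (Con.eq _).2 (CondEquiv.condCon fun r hr => iff_of_eq (congrFun h ⟨r, hr⟩))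
  refine Finite.of_surjective
    (fun s : Set.range F => (condCon A d m n).mk' (FreeMonoid.ofList s.2.choose)) fun c => ?_
  obtain ⟨w, rfl⟩ := Con.mk'_surjective c
  exact ⟨⟨F w.toList, w.toList, rfl⟩, hF _ _ (Set.mem_range_self w.toList).choose_spec⟩

/-- The languages recognized by the canonical projection are definable, since the congruence
contains `CondEquiv`. -/
theorem definable_mk'_mem [Finite A] (hm : 1 ≤ m) (S : Set (condCon A d m n).Quotient) :
    Definable m fun w => (condCon A d m n).mk' (FreeMonoid.ofList w) ∈ S :=
  definable_of_condEquiv hm fun v w h => by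
    rw [show (condCon A d m n).mk' (FreeMonoid.ofList v) =
      (condCon A d m n).mk' (FreeMonoid.ofList w) from (Con.eq _).2 h.condCon]

/-- Since words that agree on condensed rankers cannot be distinguished by `L` in any context, also
the congruence that is generated by this relation is contained in the syntactic one. -/
theorem FO2Definable.exists_condCon_le (hm : 1 ≤ m) {L : Language A} (hL : FO2Definable m L)
    (d : Dir) : ∃ N, m + 1 ≤ N ∧ condCon A d (m + 1) N ≤ syntacticCon L := by
  obtain ⟨N, h1, h2⟩ := hL.exists_condEquiv hm d
  exact ⟨N, h1, Con.conGen_le.2 fun v w h => h2 _ _ h⟩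

end

/-! ### Pseudovarieties -/

namespace Pseudovariety

theorem generated_le {C : (M : Type) → [Monoid M] → Prop} {V : Pseudovariety}
    (h : ∀ (M : Type) [Monoid M], C M → V.mem M) : generated C ≤ V :=
  fun _ _ hM => hM.2 V h

theorem mem_generated {C : (M : Type) → [Monoid M] → Prop} {M : Type} [Monoid M] [Finite M]
    (h : C M) : (generated C).mem M :=
  ⟨inferInstance, fun _ hV => hV M h⟩

theorem mem_of_mulEquiv (V : Pseudovariety) {M N : Type} [Monoid M] [Monoid N] (e : M ≃* N)
    (h : V.mem N) : V.mem M :=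
  V.image N M e.symm.toMonoidHom e.symm.surjective h

theorem mem_of_injective (V : Pseudovariety) {M N : Type} [Monoid M] [Monoid N] (f : M →* N)
    (hf : Function.Injective f) (h : V.mem N) : V.mem M := by
  refine V.mem_of_mulEquiv (MulEquiv.ofBijective f.mrangeRestrict ⟨fun x y hxy => hf ?_,
    f.mrangeRestrict_surjective⟩) (V.submonoid N _ h)
  exact congrArg Subtype.val hxy

end Pseudovariety

theorem condCon_quotient_mem {A : Type} [Finite A] (d : Dir) {m n : ℕ} (h : m ≤ n) :
    (condVar d m).mem (condCon A d m n).Quotient :=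
  have := finite_condCon_quotient (A := A) d m n
  Pseudovariety.mem_generated ⟨A, inferInstance, n, h, ⟨MulEquiv.refl _⟩⟩

/-- The quotient of a free monoid by a congruence of finite index embeds into the product of the
syntactic monoids of the classes of the congruence, and here these classes are definable. -/
theorem condVar_le_fo2Var (d : Dir) {m : ℕ} (hm : 1 ≤ m) : condVar d m ≤ FO2Var m := by
  refine Pseudovariety.generated_le ?_
  rintro M _ ⟨A, _, n, -, ⟨e⟩⟩
  refine Pseudovariety.mem_of_mulEquiv _ e ?_
  have := finite_condCon_quotient (A := A) d m n
  set C := condCon A d m n with hC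
  let K : C.Quotient → Language A := fun c => {w | C.mk' (FreeMonoid.ofList w) ∈ ({c} : Set _)}
  have hK : ∀ c, C ≤ syntacticCon (K c) := fun c v w h x y => by
    have h1 : C.mk' v = C.mk' w := (Con.eq _).2 h
    change C.mk' (FreeMonoid.ofList x * v * FreeMonoid.ofList y) ∈ ({c} : Set _) ↔
      C.mk' (FreeMonoid.ofList x * w * FreeMonoid.ofList y) ∈ ({c} : Set _)
    simp only [map_mul, h1]
  refine Pseudovariety.mem_of_injective _
    (N := ∀ c, (syntacticCon (K c)).Quotient) (MonoidHom.pi fun c => C.map _ (hK c)) ?_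
    (Pseudovariety.pi _ _ _ fun c => ?_)
  · intro x y h
    obtain ⟨v, rfl⟩ := Con.mk'_surjective x
    obtain ⟨w, rfl⟩ := Con.mk'_surjective y
    have h1 : syntacticCon (K (C.mk' v)) v w := (Con.eq _).1 (congrFun h (C.mk' v))
    have h2 := h1 [] []
    simp only [List.nil_append, List.append_nil] at h2
    exact (h2.1 rfl).symm
  · have : Finite (syntacticCon (K c)).Quotient :=
      Finite.of_surjective (C.map _ (hK c)) fun y => by
        obtain ⟨w, rfl⟩ := Con.mk'_surjective y
        exact ⟨C.mk' w, rfl⟩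
    exact Pseudovariety.mem_generated ⟨A, inferInstance, K c, definable_mk'_mem hm {c},
      ⟨MulEquiv.refl _⟩⟩

/-- The syntactic monoids of the definable languages are images of the generators of `condVar`. -/
theorem fo2Var_le_condVar (d : Dir) {m : ℕ} (hm : 1 ≤ m) : FO2Var m ≤ condVar d (m + 1) := by
  refine Pseudovariety.generated_le ?_
  rintro M _ ⟨A, _, L, hL, ⟨e⟩⟩
  refine Pseudovariety.mem_of_mulEquiv _ e ?_
  obtain ⟨N, h1, h2⟩ := hL.exists_condCon_le hm d
  refine Pseudovariety.image _ _ _ (Con.map _ _ h2) (fun y => ?_) (condCon_quotient_mem d h1)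
  obtain ⟨w, rfl⟩ := Con.mk'_surjective y
  exact ⟨(condCon A d (m + 1) N).mk' w, rfl⟩

/-! ### Recognized languages -/

/-- Morphisms from a free monoid lift along surjective morphisms. -/
theorem exists_comp_eq_of_surjective {A : Type u} {M N : Type*} [Monoid M] [Monoid N] {p : M →* N}
    (hp : Function.Surjective p) (f : FreeMonoid A →* N) :
    ∃ g : FreeMonoid A →* M, ∀ w, p (g w) = f w := by
  refine ⟨FreeMonoid.lift fun a => (hp (f (FreeMonoid.of a))).choose, fun w => ?_⟩
  rw [← MonoidHom.comp_apply]
  congr 1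
  exact FreeMonoid.hom_eq fun a => by simpa using (hp (f (FreeMonoid.of a))).choose_spec

/-- The pseudovariety of the finite monoids that recognize only definable languages, over
alphabets from a given universe. -/
def definableVar (m : ℕ) (hm : 1 ≤ m) : Pseudovariety where
  mem M _ := Finite M ∧ ∀ (A : Type u) [Finite A] (f : FreeMonoid A →* M) (S : Set M),
    Definable m fun w => f (FreeMonoid.ofList w) ∈ S
  finite _ _ h := h.1
  pi ι _ M _ h := by
    have : ∀ k, Finite (M k) := fun k => (h k).1
    refine ⟨inferInstance, fun A _ f S => (Definable.exists hm fun s : S => Definable.forall hm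
      fun k => (h k).2 A ((Pi.evalMonoidHom M k).comp f) {s.1 k}).congr fun w => ?_⟩
    simp [← funext_iff]
  submonoid M _ S h := by
    have : Finite M := h.1
    refine ⟨inferInstance, fun A _ f T => (h.2 A (S.subtype.comp f) (Subtype.val '' T)).congr
      fun w => ?_⟩
    simp
  image M N _ _ p hp h := by
    have : Finite M := h.1
    refine ⟨Finite.of_surjective p hp, fun A _ f S => ?_⟩
    obtain ⟨g, hg⟩ := exists_comp_eq_of_surjective hp f
    exact (h.2 A g (p ⁻¹' S)).congr fun w => by rw [Set.mem_preimage, hg]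

/-- A morphism to a generator of `condVar` factors through a morphism of free monoids. -/
theorem condVar_le_definableVar (d : Dir) {m : ℕ} (hm : 1 ≤ m) :
    condVar d m ≤ definableVar.{u} m hm := by
  refine Pseudovariety.generated_le ?_
  rintro M _ ⟨B, _, n, -, ⟨e⟩⟩
  refine Pseudovariety.mem_of_mulEquiv _ e ⟨finite_condCon_quotient d m n, fun A _ f S => ?_⟩
  obtain ⟨g, hg⟩ := exists_comp_eq_of_surjective (condCon B d m n).mk'_surjective f
  exact ((definable_mk'_mem hm S).comap hm g).congr fun w => by
    rw [FreeMonoid.ofList_toList, hg]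

theorem fo2Definable_of_mem_languages {A : Type u} [Finite A] {d : Dir} {m : ℕ} (hm : 1 ≤ m)
    {L : Language A} (hL : L ∈ (condVar d m).languages A) : FO2Definable m L := by
  obtain ⟨M, _, hM, f, hf⟩ := hL
  refine Definable.congr ((condVar_le_definableVar d hm M hM).2 A f
    {x | ∃ v ∈ L, f (FreeMonoid.ofList v) = x}) hf

theorem FO2Definable.mem_languages {A : Type u} [Finite A] {m : ℕ} (hm : 1 ≤ m) {L : Language A}
    (hL : FO2Definable m L) (d : Dir) : L ∈ (condVar d (m + 1)).languages A := by
  -- The generators of `condVar` live over alphabets in `Type`; so the alphabet is renamed.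
  obtain ⟨k, ⟨e⟩⟩ := Finite.exists_equiv_fin A
  let L' : Language (Fin k) :=
    {v | (FreeMonoid.map e.symm (FreeMonoid.ofList v)).toList ∈ L}
  have hL' : FO2Definable m L' := Definable.comap hm (FreeMonoid.map e.symm) hL
  obtain ⟨N, h1, h2⟩ := hL'.exists_condCon_le hm d
  have key : ∀ w : FreeMonoid A, (FreeMonoid.map e w).toList ∈ L' ↔ w.toList ∈ L := fun w => by
    change (FreeMonoid.map e.symm (FreeMonoid.map e w)).toList ∈ L ↔ _
    rw [FreeMonoid.map_map]
    simp
  refine ⟨_, _, condCon_quotient_mem (A := Fin k) d h1,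
    (condCon (Fin k) d (m + 1) N).mk'.comp (FreeMonoid.map e), fun w => ⟨fun h => ⟨w, h, rfl⟩, ?_⟩⟩
  rintro ⟨v, hv, h⟩
  have h3 := h2 ((Con.eq _).1 h) [] []
  simp only [List.nil_append, List.append_nil, key] at h3
  exact h3.1 hv

end FO2Alt

theorem mainTheorem1 (m : ℕ) (hm : 1 ≤ m) :
    (∀ (A : Type u) [Finite A] (L : Language A),
      L ∈ (RVar m).languages A ∨ L ∈ (LVar m).languages A → FO2Definable m L) ∧
    (∀ (A : Type u) [Finite A] (L : Language A),
      FO2Definable m L → L ∈ (RVar (m + 1)).languages A ∩ (LVar (m + 1)).languages A) ∧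
    RVar m ⊔ LVar m ≤ FO2Var m ∧ FO2Var m ≤ RVar (m + 1) ⊓ LVar (m + 1) := by
  refine ⟨fun A _ L h => ?_, fun A _ L h => ⟨h.mem_languages hm .X, h.mem_languages hm .Y⟩,
    Pseudovariety.generated_le fun M _ h => ?_,
    fun M _ h => ⟨fo2Var_le_condVar .X hm M h, fo2Var_le_condVar .Y hm M h⟩⟩
  · rcases h with h | h <;> exact fo2Definable_of_mem_languages hm h
  · rcases h with h | h <;> exact condVar_le_fo2Var _ hm M h
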